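/- Let $R=\bigoplus_{i\ge 0}[R]_i$ be a standard graded Gorenstein algebra over a field $K=[R]_0$. All modules are finitely generated graded $R$-modules, homomorphisms and isomorphisms preserve degrees, and $M(j)$ denotes the module $M$ with the grading $[M(j)]_i=[M]_{i+j}$. A module is called unmixed if all its associated primes have the same height, and $\operatorname{codim} M=\dim R-\dim M$. A module $C$ of codimension $c$ is called quasi-Gorenstein if it is perfect (that is, Cohen-Macaulay of finite projective dimension) and there are an integer $s$ and an isomorphism $\alpha\colon C\to \operatorname{Ext}^c_R(C,R)(s)$. For such $C$ let $\operatorname{Epi}(C)$ be the set of homomorphisms $\varphi$ from $C$ to some module with $\dim \operatorname{im}\varphi=\dim C$. For $\varphi\in\operatorname{Epi}(C)$ let $L_C(\varphi)\colon C\to\operatorname{Ext}^c_R(\ker\varphi,R)(s)$ be the composition of $\alpha$ with the homomorphism $\operatorname{Ext}^c_R(C,R)(s)\to\operatorname{Ext}^c_R(\ker\varphi,R)(s)$ induced by the inclusion $\ker\varphi\subset C$. Two modules $M,N$ are directly m-linked if there are a quasi-Gorenstein module $C$ and $\varphi,\psi\in\operatorname{Epi}(C)$ with $M=\operatorname{im}\varphi$,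 $N=\operatorname{im}\psi$, $M\cong\operatorname{im}L_C(\psi)$ and $N\cong\operatorname{im}L_C(\varphi)$. They are linked in $k$ steps if they are joined by a chain of $k$ direct m-links (modules being considered up to isomorphism), and evenly linked if this holds for some even $k$. The even m-liaison classes are the classes of the equivalence relation generated by even linkage. Then: (a) For every unmixed module $M$ and every integer $j$, the modules $M$ and $M(j)$ belong to the same even m-liaison class. (b) If $D$ is a quasi-Gorenstein module and $M$ is an unmixed module with $\dim M=\dim D$, then $M\oplus D$ is linked to $M$ in two steps. Moreover, (b) also holds if $R$ is a local Gorenstein ring, where all modules are finitely generated $R$-modules and gradings and shifts are omitted from the definitions above. -/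

import Mathlib

universe u v

namespace ModuleLiaison

open CategoryTheory

lemma isInternal_prod {ι : Type} [DecidableEq ι] {M N : Type u} [AddCommGroup M] [AddCommGroup N] (ℳ : ι → AddSubgroup M)
    (𝒩 : ι → AddSubgroup N) (hM : DirectSum.IsInternal ℳ) (hN : DirectSum.IsInternal 𝒩) :
    DirectSum.IsInternal fun i => (ℳ i).prod (𝒩 i) := by
  let f : ∀ i, ℳ i →+ (ℳ i).prod (𝒩 i) := fun i =>
    AddMonoidHom.mk' (fun x => ⟨(x, 0), x.2, zero_mem _⟩) (fun x y => by ext <;> simp)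
  let g : ∀ i, 𝒩 i →+ (ℳ i).prod (𝒩 i) := fun i =>
    AddMonoidHom.mk' (fun x => ⟨(0, x), zero_mem _, x.2⟩) (fun x y => by ext <;> simp)
  let p : ∀ i, (ℳ i).prod (𝒩 i) →+ ℳ i := fun i =>
    AddMonoidHom.mk' (fun x => ⟨x.1.1, x.2.1⟩) (fun x y => by ext; simp)
  let q : ∀ i, (ℳ i).prod (𝒩 i) →+ 𝒩 i := fun i =>
    AddMonoidHom.mk' (fun x => ⟨x.1.2, x.2.2⟩) (fun x y => by ext; simp)
  have hp : ∀ z, (DirectSum.coeAddMonoidHom (fun i => (ℳ i).prod (𝒩 i)) z).1 =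
      DirectSum.coeAddMonoidHom ℳ (DirectSum.map p z) := by
    intro z
    induction z using DirectSum.induction_on with
    | zero => simp
    | of i x => simp [p]
    | add x y hx hy => simp [hx, hy]
  have hq : ∀ z, (DirectSum.coeAddMonoidHom (fun i => (ℳ i).prod (𝒩 i)) z).2 =
      DirectSum.coeAddMonoidHom 𝒩 (DirectSum.map q z) := by
    intro z
    induction z using DirectSum.induction_on with
    | zero => simp
    | of i x => simp [q]
    | add x y hx hy => simp [hx, hy]
  constructor
  · refine (injective_iff_map_eq_zero _).2 fun z hz => ?_
    have h1 : DirectSum.map p z = 0 := hM.1 (by rw [← hp, hz, map_zero]; rfl)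
    have h2 : DirectSum.map q z = 0 := hN.1 (by rw [← hq, hz, map_zero]; rfl)
    refine DFinsupp.ext fun i => ?_
    have h1' := congrArg (fun w => ((w i : ℳ i) : M)) h1
    have h2' := congrArg (fun w => ((w i : 𝒩 i) : N)) h2
    simp only [DirectSum.map_apply] at h1' h2'
    exact Subtype.ext (Prod.ext h1' h2')
  · rintro ⟨x, y⟩
    obtain ⟨a, rfl⟩ := hM.2 x
    obtain ⟨b, rfl⟩ := hN.2 y
    refine ⟨DirectSum.map f a + DirectSum.map g b, Prod.ext ?_ ?_⟩
    · rw [hp]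
      have h1 : DirectSum.map p (DirectSum.map f a) = a := by
        refine DFinsupp.ext fun i => ?_
        simp [p, f]
      have h2 : DirectSum.map p (DirectSum.map g b) = 0 := by
        refine DFinsupp.ext fun i => ?_
        simp [p, g]
      rw [map_add, h1, h2, add_zero]
    · rw [hq]
      have h1 : DirectSum.map q (DirectSum.map f a) = 0 := by
        refine DFinsupp.ext fun i => ?_
        simp [q, f]
      have h2 : DirectSum.map q (DirectSum.map g b) = b := by
        refine DFinsupp.ext fun i => ?_
        simp [q, g]
      rw [map_add, h1, h2, zero_add]

section Rings

variable {ι : Type} [AddCommGroup ι] {R : Type u} [CommRing R]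

/-- A Gorenstein ring: a Noetherian ring all of whose localizations at maximal ideals have finite
injective dimension over themselves. -/
structure IsGorensteinRing (R : Type u) [CommRing R] : Prop where
  noetherian : IsNoetherianRing R
  injDim : ∀ (m : Ideal R) [m.IsMaximal], ∃ n : ℕ, HasInjectiveDimensionLE
    (ModuleCat.of (Localization.AtPrime m) (Localization.AtPrime m)) n

/-- `R = ⊕ 𝒜 i` is a standard graded algebra over the field `K`: it is concentrated in degrees
`≥ 0`, its degree zero part is `K`, and it is generated over `K` by its elements of degree one
(of which finitely many suffice when `R` is Noetherian). -/
structure IsStandardGraded (K : Type*) [Field K] [Algebra K R] (𝒜 : ℤ → AddSubgroup R) : Prop where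
  nontrivial : Nontrivial R
  neg : ∀ i < 0, 𝒜 i = ⊥
  zero : 𝒜 0 = (algebraMap K R).range.toAddSubgroup
  adjoin : Algebra.adjoin K (𝒜 1 : Set R) = ⊤

/-- The ideal generated by the homogeneous nonunits. For a standard graded algebra over a field
this is the irrelevant ideal `⊕_{i > 0} 𝒜 i`; for a local ring concentrated in degree zero it is
the maximal ideal. -/
def homogMaxIdeal (𝒜 : ι → AddSubgroup R) : Ideal R :=
  Ideal.span {a | SetLike.IsHomogeneousElem 𝒜 a ∧ ¬ IsUnit a}

end Rings

section Modules

variable {ι : Type} [AddCommGroup ι] [DecidableEq ι] {R : Type u} [CommRing R]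

/-- A finitely generated graded module over the graded ring `R = ⊕ 𝒜 i`. -/
structure GradedMod (𝒜 : ι → AddSubgroup R) where
  carrier : Type u
  [addCommGroup : AddCommGroup carrier]
  [module : Module R carrier]
  [finite : Module.Finite R carrier]
  /-- the homogeneous components -/
  deg : ι → AddSubgroup carrier
  isInternal : DirectSum.IsInternal deg
  smul_mem : ∀ {i j : ι} {a : R} {x : carrier}, a ∈ 𝒜 i → x ∈ deg j → a • x ∈ deg (i + j)

attribute [instance] GradedMod.addCommGroup GradedMod.module GradedMod.finite

instance (𝒜 : ι → AddSubgroup R) : CoeSort (GradedMod 𝒜) (Type u) := ⟨GradedMod.carrier⟩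

variable {𝒜 : ι → AddSubgroup R}

lemma isInternal_shift {M : Type u} [AddCommGroup M] (ℳ : ι → AddSubgroup M)
    (hM : DirectSum.IsInternal ℳ) (j : ι) : DirectSum.IsInternal fun i => ℳ (i + j) := by
  let E := DirectSum.equivCongrLeft (β := fun i => ℳ i) (Equiv.addRight j).symm
  let F : (DirectSum ι fun i => ℳ (i + j)) →+ DirectSum ι fun i => ℳ i :=
    E.symm.toAddMonoidHom
  have hF : Function.Bijective F := E.symm.bijective
  have h : DirectSum.coeAddMonoidHom (fun i => ℳ (i + j)) =
      (DirectSum.coeAddMonoidHom ℳ).comp F := by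
    refine DirectSum.addHom_ext fun i x => ?_
    have hFx : F (DirectSum.of (fun i => ℳ (i + j)) i x) =
        DirectSum.of (fun i => ℳ i) (i + j) x :=
      E.symm_apply_eq.2
        (DirectSum.equivCongrLeft_of (β := fun i => ℳ i) (Equiv.addRight j).symm i x).symm
    rw [AddMonoidHom.comp_apply, hFx, DirectSum.coeAddMonoidHom_of, DirectSum.coeAddMonoidHom_of]
  unfold DirectSum.IsInternal
  rw [h]
  exact hM.comp hF

/-- The shifted module `M(j)`, with `[M(j)]_i = [M]_{i+j}`. -/
def GradedMod.shift (M : GradedMod 𝒜) (j : ι) : GradedMod 𝒜 where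
  carrier := M
  deg i := M.deg (i + j)
  isInternal := isInternal_shift M.deg M.isInternal j
  smul_mem {i k a x} ha hx := by
    have := M.smul_mem ha hx
    rwa [← add_assoc] at this

/-- The direct sum `M ⊕ N` of graded modules. -/
def GradedMod.directSum (M N : GradedMod 𝒜) : GradedMod 𝒜 where
  carrier := M × N
  deg i := (M.deg i).prod (N.deg i)
  isInternal := isInternal_prod M.deg N.deg M.isInternal N.isInternal
  smul_mem ha hx := ⟨M.smul_mem ha hx.1, N.smul_mem ha hx.2⟩

/-- `M ≅ N` as graded modules. -/
def GradedMod.Iso (M N : GradedMod 𝒜) : Prop :=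
  ∃ e : M ≃ₗ[R] N, ∀ i x, x ∈ M.deg i ↔ e x ∈ N.deg i

/-- `codim M = c`, where `codim M = dim R - dim M`. -/
def HasCodim (M : GradedMod 𝒜) (c : ℕ) : Prop :=
  Module.supportDim R M + c = ringKrullDim R

/-- All associated primes of `M` have the same height. -/
def IsUnmixed (M : GradedMod 𝒜) : Prop :=
  ∀ p ∈ associatedPrimes R M, ∀ q ∈ associatedPrimes R M, p.height = q.height

/-- `M` is Cohen-Macaulay: there is an `M`-regular sequence of length `dim M` in the (homogeneous)
maximal ideal. In particular `M ≠ 0`. -/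
def IsCohenMacaulay (M : GradedMod 𝒜) : Prop :=
  ∃ rs : List R, (∀ r ∈ rs, r ∈ homogMaxIdeal 𝒜) ∧ RingTheory.Sequence.IsRegular M rs ∧
    (rs.length : WithBot ℕ∞) = Module.supportDim R M

/-- A perfect module: a Cohen-Macaulay module of finite projective dimension. -/
def IsPerfect (M : GradedMod 𝒜) : Prop :=
  IsCohenMacaulay M ∧ ∃ n : ℕ, HasProjectiveDimensionLE (ModuleCat.of R M) n

end Modules

section Ext

variable {ι : Type} [AddCommGroup ι] {R : Type u} [CommRing R] (𝒜 : ι → AddSubgroup R)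

/-- The homogeneous components of the graded free module `⊕ₖ R(-aₖ)`, i.e. of the free module on a
basis `(eₖ)` with `eₖ` of degree `aₖ`. -/
def freeDeg {r : ℕ} (a : Fin r → ι) (i : ι) : AddSubgroup (Fin r → R) :=
  AddSubgroup.pi Set.univ fun k => 𝒜 (i - a k)

/-- The homogeneous components of the `R`-dual `F^*` of `F = ⊕ₖ R(-aₖ)`: a linear form is of degree
`i` if it maps `[F]_t` into `[R]_{t+i}` for all `t`. -/
def dualDeg {r : ℕ} (a : Fin r → ι) (i : ι) : AddSubgroup ((Fin r → R) →ₗ[R] R) where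
  carrier := {f | ∀ t, ∀ x ∈ freeDeg 𝒜 a t, f x ∈ 𝒜 (t + i)}
  zero_mem' _ _ _ := zero_mem _
  add_mem' hf hg t x hx := add_mem (hf t x hx) (hg t x hx)
  neg_mem' hf t x hx := neg_mem (hf t x hx)

/-- The grading induced on a submodule. -/
def inducedDeg {M : Type u} [AddCommGroup M] [Module R M] (ℳ : ι → AddSubgroup M)
    (S : Submodule R M) (i : ι) : AddSubgroup S :=
  (ℳ i).comap S.subtype.toAddMonoidHom

/-- A graded free resolution `⋯ → F₂ → F₁ → F₀ → M → 0` of the graded module `(M, ℳ)` by graded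
free modules of finite rank and homomorphisms of degree zero. -/
structure FreeRes {M : Type u} [AddCommGroup M] [Module R M] (ℳ : ι → AddSubgroup M) where
  rank : ℕ → ℕ
  gen : ∀ n, Fin (rank n) → ι
  d : ∀ n, (Fin (rank (n + 1)) → R) →ₗ[R] (Fin (rank n) → R)
  ε : (Fin (rank 0) → R) →ₗ[R] M
  d_deg : ∀ n i, ∀ x ∈ freeDeg 𝒜 (gen (n + 1)) i, d n x ∈ freeDeg 𝒜 (gen n) i
  ε_deg : ∀ i, ∀ x ∈ freeDeg 𝒜 (gen 0) i, ε x ∈ ℳ i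
  ε_surjective : Function.Surjective ε
  exact_zero : Function.Exact (d 0) ε
  exact_succ : ∀ n, Function.Exact (d (n + 1)) (d n)

namespace FreeRes

variable {𝒜} {M N : Type u} [AddCommGroup M] [Module R M] [AddCommGroup N] [Module R N]
  {ℳ : ι → AddSubgroup M} {𝒩 : ι → AddSubgroup N}

/-- The cocycles in degree `c` of the complex `0 → F₀^* → F₁^* → F₂^* → ⋯`. -/
def cocycles (P : FreeRes 𝒜 ℳ) (c : ℕ) : Submodule R ((Fin (P.rank c) → R) →ₗ[R] R) :=
  LinearMap.ker (LinearMap.lcomp R R (P.d c))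

/-- The coboundaries in degree `c` of the complex `0 → F₀^* → F₁^* → F₂^* → ⋯`. -/
def coboundaries (P : FreeRes 𝒜 ℳ) :
    (c : ℕ) → Submodule R ((Fin (P.rank c) → R) →ₗ[R] R)
  | 0 => ⊥
  | c + 1 => LinearMap.range (LinearMap.lcomp R R (P.d c))

/-- `Ext^c_R(M, R)`, computed from the resolution `P` of `M`: the module of cocycles modulo
coboundaries, as a submodule of the module of cochains modulo coboundaries. -/
abbrev Ext (P : FreeRes 𝒜 ℳ) (c : ℕ) :
    Submodule R (((Fin (P.rank c) → R) →ₗ[R] R) ⧸ P.coboundaries c) :=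
  (P.cocycles c).map (P.coboundaries c).mkQ

/-- The homogeneous components of `Ext^c_R(M, R)`: the classes of the homogeneous cocycles. -/
def extDeg (P : FreeRes 𝒜 ℳ) (c : ℕ) (i : ι) : AddSubgroup (P.Ext c) :=
  ((dualDeg 𝒜 (P.gen c) i ⊓ (P.cocycles c).toAddSubgroup).map
    (P.coboundaries c).mkQ.toAddMonoidHom).comap (P.Ext c).subtype.toAddMonoidHom

/-- A lift of the homomorphism `f : N → M` to a morphism of complexes (of degree zero) from a
graded free resolution `Q` of `N` to a graded free resolution `P` of `M`. -/
structure Lift (Q : FreeRes 𝒜 𝒩) (P : FreeRes 𝒜 ℳ) (f : N →ₗ[R] M) where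
  map : ∀ n, (Fin (Q.rank n) → R) →ₗ[R] (Fin (P.rank n) → R)
  map_deg : ∀ n i, ∀ x ∈ freeDeg 𝒜 (Q.gen n) i, map n x ∈ freeDeg 𝒜 (P.gen n) i
  comm_ε : P.ε ∘ₗ map 0 = f ∘ₗ Q.ε
  comm_d : ∀ n, P.d n ∘ₗ map (n + 1) = map n ∘ₗ Q.d n

namespace Lift

variable {Q : FreeRes 𝒜 𝒩} {P : FreeRes 𝒜 ℳ} {f : N →ₗ[R] M}

lemma map_cocycles (h : Lift Q P f) (c : ℕ) :
    ∀ x ∈ P.cocycles c, LinearMap.lcomp R R (h.map c) x ∈ Q.cocycles c := by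
  intro x hx
  have hx' : x ∘ₗ P.d c = 0 := hx
  change (x ∘ₗ h.map c) ∘ₗ Q.d c = 0
  rw [LinearMap.comp_assoc, ← h.comm_d, ← LinearMap.comp_assoc, hx', LinearMap.zero_comp]

lemma map_coboundaries (h : Lift Q P f) (c : ℕ) :
    ∀ x ∈ P.coboundaries c, LinearMap.lcomp R R (h.map c) x ∈ Q.coboundaries c := by
  intro x hx
  cases c with
  | zero =>
    have hx' : x = 0 := hx
    subst hx'
    rw [map_zero]
    exact zero_mem _
  | succ c =>
    obtain ⟨y, rfl⟩ := hx
    refine ⟨LinearMap.lcomp R R (h.map c) y, ?_⟩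
    change (y ∘ₗ h.map c) ∘ₗ Q.d c = (y ∘ₗ P.d c) ∘ₗ h.map (c + 1)
    rw [LinearMap.comp_assoc, LinearMap.comp_assoc, h.comm_d]

/-- The induced homomorphism `Ext^c_R(M, R) → Ext^c_R(N, R)`. -/
def extMap (h : Lift Q P f) (c : ℕ) : P.Ext c →ₗ[R] Q.Ext c :=
  (Submodule.mapQ (P.coboundaries c) (Q.coboundaries c) (LinearMap.lcomp R R (h.map c))
    (h.map_coboundaries c)).restrict (by
      rintro _ ⟨x, hx, rfl⟩
      exact ⟨_, h.map_cocycles c x hx, rfl⟩)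

end Lift

end FreeRes

end Ext

section Liaison

variable {ι : Type} [AddCommGroup ι] [DecidableEq ι] {R : Type u} [CommRing R]
  {𝒜 : ι → AddSubgroup R}

/-- The codimension `c` of `C` together with an isomorphism `α : C ≅ Ext^c_R(C, R)(s)` of graded
modules, where `Ext^c_R(C, R)` is computed from the resolution `res` of `C`. -/
structure SelfDuality (C : GradedMod 𝒜) where
  c : ℕ
  codim : HasCodim C c
  res : FreeRes 𝒜 C.deg
  s : ι
  α : C ≃ₗ[R] res.Ext c
  α_deg : ∀ i x, x ∈ C.deg i ↔ α x ∈ res.extDeg c (i + s)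

/-- A quasi-Gorenstein module: a perfect module that is isomorphic to its canonical module
`Ext^{codim C}_R(C, R)` up to a shift. -/
def IsQuasiGorenstein (C : GradedMod 𝒜) : Prop :=
  IsPerfect C ∧ Nonempty (SelfDuality C)

/-- The data of an element of `Epi(C)` with image `M`: a surjective homomorphism of graded modules
`C → M` where `dim M = dim C`. -/
structure EpiOnto (C M : GradedMod 𝒜) where
  φ : C →ₗ[R] M
  φ_deg : ∀ i, ∀ x ∈ C.deg i, φ x ∈ M.deg i
  surjective : Function.Surjective φ
  dim_eq : Module.supportDim R M = Module.supportDim R C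

/-- The homomorphism `L_C(φ) : C ≅ Ext^c_R(C, R)(s) → Ext^c_R(ker φ, R)(s)`. Here
`Ext^c_R(ker φ, R)` is computed from the resolution `Q` of `ker φ`, and `h` is a lift of the
inclusion `ker φ → C` to the resolutions. -/
def linkingMap {C M : GradedMod 𝒜} (S : SelfDuality C) (φ : EpiOnto C M)
    (Q : FreeRes 𝒜 (inducedDeg C.deg (LinearMap.ker φ.φ)))
    (h : FreeRes.Lift Q S.res (LinearMap.ker φ.φ).subtype) : C →ₗ[R] Q.Ext S.c :=
  h.extMap S.c ∘ₗ S.α.toLinearMap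

/-- `N ≅ im L_C(φ)` as graded modules. -/
def IsoLinkingImage {C M : GradedMod 𝒜} (S : SelfDuality C) (φ : EpiOnto C M)
    (N : GradedMod 𝒜) : Prop :=
  ∃ (Q : FreeRes 𝒜 (inducedDeg C.deg (LinearMap.ker φ.φ)))
    (h : FreeRes.Lift Q S.res (LinearMap.ker φ.φ).subtype)
    (e : N ≃ₗ[R] LinearMap.range (linkingMap S φ Q h)),
    ∀ i x, x ∈ N.deg i ↔ (e x : Q.Ext S.c) ∈ Q.extDeg S.c (i + S.s)

/-- `M` and `N` are module linked in one step (directly m-linked): for some quasi-Gorenstein module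
`C` there are `φ, ψ ∈ Epi(C)` with `M = im φ`, `N = im ψ`, `M ≅ im L_C(ψ)`, `N ≅ im L_C(φ)`. -/
def DirectlyLinked (M N : GradedMod 𝒜) : Prop :=
  ∃ (C : GradedMod 𝒜) (S : SelfDuality C) (φ : EpiOnto C M) (ψ : EpiOnto C N),
    IsQuasiGorenstein C ∧ IsoLinkingImage S ψ M ∧ IsoLinkingImage S φ N

/-- `M` and `N` are linked in `s` steps. Modules are considered up to isomorphism. -/
def LinkedInSteps : ℕ → GradedMod 𝒜 → GradedMod 𝒜 → Prop
  | 0, M, N => M.Iso N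
  | s + 1, M, N => ∃ M', DirectlyLinked M M' ∧ LinkedInSteps s M' N

/-- `M` and `N` are linked in an even number of steps. -/
def EvenlyLinked (M N : GradedMod 𝒜) : Prop :=
  ∃ s, Even s ∧ LinkedInSteps s M N

/-- `M` and `N` belong to the same even m-liaison class, i.e. the same class of the equivalence
relation generated by even linkage. -/
def SameEvenLiaisonClass (M N : GradedMod 𝒜) : Prop :=
  Relation.EqvGen EvenlyLinked M N

end Liaison

end ModuleLiaison

set_option linter.unusedSectionVars false

/-! Let c be the codimension of the modules at hand, J an ideal generated by a homogeneous regular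
sequence of length c that annihilates them, and A = R/J. For modules X killed by J, Rees'
isomorphism Hom(X, A) ≅ Ext^c(X, R) is natural and shifts degrees by a constant
(`FreeRes.exists_rees`, `FreeRes.rees_mem_extDeg`, `FreeRes.extMap_rees`). It turns a self-duality
of C into a perfect A-valued pairing on C. Then L_C(φ) sends x to the restriction of ⟨x, ·⟩ to ker
φ, so its image is C/(ker φ)^⊥. Hence two mutually orthogonal graded submodules of C give a direct
link between the two quotients (`PerfectPairing.directlyLinked`).

Let F → M be a surjection from a graded free A-module, with kernel K, and let F^* be the dual of F,
suitably shifted. In F ⊕ F^* with its hyperbolic pairing, K ⊕ F^* and 0 ⊕ K^⊥ are mutually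
orthogonal, so M is linked to N' = F^*/K^⊥ ⊕ F. In the orthogonal sum of F ⊕ F^* and D, the
submodules K ⊕ F^* ⊕ 0 and 0 ⊕ K^⊥ ⊕ D are mutually orthogonal, so M ⊕ D is linked to the same N'.
This is (b).

For (a), F is chosen to be itself hyperbolic, hence self-dual and quasi-Gorenstein. With N = F/K^⊥,
M is linked to N ⊕ F. Shifting only the first argument of the pairing links M(j) to N ⊕ F(j) with
the same N. By (b) both N ⊕ F and N ⊕ F(j) are linked to N in two steps, so M and M(j) are joined by
six links.

The input from commutative algebra is K^⊥⊥ = K, that is, Hom(M, A) separates the elements of M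
(`exists_map_ne_zero`). Unmixedness forces the associated primes of M to be associated primes of A.
At such a prime p the ring A_p has a socle element, and together with the finite injective dimension
of R_p this makes A_p self-injective (`exists_extension_of_socle`). What is needed of the grading,
in both the local and the standard graded case, is collected in `GoodGrading`. -/

namespace ModuleLiaison

open CategoryTheory

/-! ### Homogeneous components -/

section Projections

variable {ι : Type} [DecidableEq ι] {M N : Type u} [AddCommGroup M] [AddCommGroup N]

/-- The projection onto a homogeneous component. -/
noncomputable def gproj {ℳ : ι → AddSubgroup M} (h : DirectSum.IsInternal ℳ) (i : ι) : M →+ M :=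
  (ℳ i).subtype.comp ((DFinsupp.evalAddMonoidHom i).comp
    (AddEquiv.ofBijective (DirectSum.coeAddMonoidHom ℳ) h).symm.toAddMonoidHom)

section

variable {ℳ : ι → AddSubgroup M} (h : DirectSum.IsInternal ℳ)

lemma gproj_mem (i : ι) (x : M) : gproj h i x ∈ ℳ i := Subtype.coe_prop _

lemma gproj_coe (i : ι) (z : DirectSum ι fun i => ℳ i) :
    gproj h i (DirectSum.coeAddMonoidHom ℳ z) = z i := by
  have : (AddEquiv.ofBijective (DirectSum.coeAddMonoidHom ℳ) h).symm
      (DirectSum.coeAddMonoidHom ℳ z) = z :=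
    (AddEquiv.ofBijective (DirectSum.coeAddMonoidHom ℳ) h).symm_apply_apply z
  change (((AddEquiv.ofBijective (DirectSum.coeAddMonoidHom ℳ) h).symm
      (DirectSum.coeAddMonoidHom ℳ z)) i : M) = z i
  rw [this]

lemma gproj_of_mem {i : ι} {x : M} (hx : x ∈ ℳ i) : gproj h i x = x := by
  have := gproj_coe h i (DirectSum.of (fun i => ℳ i) i ⟨x, hx⟩)
  rwa [DirectSum.coeAddMonoidHom_of, DirectSum.of_eq_same] at this

lemma gproj_of_mem_ne {i j : ι} {x : M} (hx : x ∈ ℳ i) (hij : i ≠ j) : gproj h j x = 0 := by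
  have := gproj_coe h j (DirectSum.of (fun i => ℳ i) i ⟨x, hx⟩)
  rwa [DirectSum.coeAddMonoidHom_of, DirectSum.of_eq_of_ne _ _ _ hij.symm] at this

lemma gproj_ext {x : M} (hx : ∀ i, gproj h i x = 0) : x = 0 := by
  obtain ⟨z, rfl⟩ := h.2 x
  have : z = 0 := DFinsupp.ext fun i => Subtype.ext (by
    rw [← gproj_coe h i z, hx i]; rfl)
  rw [this, map_zero]

lemma exists_gproj_sum (x : M) : ∃ s : Finset ι, x = ∑ i ∈ s, gproj h i x := by
  obtain ⟨z, rfl⟩ := h.2 x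
  classical
  refine ⟨DFinsupp.support z, ?_⟩
  conv_lhs => rw [DirectSum.coeAddMonoidHom_eq_dfinsuppSum]
  exact Finset.sum_congr rfl fun i _ => (gproj_coe h i z).symm

lemma homogeneous_induction (h : DirectSum.IsInternal ℳ) {P : M → Prop} (x : M) (zero : P 0)
    (hom : ∀ i, ∀ x ∈ ℳ i, P x) (add : ∀ x y, P x → P y → P (x + y)) : P x := by
  obtain ⟨s, hs⟩ := exists_gproj_sum h x
  rw [hs]
  exact Finset.sum_induction _ P add zero fun i _ => hom i _ (gproj_mem h i x)

lemma gproj_map {κ : Type} [DecidableEq κ] {𝒩 : κ → AddSubgroup N} (h' : DirectSum.IsInternal 𝒩)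
    (e : ι → κ) (he : Function.Injective e) (f : M →+ N)
    (hf : ∀ i, ∀ x ∈ ℳ i, f x ∈ 𝒩 (e i)) (i : ι) (x : M) :
    gproj h' (e i) (f x) = f (gproj h i x) := by
  refine homogeneous_induction h (P := fun x => gproj h' (e i) (f x) = f (gproj h i x)) x
    (by simp) (fun j x hx => ?_) (fun x y hx hy => by simp only [map_add, hx, hy])
  by_cases hij : j = i
  · subst hij
    rw [gproj_of_mem h hx, gproj_of_mem h' (hf _ _ hx)]
  · rw [gproj_of_mem_ne h hx hij, gproj_of_mem_ne h' (hf _ _ hx) (fun h => hij (he h)), map_zero]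

end

lemma isInternal_of_proj {ℳ : ι → AddSubgroup M} (p : ι → M →+ M)
    (h₁ : ∀ i x, x ∈ ℳ i → p i x = x)
    (h₂ : ∀ i j x, x ∈ ℳ i → i ≠ j → p j x = 0) (h₃ : ∀ x, x ∈ ⨆ i, ℳ i) :
    DirectSum.IsInternal ℳ := by
  have hp : ∀ (z : DirectSum ι fun i => ℳ i) i, p i (DirectSum.coeAddMonoidHom ℳ z) = z i := by
    intro z i
    induction z using DirectSum.induction_on with
    | zero => simp
    | of j x =>
      rw [DirectSum.coeAddMonoidHom_of]
      by_cases hij : j = i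
      · subst hij
        rw [DirectSum.of_eq_same, h₁ _ _ x.2]
      · rw [DirectSum.of_eq_of_ne _ _ _ (Ne.symm hij), h₂ _ _ _ x.2 hij]; rfl
    | add x y hx hy => simp [hx, hy]
  constructor
  · refine (injective_iff_map_eq_zero _).2 fun z hz => DFinsupp.ext fun i => Subtype.ext ?_
    rw [← hp, hz, map_zero]; rfl
  · intro x
    have : (⨆ i, ℳ i) ≤ (DirectSum.coeAddMonoidHom ℳ).range := iSup_le fun i y hy =>
      ⟨DirectSum.of (fun i => ℳ i) i ⟨y, hy⟩, DirectSum.coeAddMonoidHom_of _ _ _⟩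
    exact this (h₃ x)

end Projections

/-! ### Graded submodules, quotients and sums; the graded Nakayama lemma -/

section Graded

variable {ι : Type} [AddCommGroup ι] [DecidableEq ι] {R : Type u} [CommRing R]
  {𝒜 : ι → AddSubgroup R}

namespace GradedMod

/-- The projection of a graded module onto its component of degree `i`. -/
noncomputable def comp (X : GradedMod 𝒜) (i : ι) : X →+ X := gproj X.isInternal i

variable (X Y : GradedMod 𝒜)

lemma comp_mem (i : ι) (x : X) : X.comp i x ∈ X.deg i := gproj_mem _ _ _

variable {X Y}

lemma comp_of_mem {i : ι} {x : X} (hx : x ∈ X.deg i) : X.comp i x = x := gproj_of_mem _ hx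

lemma comp_of_mem_ne {i j : ι} {x : X} (hx : x ∈ X.deg i) (hij : i ≠ j) : X.comp j x = 0 :=
  gproj_of_mem_ne _ hx hij

lemma comp_ext {x : X} (hx : ∀ i, X.comp i x = 0) : x = 0 := gproj_ext _ hx

variable (X) in
lemma exists_sum_comp (x : X) : ∃ s : Finset ι, x = ∑ i ∈ s, X.comp i x := exists_gproj_sum _ x

@[elab_as_elim]
lemma induction {P : X → Prop} (x : X) (zero : P 0)
    (hom : ∀ i, ∀ x ∈ X.deg i, P x) (add : ∀ x y, P x → P y → P (x + y)) : P x :=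
  homogeneous_induction X.isInternal x zero hom add

lemma comp_map (f : X →ₗ[R] Y) (hf : ∀ i, ∀ x ∈ X.deg i, f x ∈ Y.deg i) (i : ι) (x : X) :
    Y.comp i (f x) = f (X.comp i x) :=
  gproj_map X.isInternal Y.isInternal id Function.injective_id f.toAddMonoidHom hf i x

lemma comp_map_shift (d : ι) (f : X →ₗ[R] Y) (hf : ∀ i, ∀ x ∈ X.deg i, f x ∈ Y.deg (i + d))
    (i : ι) (x : X) : Y.comp (i + d) (f x) = f (X.comp i x) :=
  gproj_map X.isInternal Y.isInternal (· + d) (add_left_injective d) f.toAddMonoidHom hf i x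

lemma comp_smul {j : ι} {a : R} (ha : a ∈ 𝒜 j) (i : ι) (x : X) :
    X.comp (i + j) (a • x) = a • X.comp i x :=
  comp_map_shift (X := X) (Y := X) j (LinearMap.lsmul R X a)
    (fun i x hx => by rw [add_comm]; exact X.smul_mem ha hx) i x

variable (X) in
lemma exists_homogeneous_generators : ∃ (r : ℕ) (a : Fin r → ι) (x : Fin r → X),
    (∀ k, x k ∈ X.deg (a k)) ∧ Submodule.span R (Set.range x) = ⊤ := by
  classical
  obtain ⟨S, hS⟩ := (Module.Finite.fg_top : (⊤ : Submodule R X).FG)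
  choose t ht using X.exists_sum_comp
  let T : Finset X := S.biUnion fun y => (t y).image fun i => X.comp i y
  have hT : ∀ z : T, ∃ i, (z : X) ∈ X.deg i := by
    rintro ⟨z, hz⟩
    obtain ⟨y, -, hy⟩ := Finset.mem_biUnion.1 hz
    obtain ⟨i, -, rfl⟩ := Finset.mem_image.1 hy
    exact ⟨i, X.comp_mem i y⟩
  choose a ha using hT
  refine ⟨T.card, fun k => a (T.equivFin.symm k), fun k => T.equivFin.symm k, fun k => ha _, ?_⟩
  refine top_le_iff.1 (hS ▸ Submodule.span_le.2 fun y hy => ?_)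
  rw [SetLike.mem_coe, ht y]
  refine sum_mem fun i hi => Submodule.subset_span ?_
  have : X.comp i y ∈ T := Finset.mem_biUnion.2 ⟨y, hy, Finset.mem_image_of_mem _ hi⟩
  exact ⟨T.equivFin ⟨_, this⟩, by simp⟩

/-- A graded submodule. -/
def IsHomog (X : GradedMod 𝒜) (K : Submodule R X) : Prop := ∀ i, ∀ x ∈ K, X.comp i x ∈ K

lemma isHomog_ker {f : X →ₗ[R] Y} (hf : ∀ i, ∀ x ∈ X.deg i, f x ∈ Y.deg i) :
    X.IsHomog (LinearMap.ker f) := fun i x hx => by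
  rw [LinearMap.mem_ker, ← comp_map f hf, LinearMap.mem_ker.1 hx, map_zero]

/-- The graded module given by a graded submodule. -/
abbrev sub (X : GradedMod 𝒜) [IsNoetherianRing R] (K : Submodule R X) (hK : X.IsHomog K) :
    GradedMod 𝒜 where
  carrier := K
  finite := inferInstance
  deg := inducedDeg X.deg K
  isInternal := by
    let p : ι → K →+ K := fun i => AddMonoidHom.mk' (fun x => ⟨X.comp i x, hK i x x.2⟩)
      (fun x y => by ext; simp)
    refine isInternal_of_proj p (fun i x hx => Subtype.ext (comp_of_mem (i := i) hx))
      (fun i j x hx hij => Subtype.ext (comp_of_mem_ne (i := i) hx hij)) fun x => ?_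
    obtain ⟨s, hs⟩ := X.exists_sum_comp x
    have : x = ∑ i ∈ s, p i x := Subtype.ext (by
      rw [AddSubmonoidClass.coe_finsetSum]; exact hs)
    rw [this]
    exact sum_mem fun i _ => AddSubgroup.mem_iSup_of_mem i (X.comp_mem i x)
  smul_mem ha hx := X.smul_mem ha hx

/-- The quotient by a graded submodule. -/
abbrev quot (X : GradedMod 𝒜) (K : Submodule R X) (hK : X.IsHomog K) : GradedMod 𝒜 where
  carrier := X ⧸ K
  finite := inferInstance
  deg i := (X.deg i).map K.mkQ.toAddMonoidHom
  isInternal := by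
    let p : ι → (X ⧸ K) →+ (X ⧸ K) := fun i =>
      QuotientAddGroup.map K.toAddSubgroup K.toAddSubgroup (X.comp i) (hK i)
    have hp : ∀ i x, p i (K.mkQ x) = K.mkQ (X.comp i x) := fun i x => rfl
    refine isInternal_of_proj p ?_ ?_ fun x => ?_
    · rintro i _ ⟨x, hx, rfl⟩
      exact (hp i x).trans (congrArg K.mkQ (comp_of_mem hx))
    · rintro i j _ ⟨x, hx, rfl⟩ hij
      exact (hp j x).trans ((congrArg K.mkQ (comp_of_mem_ne hx hij)).trans (map_zero _))
    · obtain ⟨x, rfl⟩ := K.mkQ_surjective x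
      obtain ⟨s, hs⟩ := X.exists_sum_comp x
      rw [hs, map_sum]
      exact sum_mem fun i _ => AddSubgroup.mem_iSup_of_mem i ⟨_, X.comp_mem i x, rfl⟩
  smul_mem := by
    rintro i j a _ ha ⟨x, hx, rfl⟩
    exact ⟨a • x, X.smul_mem ha hx, map_smul K.mkQ _ _⟩

lemma mkQ_mem_quot_deg {K : Submodule R X} {hK : X.IsHomog K} {i : ι} {x : X}
    (hx : x ∈ X.deg i) : K.mkQ x ∈ (X.quot K hK).deg i := ⟨x, hx, rfl⟩

/-- The graded module `⊕ₖ X(-aₖ)`. -/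
abbrev pi (X : GradedMod 𝒜) {κ : Type} [Finite κ] (a : κ → ι) : GradedMod 𝒜 where
  carrier := κ → X
  finite := Module.Finite.pi
  deg i := AddSubgroup.pi Set.univ fun k => X.deg (i - a k)
  isInternal := by
    classical
    have := Fintype.ofFinite κ
    let p : ι → (κ → X) →+ (κ → X) := fun i =>
      AddMonoidHom.mk' (fun x k => X.comp (i - a k) (x k)) (fun x y => by ext; simp)
    refine isInternal_of_proj p (fun i x hx => funext fun k => comp_of_mem (hx k trivial))
      (fun i j x hx hij => funext fun k => comp_of_mem_ne (hx k trivial) (by simpa using hij))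
      fun x => ?_
    rw [← Finset.univ_sum_single x]
    refine sum_mem fun k _ => ?_
    obtain ⟨s, hs⟩ := X.exists_sum_comp (x k)
    have hs' : Pi.single k (x k) = ∑ i ∈ s, (Pi.single k (X.comp i (x k)) : κ → X) := by
      conv_lhs => rw [hs]
      exact map_sum (AddMonoidHom.single (fun _ : κ => (X : Type u)) k) _ _
    rw [hs']
    refine sum_mem fun i _ => AddSubgroup.mem_iSup_of_mem (i + a k) fun l _ => ?_
    by_cases hl : l = k
    · subst hl
      simpa using X.comp_mem i (x l)
    · simp [Pi.single_eq_of_ne hl]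
  smul_mem ha hx k _ := by
    simpa [add_sub_assoc] using X.smul_mem ha (hx k trivial)

variable (𝒜) in
/-- The graded ring as a graded module over itself. -/
abbrev self [GradedRing 𝒜] : GradedMod 𝒜 where
  carrier := R
  finite := inferInstance
  deg := 𝒜
  isInternal := DirectSum.Decomposition.isInternal 𝒜
  smul_mem ha hx := SetLike.GradedMul.mul_mem ha hx

variable [GradedRing 𝒜]

variable (𝒜) in
/-- The projection of the graded ring onto its component of degree `i`. -/
noncomputable def _root_.ModuleLiaison.rcomp (i : ι) : R →+ R := (self 𝒜).comp i

lemma _root_.ModuleLiaison.rcomp_mem (i : ι) (x : R) : rcomp 𝒜 i x ∈ 𝒜 i := (self 𝒜).comp_mem i x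

lemma _root_.ModuleLiaison.rcomp_of_mem {i : ι} {x : R} (hx : x ∈ 𝒜 i) : rcomp 𝒜 i x = x :=
  comp_of_mem (X := self 𝒜) hx

lemma _root_.ModuleLiaison.rcomp_of_mem_ne {i j : ι} {x : R} (hx : x ∈ 𝒜 i) (hij : i ≠ j) :
    rcomp 𝒜 j x = 0 := comp_of_mem_ne (X := self 𝒜) hx hij

variable (𝒜) in
lemma _root_.ModuleLiaison.exists_sum_rcomp (x : R) : ∃ s : Finset ι, x = ∑ i ∈ s, rcomp 𝒜 i x :=
  (self 𝒜).exists_sum_comp x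

lemma _root_.ModuleLiaison.rcomp_mul {x : R} {j : ι} (i : ι) (r : R) (hx : x ∈ 𝒜 j) :
    rcomp 𝒜 (i + j) (r * x) = rcomp 𝒜 i r * x := by
  rw [mul_comm, mul_comm _ x]
  exact comp_smul (X := self 𝒜) hx i r

lemma _root_.ModuleLiaison.rcomp_induction {P : R → Prop} (x : R) (zero : P 0)
    (hom : ∀ i, ∀ x ∈ 𝒜 i, P x) (add : ∀ x y, P x → P y → P (x + y)) : P x :=
  homogeneous_induction (DirectSum.Decomposition.isInternal 𝒜) x zero hom add

lemma comp_smul_of_mem {i : ι} {x : X} (j : ι) (s : R) (hx : x ∈ X.deg i) :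
    X.comp (j + i) (s • x) = rcomp 𝒜 j s • x := by
  refine rcomp_induction (𝒜 := 𝒜)
    (P := fun s : R => X.comp (j + i) (s • x) = rcomp 𝒜 j s • x) s ?_ ?_ ?_
  · rw [map_zero, zero_smul, map_zero]
  · intro k s hs
    have h1 : s • x ∈ X.deg (k + i) := X.smul_mem (𝒜 := 𝒜) hs hx
    by_cases hkj : k = j
    · subst hkj
      rw [rcomp_of_mem hs, comp_of_mem h1]
    · rw [rcomp_of_mem_ne hs hkj, comp_of_mem_ne h1 (by simpa using hkj), zero_smul]
  · intro s t hs ht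
    rw [map_add, add_smul, map_add, hs, ht, add_smul]

lemma _root_.ModuleLiaison.exists_rcomp_isUnit {s : R} (hs : s ∉ homogMaxIdeal 𝒜) :
    ∃ j, IsUnit (rcomp 𝒜 j s) := by
  by_contra! h
  refine hs ?_
  obtain ⟨t, ht⟩ := exists_sum_rcomp 𝒜 s
  rw [ht]
  exact sum_mem fun j _ => Ideal.subset_span ⟨⟨j, rcomp_mem j s⟩, h j⟩

/-- Some homogeneous component of s is a unit, and the corresponding component of s x = 0 says that
this unit kills x. This replaces localization at the graded maximal ideal. -/
lemma eq_zero_of_smul_eq_zero {i : ι} {x : X} (hx : x ∈ X.deg i) {s : R}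
    (hs : s ∉ homogMaxIdeal 𝒜) (h : s • x = 0) : x = 0 := by
  obtain ⟨j, hj⟩ := exists_rcomp_isUnit hs
  have := comp_smul_of_mem j s hx
  rw [h, map_zero] at this
  exact hj.smul_eq_zero.1 this.symm

/-- Graded Nakayama. -/
lemma smul_top_ne_top [Nontrivial X] (hm : homogMaxIdeal 𝒜 ≠ ⊤) :
    homogMaxIdeal 𝒜 • (⊤ : Submodule R X) ≠ ⊤ := by
  intro h
  obtain ⟨r, hr, hr'⟩ := Submodule.exists_sub_one_mem_and_smul_eq_zero_of_fg_of_le_smul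
    (homogMaxIdeal 𝒜) (⊤ : Submodule R X) Module.Finite.fg_top h.ge
  have hr1 : r ∉ homogMaxIdeal 𝒜 := fun h1 => hm <| (Ideal.eq_top_iff_one _).2 <| by
    simpa using sub_mem h1 hr
  obtain ⟨x, hx⟩ := exists_ne (0 : X)
  exact hx <| comp_ext fun i => eq_zero_of_smul_eq_zero (X.comp_mem i x) hr1 (hr' _ trivial)

variable (𝒜) in
/-- A graded ideal. -/
def _root_.ModuleLiaison.IsHomogIdeal (J : Ideal R) : Prop := ∀ i, ∀ x ∈ J, rcomp 𝒜 i x ∈ J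

/-- The residue class ring of a graded ideal as a graded module. -/
abbrev quotRing (J : Ideal R) (hJ : IsHomogIdeal 𝒜 J) : GradedMod 𝒜 where
  carrier := R ⧸ J
  finite := inferInstance
  deg := ((self 𝒜).quot J hJ).deg
  isInternal := ((self 𝒜).quot J hJ).isInternal
  smul_mem := ((self 𝒜).quot J hJ).smul_mem

lemma mem_quotRing_deg {J : Ideal R} {hJ : IsHomogIdeal 𝒜 J} {i : ι} {y : R ⧸ J} :
    y ∈ (quotRing J hJ).deg i ↔ ∃ x ∈ 𝒜 i, Ideal.Quotient.mk J x = y := Iff.rfl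

lemma mk_mem_quotRing_deg {J : Ideal R} {hJ : IsHomogIdeal 𝒜 J} {i : ι} {x : R} (hx : x ∈ 𝒜 i) :
    Ideal.Quotient.mk J x ∈ (quotRing J hJ).deg i := ⟨x, hx, rfl⟩

lemma mem_of_mul_mem {J : Ideal R} (hJ : IsHomogIdeal 𝒜 J) {i : ι} {x s : R} (hx : x ∈ 𝒜 i)
    (hs : s ∉ homogMaxIdeal 𝒜) (h : s * x ∈ J) : x ∈ J := by
  rw [← Ideal.Quotient.eq_zero_iff_mem] at h ⊢
  exact eq_zero_of_smul_eq_zero (X := quotRing J hJ) (mk_mem_quotRing_deg hx) hs h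

end GradedMod

end Graded

end ModuleLiaison

namespace ModuleLiaison

open CategoryTheory

/-! ### Graded free resolutions, comparison maps and homotopies -/

section Resolutions

/-- Dependent choice with an invariant p, which in the applications says that the next lifting
problem is solvable. -/
lemma exists_dependent_seq {α : ℕ → Type*} (p : ∀ n, α n → Prop) (r : ∀ n, α n → α (n + 1) → Prop)
    (h₀ : ∃ a, p 0 a) (h : ∀ n a, p n a → ∃ b, p (n + 1) b ∧ r n a b) :
    ∃ f : ∀ n, α n, (∀ n, p n (f n)) ∧ ∀ n, r n (f n) (f (n + 1)) := by
  obtain ⟨a, ha⟩ := h₀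
  choose b hb using h
  let F : ∀ n, {a : α n // p n a} := fun n => Nat.rec ⟨a, ha⟩ (fun n x => ⟨b n x.1 x.2, (hb n x.1 x.2).1⟩) n
  exact ⟨fun n => (F n).1, fun n => (F n).2, fun n => (hb n (F n).1 (F n).2).2⟩

variable {ι : Type} [AddCommGroup ι] [DecidableEq ι] {R : Type u} [CommRing R]
  {𝒜 : ι → AddSubgroup R} [GradedRing 𝒜]

lemma linearCombination_mem_deg {X : GradedMod 𝒜} {r : ℕ} {a : Fin r → ι} {x : Fin r → X} {b : ι}
    (hx : ∀ k, x k ∈ X.deg (a k + b)) {t : ι} {v : Fin r → R} (hv : v ∈ freeDeg 𝒜 a t) :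
    Fintype.linearCombination R x v ∈ X.deg (t + b) := by
  rw [Fintype.linearCombination_apply]
  refine sum_mem fun k _ => ?_
  have := X.smul_mem (hv k trivial) (hx k)
  rwa [← add_assoc, sub_add_cancel] at this

lemma single_mem_freeDeg {r : ℕ} (a : Fin r → ι) (k : Fin r) :
    (Pi.single k 1 : Fin r → R) ∈ freeDeg 𝒜 a (a k) := by
  intro l _
  by_cases h : l = k
  · subst h; simpa using SetLike.GradedOne.one_mem
  · simp [Pi.single_eq_of_ne h]

/-- A preimage of the image of a basis vector may be replaced by its component of the right degree.
The shift b is 0 for comparison maps and the degree of the multiplier for homotopies. -/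
lemma exists_lift_free {X Y : GradedMod 𝒜} {r : ℕ} {a : Fin r → ι} {π : X →ₗ[R] Y}
    (hπ : ∀ i, ∀ x ∈ X.deg i, π x ∈ Y.deg i) {g : (Fin r → R) →ₗ[R] Y} {b : ι}
    (hg : ∀ t, ∀ x ∈ freeDeg 𝒜 a t, g x ∈ Y.deg (t + b)) (hr : ∀ x, g x ∈ LinearMap.range π) :
    ∃ f : (Fin r → R) →ₗ[R] X, π ∘ₗ f = g ∧ ∀ t, ∀ x ∈ freeDeg 𝒜 a t, f x ∈ X.deg (t + b) := by
  choose z hz using fun k : Fin r => hr (Pi.single k 1)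
  refine ⟨Fintype.linearCombination R fun k => X.comp (a k + b) (z k), ?_, fun t x hx =>
    linearCombination_mem_deg (fun k => X.comp_mem _ _) hx⟩
  refine LinearMap.pi_ext' fun k => LinearMap.ext_ring ?_
  simp only [LinearMap.comp_apply, LinearMap.single_apply]
  rw [Fintype.linearCombination_apply_single, one_smul, ← GradedMod.comp_map π hπ, hz,
    GradedMod.comp_of_mem (hg _ _ (single_mem_freeDeg a k))]

lemma exists_graded_presentation (X : GradedMod 𝒜) :
    ∃ (r : ℕ) (a : Fin r → ι) (f : (Fin r → R) →ₗ[R] X),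
      (∀ i, ∀ x ∈ freeDeg 𝒜 a i, f x ∈ X.deg i) ∧ Function.Surjective f := by
  obtain ⟨r, a, x, hx, hspan⟩ := X.exists_homogeneous_generators
  refine ⟨r, a, Fintype.linearCombination R x, fun i v hv => ?_, LinearMap.range_eq_top.1 ?_⟩
  · have := linearCombination_mem_deg (b := 0) (fun k => by rw [add_zero]; exact hx k) hv
    rwa [add_zero] at this
  · rw [Fintype.range_linearCombination, hspan]

lemma exists_freeRes [IsNoetherianRing R] (X : GradedMod 𝒜) : Nonempty (FreeRes 𝒜 X.deg) := by
  obtain ⟨r₀, a₀, ε, hε, hεs⟩ := exists_graded_presentation X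
  -- A state is a graded free module with a graded submodule, the kernel which the next differential
  -- has to cover.
  let St := Σ (r : ℕ) (a : Fin r → ι),
    {K : Submodule R (Fin r → R) // ((GradedMod.self 𝒜).pi a).IsHomog K}
  have next : ∀ S : St, ∃ (r : ℕ) (a : Fin r → ι) (d : (Fin r → R) →ₗ[R] (Fin S.1 → R)),
      (∀ i, ∀ x ∈ freeDeg 𝒜 a i, d x ∈ freeDeg 𝒜 S.2.1 i) ∧ LinearMap.range d = S.2.2.1 := by
    rintro ⟨r, a, K, hK⟩
    obtain ⟨r', a', f, hf, hfs⟩ := exists_graded_presentation (((GradedMod.self 𝒜).pi a).sub K hK)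
    refine ⟨r', a', K.subtype ∘ₗ f, fun i x hx => hf i x hx, ?_⟩
    rw [LinearMap.range_comp, LinearMap.range_eq_top.2 hfs, Submodule.map_top, K.range_subtype]
  choose rk gn d hd hr using next
  let nx : St → St := fun S => ⟨rk S, gn S, LinearMap.ker (d S),
    GradedMod.isHomog_ker (X := (GradedMod.self 𝒜).pi (gn S)) (Y := (GradedMod.self 𝒜).pi S.2.1)
      (hd S)⟩
  let S₀ : St := ⟨r₀, a₀, LinearMap.ker ε,
    GradedMod.isHomog_ker (X := (GradedMod.self 𝒜).pi a₀) hε⟩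
  let S : ℕ → St := fun n => Nat.rec S₀ (fun _ => nx) n
  exact ⟨{
    rank := fun n => (S n).1
    gen := fun n => (S n).2.1
    d := fun n => d (S n)
    ε := ε
    d_deg := fun n => hd (S n)
    ε_deg := hε
    ε_surjective := hεs
    exact_zero := LinearMap.exact_iff.2 (hr S₀).symm
    exact_succ := fun n => LinearMap.exact_iff.2 (hr (S (n + 1))).symm }⟩

namespace FreeRes

variable {X Y : GradedMod 𝒜}

lemma d_d (P : FreeRes 𝒜 X.deg) (n : ℕ) (x) : P.d n (P.d (n + 1) x) = 0 :=
  (P.exact_succ n).apply_apply_eq_zero x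

lemma ε_d (P : FreeRes 𝒜 X.deg) (x) : P.ε (P.d 0 x) = 0 :=
  P.exact_zero.apply_apply_eq_zero x

/-- The free module of degree `n` of a resolution. -/
abbrev F (P : FreeRes 𝒜 X.deg) (n : ℕ) : GradedMod 𝒜 := (GradedMod.self 𝒜).pi (P.gen n)

lemma exists_lift (Q : FreeRes 𝒜 X.deg) (P : FreeRes 𝒜 Y.deg) (f : X →ₗ[R] Y)
    (hf : ∀ i, ∀ x ∈ X.deg i, f x ∈ Y.deg i) : Nonempty (Lift Q P f) := by
  let α : ℕ → Type u := fun n => {m : (Fin (Q.rank n) → R) →ₗ[R] (Fin (P.rank n) → R) //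
    ∀ i, ∀ x ∈ freeDeg 𝒜 (Q.gen n) i, m x ∈ freeDeg 𝒜 (P.gen n) i}
  have key : ∃ m : ∀ n, α n, (∀ n, (n = 0 → ∀ x, P.ε ((m 0).1 x) = f (Q.ε x)) ∧
      ∀ x, (m n).1 (Q.d n x) ∈ LinearMap.range (P.d n)) ∧
      ∀ n x, P.d n ((m (n + 1)).1 x) = (m n).1 (Q.d n x) := by
    have := exists_dependent_seq (α := α)
      (fun n => match n with
        | 0 => fun m => (∀ x, P.ε (m.1 x) = f (Q.ε x)) ∧ ∀ x, m.1 (Q.d 0 x) ∈ LinearMap.range (P.d 0)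
        | n + 1 => fun m => ∀ x, m.1 (Q.d (n + 1) x) ∈ LinearMap.range (P.d (n + 1)))
      (fun n m m' => ∀ x, P.d n (m'.1 x) = m.1 (Q.d n x)) ?_ ?_
    · obtain ⟨m, h1, h2⟩ := this
      refine ⟨m, fun n => ?_, h2⟩
      cases n with
      | zero => exact ⟨fun _ => (h1 0).1, (h1 0).2⟩
      | succ n => exact ⟨fun h => absurd h (by simp), h1 (n + 1)⟩
    · obtain ⟨m, hm, hm'⟩ := exists_lift_free (X := P.F 0) (Y := Y) (π := P.ε) P.ε_deg
        (g := f ∘ₗ Q.ε) (b := 0) (a := Q.gen 0)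
        (fun t x hx => by rw [add_zero]; exact hf _ _ (Q.ε_deg _ _ hx))
        (fun x => P.ε_surjective _)
      simp only [add_zero] at hm'
      have h : ∀ x, P.ε (m x) = f (Q.ε x) := fun x => LinearMap.congr_fun hm x
      refine ⟨⟨m, hm'⟩, h, fun x => (P.exact_zero _).1 ?_⟩
      rw [h, Q.ε_d, map_zero]
    · intro n m hm
      have hm' : ∀ x, m.1 (Q.d n x) ∈ LinearMap.range (P.d n) := by
        cases n with
        | zero => exact hm.2
        | succ n => exact hm
      obtain ⟨m', h, h'⟩ := exists_lift_free (X := P.F (n + 1)) (Y := P.F n) (π := P.d n)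
        (P.d_deg n) (g := m.1 ∘ₗ Q.d n) (b := 0) (a := Q.gen (n + 1))
        (fun t x hx => by rw [add_zero]; exact m.2 _ _ (Q.d_deg _ _ _ hx)) hm'
      simp only [add_zero] at h'
      have h2 : ∀ x, P.d n (m' x) = m.1 (Q.d n x) := fun x => LinearMap.congr_fun h x
      refine ⟨⟨m', h'⟩, fun x => (P.exact_succ n _).1 ?_, h2⟩
      rw [h2, Q.d_d, map_zero]
  obtain ⟨m, h1, h2⟩ := key
  exact ⟨{
    map := fun n => (m n).1
    map_deg := fun n => (m n).2
    comm_ε := LinearMap.ext ((h1 0).1 rfl)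
    comm_d := fun n => LinearMap.ext (h2 n) }⟩

/-- Multiplication by a homogeneous element of the annihilator is null-homotopic. -/
lemma exists_homotopy (P : FreeRes 𝒜 X.deg) {r : R} {b : ι} (hr : r ∈ 𝒜 b)
    (hrX : ∀ x : X, r • x = 0) :
    ∃ s : ∀ n, (Fin (P.rank n) → R) →ₗ[R] (Fin (P.rank (n + 1)) → R),
      (∀ n t, ∀ x ∈ freeDeg 𝒜 (P.gen n) t, s n x ∈ freeDeg 𝒜 (P.gen (n + 1)) (t + b)) ∧
      (∀ x, P.d 0 (s 0 x) = r • x) ∧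
      ∀ n x, P.d (n + 1) (s (n + 1) x) = r • x - s n (P.d n x) := by
  let α : ℕ → Type u := fun n => {m : (Fin (P.rank n) → R) →ₗ[R] (Fin (P.rank (n + 1)) → R) //
    ∀ t, ∀ x ∈ freeDeg 𝒜 (P.gen n) t, m x ∈ freeDeg 𝒜 (P.gen (n + 1)) (t + b)}
  have hsm : ∀ n t, ∀ x ∈ freeDeg 𝒜 (P.gen n) t, r • x ∈ freeDeg 𝒜 (P.gen n) (t + b) :=
    fun n t x hx => by rw [add_comm]; exact (P.F n).smul_mem hr hx
  have := exists_dependent_seq (α := α)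
    (fun n => match n with
      | 0 => fun m => ∀ x, P.d 0 (m.1 x) = r • x
      | n + 1 => fun m => ∀ x, P.d (n + 1) (m.1 (P.d (n + 1) x)) = r • P.d (n + 1) x)
    (fun n m m' => ∀ x, P.d (n + 1) (m'.1 x) = r • x - m.1 (P.d n x)) ?_ ?_
  · obtain ⟨s, h1, h2⟩ := this
    exact ⟨fun n => (s n).1, fun n => (s n).2, h1 0, h2⟩
  · obtain ⟨m, hm, hm'⟩ := exists_lift_free (X := P.F 1) (Y := P.F 0) (π := P.d 0)
      (P.d_deg 0) (g := LinearMap.lsmul R _ r) (b := b) (a := P.gen 0) (hsm 0)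
      (fun x => (P.exact_zero _).1 (by
        change P.ε (r • x) = 0
        rw [map_smul, hrX]))
    exact ⟨⟨m, hm'⟩, fun x => LinearMap.congr_fun hm x⟩
  · intro n m hm
    have hm' : ∀ x, P.d n (m.1 (P.d n x)) = r • P.d n x := by
      cases n with
      | zero => exact fun x => hm _
      | succ n => exact hm
    obtain ⟨m', h, h'⟩ := exists_lift_free (X := P.F (n + 2)) (Y := P.F (n + 1)) (π := P.d (n + 1))
      (P.d_deg _) (g := LinearMap.lsmul R _ r - m.1 ∘ₗ P.d n) (b := b) (a := P.gen (n + 1))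
      (fun t x hx => sub_mem (hsm _ _ _ hx) (m.2 _ _ (P.d_deg _ _ _ hx)))
      (fun x => (P.exact_succ n _).1 (by
        change P.d n (r • x - m.1 (P.d n x)) = 0
        rw [map_sub, hm', map_smul, sub_self]))
    have h2 : ∀ x, P.d (n + 1) (m' x) = r • x - m.1 (P.d n x) := fun x => LinearMap.congr_fun h x
    refine ⟨⟨m', h'⟩, fun x => ?_, h2⟩
    rw [h2, P.d_d, map_zero, sub_zero]

end FreeRes

end Resolutions

end ModuleLiaison

namespace ModuleLiaison

open CategoryTheory

/-! ### Iterated connecting homomorphisms along a regular sequence -/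

section Rees

/-- A list `[x_c, …, x_1]` such that each `x_{i+1}` is a nonzerodivisor modulo `(x_1, …, x_i)`. -/
def IsRegRev {R : Type u} [CommRing R] : List R → Prop
  | [] => True
  | x :: rs => (∀ y, x * y ∈ Ideal.ofList rs → y ∈ Ideal.ofList rs) ∧ IsRegRev rs

/-- A list of homogeneous elements such that the sum of the degrees is `w`. -/
inductive IsHomogSeq {ι : Type} [AddCommGroup ι] {R : Type u} [CommRing R] (𝒜 : ι → AddSubgroup R) :
    List R → ι → Prop
  | nil : IsHomogSeq 𝒜 [] 0
  | cons {x : R} {rs : List R} {b w : ι} : x ∈ 𝒜 b → IsHomogSeq 𝒜 rs w →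
      IsHomogSeq 𝒜 (x :: rs) (b + w)

lemma mem_ofList_cons {R : Type u} [CommRing R] {x y : R} {rs : List R} :
    y ∈ Ideal.ofList (x :: rs) ↔ ∃ a, y - x * a ∈ Ideal.ofList rs := by
  rw [Ideal.ofList_cons, sup_comm, Submodule.mem_sup]
  constructor
  · rintro ⟨z, hz, t, ht, rfl⟩
    obtain ⟨a, rfl⟩ := Ideal.mem_span_singleton'.1 ht
    exact ⟨a, by rwa [mul_comm x a, add_sub_cancel_right]⟩
  · rintro ⟨a, ha⟩
    exact ⟨_, ha, x * a, Ideal.mul_mem_right _ _ (Ideal.mem_span_singleton_self x), by ring⟩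

lemma ofList_le_cons {R : Type u} [CommRing R] (x : R) (rs : List R) :
    Ideal.ofList rs ≤ Ideal.ofList (x :: rs) := by
  rw [Ideal.ofList_cons]; exact le_sup_right

lemma isRegRev_of_append {R : Type u} [CommRing R] (l : List R) {rs : List R}
    (h : IsRegRev (l ++ rs)) : IsRegRev rs := by
  induction l with
  | nil => exact h
  | cons x l ih => exact ih h.2

variable {ι : Type} [AddCommGroup ι] [DecidableEq ι] {R : Type u} [CommRing R]
  {𝒜 : ι → AddSubgroup R} [GradedRing 𝒜]

lemma IsHomogSeq.isHomogIdeal {rs : List R} {w : ι} (h : IsHomogSeq 𝒜 rs w) :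
    IsHomogIdeal 𝒜 (Ideal.ofList rs) := by
  induction h with
  | nil => intro i x hx; rw [Ideal.ofList_nil, Ideal.mem_bot] at hx ⊢; rw [hx, map_zero]
  | @cons x rs b w hx _ ih =>
    intro i y hy
    obtain ⟨a, ha⟩ := mem_ofList_cons.1 hy
    refine mem_ofList_cons.2 ⟨rcomp 𝒜 (i - b) a, ?_⟩
    have := ih i _ ha
    rw [map_sub, mul_comm x a] at this
    have h2 := rcomp_mul (i - b) a hx
    rw [sub_add_cancel] at h2
    rwa [h2, mul_comm] at this

lemma IsHomogSeq.exists_deg {rs : List R} {w : ι} (h : IsHomogSeq 𝒜 rs w) :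
    ∀ x ∈ rs, ∃ b, x ∈ 𝒜 b := by
  induction h with
  | nil => simp
  | cons hx _ ih =>
    intro y hy
    rcases List.mem_cons.1 hy with rfl | hy
    · exact ⟨_, hx⟩
    · exact ih y hy

lemma apply_mem_of_single_mem {r : ℕ} {J : Ideal R} {g : (Fin r → R) →ₗ[R] R}
    (h : ∀ k, g (Pi.single k 1) ∈ J) (y : Fin r → R) : g y ∈ J := by
  rw [LinearMap.pi_apply_eq_sum_univ]
  exact sum_mem fun k _ => by
    have : (fun j => if k = j then (1 : R) else 0) = Pi.single k 1 := by
      ext j; simp [Pi.single_apply, eq_comm]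
    rw [this]; exact Ideal.mul_mem_left _ _ (h k)

/-- Cochains live on free modules, so the division by x may be carried out on basis vectors and
extended linearly. -/
lemma exists_divide {r : ℕ} {x : R} {rs : List R} (g : (Fin r → R) →ₗ[R] R)
    (hg : ∀ y, g y ∈ Ideal.ofList (x :: rs)) :
    ∃ u : (Fin r → R) →ₗ[R] R, ∀ y, g y - x * u y ∈ Ideal.ofList rs := by
  choose a ha using fun k : Fin r => mem_ofList_cons.1 (hg (Pi.single k 1))
  refine ⟨Fintype.linearCombination R a, fun y =>
    apply_mem_of_single_mem (g := g - x • Fintype.linearCombination R a) (fun k => ?_) y⟩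
  simpa [Fintype.linearCombination_apply_single] using ha k

lemma exists_divide_graded {r : ℕ} {a : Fin r → ι} {x : R} {rs : List R} {b w i : ι} (hx : x ∈ 𝒜 b)
    (hrs : IsHomogSeq 𝒜 rs w) (g : (Fin r → R) →ₗ[R] R)
    (hg : ∀ y, g y ∈ Ideal.ofList (x :: rs)) (hgi : g ∈ dualDeg 𝒜 a i) :
    ∃ u ∈ dualDeg 𝒜 a (i - b), ∀ y, g y - x * u y ∈ Ideal.ofList rs := by
  choose c hc using fun k : Fin r => mem_ofList_cons.1 (hg (Pi.single k 1))
  let c' : Fin r → R := fun k => rcomp 𝒜 (a k + (i - b)) (c k)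
  have h1 : Fintype.linearCombination R c' ∈ dualDeg 𝒜 a (i - b) := fun t y hy =>
    linearCombination_mem_deg (X := GradedMod.self 𝒜) (fun k => rcomp_mem _ _) hy
  refine ⟨Fintype.linearCombination R c', h1, fun y =>
    apply_mem_of_single_mem (g := g - x • Fintype.linearCombination R c') (fun k => ?_) y⟩
  have h2 := hrs.isHomogIdeal (a k + i) _ (hc k)
  have h3 := rcomp_mul (a k + (i - b)) (c k) hx
  rw [show a k + (i - b) + b = a k + i by abel] at h3
  rw [map_sub, mul_comm x, h3, rcomp_of_mem (hgi _ _ (single_mem_freeDeg a k)), mul_comm] at h2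
  simpa [Fintype.linearCombination_apply_single] using h2

namespace FreeRes

variable {X Y : GradedMod 𝒜}

/-- A cochain with values in `R / J` that is a cocycle. -/
def IsCocycleMod (P : FreeRes 𝒜 X.deg) (J : Ideal R) (n : ℕ)
    (f : (Fin (P.rank n) → R) →ₗ[R] R) : Prop := ∀ x, f (P.d n x) ∈ J

/-- A cochain with values in `R / J` that is a coboundary. -/
def IsCoboundMod (P : FreeRes 𝒜 X.deg) (J : Ideal R) :
    (n : ℕ) → ((Fin (P.rank n) → R) →ₗ[R] R) → Prop
  | 0, f => ∀ x, f x ∈ J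
  | n + 1, f => ∃ h : (Fin (P.rank n) → R) →ₗ[R] R, ∀ x, f x - h (P.d n x) ∈ J

/-- The iterated connecting homomorphisms for the modules `R / (x_1, …, x_i)`. -/
inductive IsRel (P : FreeRes 𝒜 X.deg) : (n m : ℕ) → List R → ((Fin (P.rank n) → R) →ₗ[R] R) →
    ((Fin (P.rank m) → R) →ₗ[R] R) → Prop
  | nil (n f) : IsRel P n n [] f f
  | cons {n m x rs f f₁ g} : (∀ y, f (P.d n y) - x * f₁ y ∈ Ideal.ofList rs) →
      IsRel P (n + 1) m rs f₁ g → IsRel P n m (x :: rs) f g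

section

variable {P : FreeRes 𝒜 X.deg}

lemma isCoboundMod_congr {J : Ideal R} {n : ℕ} {f g : (Fin (P.rank n) → R) →ₗ[R] R}
    (h : ∀ x, f x - g x ∈ J) (hg : P.IsCoboundMod J n g) : P.IsCoboundMod J n f := by
  cases n with
  | zero => exact fun x => by simpa using add_mem (h x) (hg x)
  | succ n =>
    obtain ⟨u, hu⟩ := hg
    exact ⟨u, fun x => by simpa using add_mem (h x) (hu x)⟩

lemma isCoboundMod_mono {J J' : Ideal R} (hJ : J ≤ J') {n : ℕ} {f : (Fin (P.rank n) → R) →ₗ[R] R}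
    (h : P.IsCoboundMod J n f) : P.IsCoboundMod J' n f := by
  cases n with
  | zero => exact fun x => hJ (h x)
  | succ n => obtain ⟨u, hu⟩ := h; exact ⟨u, fun x => hJ (hu x)⟩

/-- A coboundary modulo (x, rs) is a coboundary modulo rs up to a multiple x u; since d ∘ d = 0, the
same u records f ∘ d as x (u ∘ d). -/
lemma isCoboundMod_divide {x : R} {rs : List R} {n : ℕ} {f : (Fin (P.rank n) → R) →ₗ[R] R}
    (h : P.IsCoboundMod (Ideal.ofList (x :: rs)) n f) :
    ∃ u : (Fin (P.rank n) → R) →ₗ[R] R, P.IsCoboundMod (Ideal.ofList rs) n (f - x • u) ∧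
      ∀ y, f (P.d n y) - x * u (P.d n y) ∈ Ideal.ofList rs := by
  cases n with
  | zero =>
    obtain ⟨u, hu⟩ := exists_divide f h
    exact ⟨u, hu, fun y => hu _⟩
  | succ n =>
    obtain ⟨v, hv⟩ := h
    obtain ⟨u, hu⟩ := exists_divide (f - v ∘ₗ P.d n) hv
    refine ⟨u, ⟨v, fun y => ?_⟩, fun y => ?_⟩
    · convert hu y using 1
      simp only [LinearMap.sub_apply, LinearMap.smul_apply, LinearMap.comp_apply, smul_eq_mul]
      ring
    · simpa [P.d_d] using hu (P.d (n + 1) y)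

/-- This is the vanishing of Ext^n(X, R/(rs)) below the length of a regular sequence annihilating X.
A homotopy s for multiplication by x gives x f ≡ f ∘ s ∘ d, so f ∘ s is a cocycle modulo (x, rs) in
one degree less. By induction it is a coboundary, and x can be cancelled. -/
lemma isCoboundMod_of_isCocycleMod {l rs : List R} {n : ℕ} (hreg : IsRegRev (l ++ rs))
    (hhom : ∀ x ∈ l, ∃ b, x ∈ 𝒜 b) (hann : ∀ x ∈ l, ∀ y : X, x • y = 0) (hn : n < l.length)
    {f : (Fin (P.rank n) → R) →ₗ[R] R} (hf : P.IsCocycleMod (Ideal.ofList rs) n f) :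
    P.IsCoboundMod (Ideal.ofList rs) n f := by
  induction l using List.reverseRecOn generalizing rs n with
  | nil => simp at hn
  | append_singleton l x ih =>
    rw [List.append_assoc, List.singleton_append] at hreg
    have hx := (isRegRev_of_append l hreg).1
    obtain ⟨b, hb⟩ := hhom x (by simp)
    obtain ⟨s, -, hs0, hs⟩ := P.exists_homotopy hb (hann x (by simp))
    cases n with
    | zero =>
      intro y
      refine hx _ ?_
      have := hf (s 0 y)
      rwa [hs0, map_smul] at this
    | succ n =>
      have h1 : ∀ y, x * f y - f (s n (P.d n y)) ∈ Ideal.ofList rs := fun y => by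
        have := hf (s (n + 1) y)
        rwa [hs, map_sub, map_smul] at this
      have h2 : P.IsCocycleMod (Ideal.ofList (x :: rs)) n (f ∘ₗ s n) := fun y =>
        mem_ofList_cons.2 ⟨f y, by simpa using neg_mem (h1 y)⟩
      obtain ⟨u, -, hu⟩ := isCoboundMod_divide (ih hreg (fun y hy => hhom y (by simp [hy]))
        (fun y hy => hann y (by simp [hy])) (by simpa using hn) h2)
      refine ⟨u, fun y => hx _ ?_⟩
      convert add_mem (h1 y) (hu y) using 1
      simp only [LinearMap.comp_apply]
      ring

namespace IsRel

lemma length_eq {n m : ℕ} {rs : List R} {f g} (h : P.IsRel n m rs f g) : n + rs.length = m := by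
  induction h with
  | nil => simp
  | cons _ _ ih => rw [List.length_cons]; omega

lemma add {n m : ℕ} {rs : List R} {f g f' g'} (h : P.IsRel n m rs f g)
    (h' : P.IsRel n m rs f' g') : P.IsRel n m rs (f + f') (g + g') := by
  induction h with
  | nil n f => cases h'; exact .nil _ _
  | @cons n m x rs f f₁ g hf _ ih =>
    cases h' with
    | @cons _ _ _ _ _ f₁' _ hf' h' =>
      refine .cons (f₁ := f₁ + f₁') (fun y => ?_) (ih h')
      convert add_mem (hf y) (hf' y) using 1
      simp only [LinearMap.add_apply]
      ring

lemma smul {n m : ℕ} {rs : List R} {f g} (r : R) (h : P.IsRel n m rs f g) :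
    P.IsRel n m rs (r • f) (r • g) := by
  induction h with
  | nil n f => exact .nil _ _
  | @cons n m x rs f f₁ g hf _ ih =>
    refine .cons (f₁ := r • f₁) (fun y => ?_) ih
    convert Ideal.mul_mem_left _ r (hf y) using 1
    simp only [LinearMap.smul_apply, smul_eq_mul]
    ring

lemma isCocycleMod {n m : ℕ} {rs : List R} (hreg : IsRegRev rs) {f g} (h : P.IsRel n m rs f g)
    (hf : P.IsCocycleMod (Ideal.ofList rs) n f) : P.IsCocycleMod ⊥ m g := by
  induction h with
  | nil n f => rwa [Ideal.ofList_nil] at hf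
  | @cons n m x rs f f₁ g hf₁ _ ih =>
    refine ih hreg.2 fun y => hreg.1 _ ?_
    simpa [P.d_d] using neg_mem (hf₁ (P.d (n + 1) y))

/-- Each connecting map is injective: if the next cochain satisfies f₁ ≡ v ∘ d, then f - x v is a
cocycle modulo rs and hence a coboundary by `isCoboundMod_of_isCocycleMod`. The list l provides the
regular elements for that vanishing; it gains x whenever the degree rises by one. -/
lemma isCoboundMod_iff {l rs : List R} {n m : ℕ} (hreg : IsRegRev rs)
    (hhom : ∀ x ∈ rs, ∃ b, x ∈ 𝒜 b) (hann : ∀ x ∈ rs, ∀ y : X, x • y = 0)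
    {f g} (h : P.IsRel n m rs f g) (hl : l.length = n) (hreg' : IsRegRev (l ++ rs))
    (hl1 : ∀ x ∈ l, ∃ b, x ∈ 𝒜 b) (hl2 : ∀ x ∈ l, ∀ y : X, x • y = 0)
    (hf : P.IsCocycleMod (Ideal.ofList rs) n f) :
    P.IsCoboundMod (Ideal.ofList rs) n f ↔ P.IsCoboundMod ⊥ m g := by
  induction h generalizing l with
  | nil n f => rw [Ideal.ofList_nil]
  | @cons n m x rs f f₁ g hf₁ hr ih =>
    rw [← ih (l := l ++ [x]) hreg.2 (fun y hy => hhom y (by simp [hy]))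
      (fun y hy => hann y (by simp [hy])) (by simp [hl]) (by simpa using hreg')
      (fun y hy => by
        rcases List.mem_append.1 hy with hy | hy
        · exact hl1 y hy
        · exact hhom y (by simp [List.mem_singleton.1 hy]))
      (fun y hy => by
        rcases List.mem_append.1 hy with hy | hy
        · exact hl2 y hy
        · exact hann y (by simp [List.mem_singleton.1 hy]))
      (fun y => hreg.1 _ (by simpa [P.d_d] using neg_mem (hf₁ (P.d (n + 1) y))))]
    constructor
    · intro h
      obtain ⟨u, -, hu⟩ := isCoboundMod_divide h
      refine ⟨u, fun y => hreg.1 _ ?_⟩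
      convert sub_mem (hu y) (hf₁ y) using 1
      ring
    · rintro ⟨v, hv⟩
      have h1 : P.IsCocycleMod (Ideal.ofList rs) n (f - x • v) := fun y => by
        convert add_mem (hf₁ y) (Ideal.mul_mem_left _ x (hv y)) using 1
        simp only [LinearMap.sub_apply, LinearMap.smul_apply, smul_eq_mul]
        ring
      have h2 := isCoboundMod_of_isCocycleMod (l := l ++ [x]) (rs := rs) (by simpa using hreg')
        (fun y hy => by
          rcases List.mem_append.1 hy with hy | hy
          · exact hl1 y hy
          · exact hhom y (by simp [List.mem_singleton.1 hy]))
        (fun y hy => by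
          rcases List.mem_append.1 hy with hy | hy
          · exact hl2 y hy
          · exact hann y (by simp [List.mem_singleton.1 hy])) (by simp [hl]) h1
      refine isCoboundMod_congr (g := f - x • v) (fun y => ?_)
        (isCoboundMod_mono (ofList_le_cons x rs) h2)
      exact mem_ofList_cons.2 ⟨v y, by simp⟩

lemma exists_right {n : ℕ} {rs : List R} (hreg : IsRegRev rs) {f}
    (hf : P.IsCocycleMod (Ideal.ofList rs) n f) : ∃ m g, P.IsRel n m rs f g := by
  induction rs generalizing n with
  | nil => exact ⟨n, f, .nil n f⟩
  | cons x rs ih =>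
    obtain ⟨u, hu⟩ := exists_divide (f ∘ₗ P.d n) hf
    obtain ⟨m, g, hg⟩ := ih (n := n + 1) (f := u) hreg.2 fun y => hreg.1 _ (by
      simpa [P.d_d] using neg_mem (hu (P.d (n + 1) y)))
    exact ⟨m, g, .cons hu hg⟩

lemma exists_right_graded {n : ℕ} {rs : List R} (hreg : IsRegRev rs) {w : ι}
    (hrs : IsHomogSeq 𝒜 rs w) {i : ι} {f} (hf : P.IsCocycleMod (Ideal.ofList rs) n f)
    (hfi : f ∈ dualDeg 𝒜 (P.gen n) i) :
    ∃ m, ∃ g ∈ dualDeg 𝒜 (P.gen m) (i - w), P.IsRel n m rs f g := by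
  induction hrs generalizing n i with
  | nil => exact ⟨n, f, by simpa using hfi, .nil n f⟩
  | @cons x rs b w hx hrs ih =>
    obtain ⟨u, hui, hu⟩ := exists_divide_graded hx hrs (f ∘ₗ P.d n) hf
      (a := P.gen (n + 1)) (i := i) (fun t y hy => hfi _ _ (P.d_deg _ _ _ hy))
    obtain ⟨m, g, hgi, hg⟩ := ih (n := n + 1) (f := u) hreg.2 (fun y => hreg.1 _ (by
      simpa [P.d_d] using neg_mem (hu (P.d (n + 1) y)))) hui
    exact ⟨m, g, by rwa [sub_sub] at hgi, .cons hu hg⟩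

/-- Each connecting map is surjective: for a cocycle f and a homotopy s for x one has f ∘ s ∘ d ≡ x
f, so f ∘ s is mapped to f. -/
lemma exists_left {n : ℕ} {rs : List R} (hhom : ∀ x ∈ rs, ∃ b, x ∈ 𝒜 b)
    (hann : ∀ x ∈ rs, ∀ y : X, x • y = 0) {g}
    (hg : P.IsCocycleMod ⊥ (n + rs.length) g) :
    ∃ f, P.IsCocycleMod (Ideal.ofList rs) n f ∧ P.IsRel n (n + rs.length) rs f g := by
  induction rs generalizing n with
  | nil => exact ⟨g, by rwa [Ideal.ofList_nil], .nil n g⟩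
  | cons x rs ih =>
    obtain ⟨b, hb⟩ := hhom x (by simp)
    obtain ⟨s, -, hs0, hs⟩ := P.exists_homotopy hb (hann x (by simp))
    have e : n + (x :: rs).length = n + 1 + rs.length := by rw [List.length_cons]; omega
    revert g
    rw [e]
    intro g hg
    obtain ⟨f, hf, hfg⟩ := ih (n := n + 1) (fun y hy => hhom y (by simp [hy]))
      (fun y hy => hann y (by simp [hy])) hg
    have h1 : ∀ y, (f ∘ₗ s n) (P.d n y) - x * f y ∈ Ideal.ofList rs := fun y => by
      have := hf (s (n + 1) y)
      rw [hs, map_sub, map_smul] at this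
      simpa using neg_mem this
    exact ⟨f ∘ₗ s n, fun y => mem_ofList_cons.2 ⟨f y, h1 y⟩, .cons h1 hfg⟩

lemma exists_left_graded {n : ℕ} {rs : List R} {w : ι} (hrs : IsHomogSeq 𝒜 rs w)
    (hann : ∀ x ∈ rs, ∀ y : X, x • y = 0) {i : ι} {g}
    (hg : P.IsCocycleMod ⊥ (n + rs.length) g) (hgi : g ∈ dualDeg 𝒜 (P.gen (n + rs.length)) i) :
    ∃ f ∈ dualDeg 𝒜 (P.gen n) (i + w), P.IsCocycleMod (Ideal.ofList rs) n f ∧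
      P.IsRel n (n + rs.length) rs f g := by
  induction hrs generalizing n i with
  | nil => exact ⟨g, by simpa using hgi, by rwa [Ideal.ofList_nil], .nil n g⟩
  | @cons x rs b w hb hrs ih =>
    obtain ⟨s, hsd, hs0, hs⟩ := P.exists_homotopy hb (hann x (by simp))
    have e : n + (x :: rs).length = n + 1 + rs.length := by rw [List.length_cons]; omega
    revert g
    rw [e]
    intro g hg hgi
    obtain ⟨f, hfi, hf, hfg⟩ := ih (n := n + 1) (fun y hy => hann y (by simp [hy])) hg hgi
    have h1 : ∀ y, (f ∘ₗ s n) (P.d n y) - x * f y ∈ Ideal.ofList rs := fun y => by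
      have := hf (s (n + 1) y)
      rw [hs, map_sub, map_smul] at this
      simpa using neg_mem this
    refine ⟨f ∘ₗ s n, fun t y hy => ?_, fun y => mem_ofList_cons.2 ⟨f y, h1 y⟩, .cons h1 hfg⟩
    have := hfi _ _ (hsd n t y hy)
    rwa [show t + b + (i + w) = t + (i + (b + w)) by abel] at this

lemma comp_lift {Q : FreeRes 𝒜 Y.deg} {u : Y →ₗ[R] X} (h : Lift Q P u) {n m : ℕ} {rs : List R}
    {f g} (hr : P.IsRel n m rs f g) : Q.IsRel n m rs (f ∘ₗ h.map n) (g ∘ₗ h.map m) := by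
  induction hr with
  | nil n f => exact .nil _ _
  | @cons n m x rs f f₁ g hf _ ih =>
    refine .cons (f₁ := f₁ ∘ₗ h.map (n + 1)) (fun y => ?_) ih
    have := hf (h.map (n + 1) y)
    rwa [show P.d n (h.map (n + 1) y) = h.map n (Q.d n y) from
      LinearMap.congr_fun (h.comm_d n) y] at this

end IsRel

lemma isCocycleMod_bot_iff {n : ℕ} {f} : P.IsCocycleMod ⊥ n f ↔ f ∈ P.cocycles n := by
  simp only [IsCocycleMod, Ideal.mem_bot]
  exact ⟨fun h => LinearMap.ext h, fun h x => LinearMap.congr_fun h x⟩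

lemma isCoboundMod_bot_iff {n : ℕ} {f} : P.IsCoboundMod ⊥ n f ↔ f ∈ P.coboundaries n := by
  cases n with
  | zero =>
    simp only [IsCoboundMod, Ideal.mem_bot]
    exact ⟨fun h => LinearMap.ext h, fun h x => LinearMap.congr_fun h x⟩
  | succ n =>
    simp only [IsCoboundMod, Ideal.mem_bot, sub_eq_zero]
    exact ⟨fun ⟨h, hh⟩ => ⟨h, LinearMap.ext fun x => (hh x).symm⟩,
      fun ⟨h, hh⟩ => ⟨h, fun x => (LinearMap.congr_fun hh x).symm⟩⟩

end

end FreeRes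

end Rees

end ModuleLiaison

namespace ModuleLiaison

open CategoryTheory

/-! ### Rees' isomorphism, its degree and its naturality -/

section ReesIso

variable {ι : Type} [AddCommGroup ι] [DecidableEq ι] {R : Type u} [CommRing R]
  {𝒜 : ι → AddSubgroup R} [GradedRing 𝒜]

/-- A linear map of degree `i`. -/
def IsOfDegree {X Y : GradedMod 𝒜} (i : ι) (f : X →ₗ[R] Y) : Prop :=
  ∀ t, ∀ x ∈ X.deg t, f x ∈ Y.deg (t + i)

namespace FreeRes

variable {X Y : GradedMod 𝒜}

/-- The `0`-cochain `f` represents the homomorphism `φ`. -/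
def Represents (P : FreeRes 𝒜 X.deg) {J : Ideal R} (f : (Fin (P.rank 0) → R) →ₗ[R] R)
    (φ : X →ₗ[R] R ⧸ J) : Prop := ∀ y, Ideal.Quotient.mk J (f y) = φ (P.ε y)

variable {P : FreeRes 𝒜 X.deg} {J : Ideal R}

lemma Represents.isCocycleMod {f} {φ : X →ₗ[R] R ⧸ J} (h : P.Represents f φ) :
    P.IsCocycleMod J 0 f := fun x => by
  rw [← Ideal.Quotient.eq_zero_iff_mem, h, P.ε_d, map_zero]

lemma Represents.isCoboundMod_iff {f} {φ : X →ₗ[R] R ⧸ J} (h : P.Represents f φ) :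
    P.IsCoboundMod J 0 f ↔ φ = 0 := by
  constructor
  · intro h'
    ext x
    obtain ⟨y, rfl⟩ := P.ε_surjective x
    rw [← h, LinearMap.zero_apply, Ideal.Quotient.eq_zero_iff_mem]
    exact h' y
  · rintro rfl y
    rw [← Ideal.Quotient.eq_zero_iff_mem, h]; rfl

lemma exists_represents (P : FreeRes 𝒜 X.deg) (φ : X →ₗ[R] R ⧸ J) : ∃ f, P.Represents f φ := by
  choose a ha using fun k : Fin (P.rank 0) =>
    Ideal.Quotient.mk_surjective (φ (P.ε (Pi.single k 1)))
  refine ⟨Fintype.linearCombination R a, LinearMap.congr_fun (f := J.mkQ ∘ₗ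
    Fintype.linearCombination R a) (g := φ ∘ₗ P.ε) ?_⟩
  refine LinearMap.pi_ext' fun k => LinearMap.ext_ring ?_
  simpa [Fintype.linearCombination_apply_single] using ha k

lemma exists_represents_graded (P : FreeRes 𝒜 X.deg) (hJ : IsHomogIdeal 𝒜 J) {i : ι}
    {φ : X →ₗ[R] R ⧸ J} (hφ : IsOfDegree (Y := GradedMod.quotRing J hJ) i φ) :
    ∃ f ∈ dualDeg 𝒜 (P.gen 0) i, P.Represents f φ := by
  obtain ⟨f, hf, hfi⟩ := exists_lift_free (X := GradedMod.self 𝒜) (Y := GradedMod.quotRing J hJ)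
    (π := J.mkQ) (fun i x hx => ⟨x, hx, rfl⟩) (g := φ ∘ₗ P.ε) (b := i) (a := P.gen 0)
    (fun t x hx => hφ _ _ (P.ε_deg _ _ hx)) (fun x => Submodule.mkQ_surjective J _)
  exact ⟨f, hfi, LinearMap.congr_fun hf⟩

lemma exists_of_isCocycleMod {f} (hf : P.IsCocycleMod J 0 f) :
    ∃ φ : X →ₗ[R] R ⧸ J, P.Represents f φ := by
  have hk : LinearMap.ker P.ε ≤ LinearMap.ker (J.mkQ ∘ₗ f) := fun x hx => by
    obtain ⟨y, rfl⟩ := (P.exact_zero x).1 hx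
    exact Ideal.Quotient.eq_zero_iff_mem.2 (hf y)
  let e := P.ε.quotKerEquivOfSurjective P.ε_surjective
  refine ⟨(LinearMap.ker P.ε).liftQ _ hk ∘ₗ e.symm.toLinearMap, fun y => ?_⟩
  have : e.symm (P.ε y) = (LinearMap.ker P.ε).mkQ y := e.symm_apply_eq.2 rfl
  rw [LinearMap.comp_apply, LinearEquiv.coe_coe, this]
  rfl

lemma Represents.isOfDegree (hJ : IsHomogIdeal 𝒜 J) {i : ι} {f} {φ : X →ₗ[R] R ⧸ J}
    (h : P.Represents f φ) (hf : f ∈ dualDeg 𝒜 (P.gen 0) i) :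
    IsOfDegree (Y := GradedMod.quotRing J hJ) i φ := fun t x hx => by
  obtain ⟨y, rfl⟩ := P.ε_surjective x
  have h1 := GradedMod.comp_map (X := P.F 0) (Y := X) P.ε P.ε_deg t y
  rw [GradedMod.comp_of_mem hx] at h1
  have h2 := (P.F 0).comp_mem t y
  refine ⟨f ((P.F 0).comp t y), hf _ _ h2, ?_⟩
  rw [h1, ← h]; rfl

variable {rs : List R} {c : ℕ}

/-- Applied to the difference of two homomorphisms, `IsRel.isCoboundMod_iff` yields independence of
all choices and injectivity at once. -/
lemma mkQ_eq_iff {w : ι} (hreg : IsRegRev rs) (hrs : IsHomogSeq 𝒜 rs w)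
    (hann : ∀ x ∈ rs, ∀ y : X, x • y = 0) {φ φ' : X →ₗ[R] R ⧸ Ideal.ofList rs} {f f' g g'}
    (hf : P.Represents f φ) (hf' : P.Represents f' φ')
    (h : P.IsRel 0 c rs f g) (h' : P.IsRel 0 c rs f' g') :
    (P.coboundaries c).mkQ g = (P.coboundaries c).mkQ g' ↔ φ = φ' := by
  have h1 : P.Represents (f + (-1 : R) • f') (φ + (-1 : R) • φ') := fun y => by
    simp [hf y, hf' y]
  have h2 := (h.add (h'.smul (-1))).isCoboundMod_iff (l := []) hreg hrs.exists_deg hann rfl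
    hreg (by simp) (by simp) h1.isCocycleMod
  rw [h1.isCoboundMod_iff, isCoboundMod_bot_iff] at h2
  rw [Submodule.mkQ_apply, Submodule.mkQ_apply, Submodule.Quotient.eq, sub_eq_add_neg,
    ← neg_one_smul R g', ← h2, ← sub_eq_zero (a := φ)]
  have : φ + (-1 : R) • φ' = φ - φ' := by ext x; simp [sub_eq_add_neg]
  rw [this]

theorem exists_rees (P : FreeRes 𝒜 X.deg) {w : ι} (hreg : IsRegRev rs) (hrs : IsHomogSeq 𝒜 rs w)
    (hann : ∀ x ∈ rs, ∀ y : X, x • y = 0) (hc : rs.length = c) :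
    ∃ E : (X →ₗ[R] R ⧸ Ideal.ofList rs) ≃ₗ[R] P.Ext c, ∀ φ f g, P.Represents f φ →
      P.IsRel 0 c rs f g → (E φ : _ ⧸ P.coboundaries c) = (P.coboundaries c).mkQ g := by
  have hex : ∀ φ : X →ₗ[R] R ⧸ Ideal.ofList rs, ∃ f g, P.Represents f φ ∧ P.IsRel 0 c rs f g := by
    intro φ
    obtain ⟨f, hf⟩ := P.exists_represents φ
    obtain ⟨m, g, hg⟩ := IsRel.exists_right hreg hf.isCocycleMod
    have := hg.length_eq
    obtain rfl : m = c := by omega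
    exact ⟨f, g, hf, hg⟩
  -- The representatives are chosen without any linearity; `mkQ_eq_iff` makes their classes linear
  -- in φ.
  choose F G hF hG using hex
  have huniq := fun {φ φ'} {f f' : (Fin (P.rank 0) → R) →ₗ[R] R}
    {g g' : (Fin (P.rank c) → R) →ₗ[R] R} =>
    mkQ_eq_iff (φ := φ) (φ' := φ') (f := f) (f' := f') (g := g) (g' := g') (P := P) hreg hrs hann
  have hmem : ∀ φ, (P.coboundaries c).mkQ (G φ) ∈ P.Ext c := fun φ =>
    ⟨_, isCocycleMod_bot_iff.1 ((hG φ).isCocycleMod hreg (hF φ).isCocycleMod), rfl⟩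
  let E₀ : (X →ₗ[R] R ⧸ Ideal.ofList rs) →ₗ[R] P.Ext c :=
    { toFun := fun φ => ⟨(P.coboundaries c).mkQ (G φ), hmem φ⟩
      map_add' := fun φ φ' => Subtype.ext <| by
        have := (huniq (hF (φ + φ')) (f' := F φ + F φ') (fun y => by
          simp [hF φ y, hF φ' y]) (hG _) ((hG φ).add (hG φ'))).2 rfl
        rw [map_add] at this
        exact this
      map_smul' := fun r φ => Subtype.ext <| by
        have := (huniq (hF (r • φ)) (f' := r • F φ) (fun y => by
          rw [LinearMap.smul_apply, LinearMap.smul_apply, ← hF φ y]; rfl)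
          (hG _) ((hG φ).smul r)).2 rfl
        rw [map_smul] at this
        exact this }
  refine ⟨LinearEquiv.ofBijective E₀ ⟨fun φ φ' h => ?_, ?_⟩, fun φ f g hf hg =>
    (huniq (hF φ) hf (hG φ) hg).2 rfl⟩
  · exact (huniq (hF φ) (hF φ') (hG φ) (hG φ')).1 (congrArg Subtype.val h)
  · rintro ⟨_, g, hg, rfl⟩
    have key : ∃ f, P.IsCocycleMod (Ideal.ofList rs) 0 f ∧ P.IsRel 0 c rs f g := by
      have hg' : P.IsCocycleMod ⊥ c g := isCocycleMod_bot_iff.2 hg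
      obtain rfl : 0 + rs.length = c := by omega
      exact IsRel.exists_left (n := 0) (rs := rs) hrs.exists_deg hann (g := g) hg'
    obtain ⟨f, hf, hfg⟩ := key
    obtain ⟨φ, hφ⟩ := exists_of_isCocycleMod hf
    exact ⟨φ, Subtype.ext ((huniq (hF φ) hφ (hG φ) hfg).2 rfl)⟩

section

variable (P) {w : ι} (hreg : IsRegRev rs) (hrs : IsHomogSeq 𝒜 rs w)
  (hann : ∀ x ∈ rs, ∀ y : X, x • y = 0) (hc : rs.length = c)

/-- Rees' isomorphism `Hom(X, R/(x_1, …, x_c)) ≅ Ext^c(X, R)`. -/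
noncomputable def rees : (X →ₗ[R] R ⧸ Ideal.ofList rs) ≃ₗ[R] P.Ext c :=
  (P.exists_rees hreg hrs hann hc).choose

lemma rees_spec {φ : X →ₗ[R] R ⧸ Ideal.ofList rs} {f g} (hf : P.Represents f φ)
    (hg : P.IsRel 0 c rs f g) :
    (P.rees hreg hrs hann hc φ : _ ⧸ P.coboundaries c) = (P.coboundaries c).mkQ g :=
  (P.exists_rees hreg hrs hann hc).choose_spec φ f g hf hg

/-- Each division by an element of degree b lowers the degree of the cochain by b, so the whole
sequence lowers it by its degree sum w. Conversely, the homotopies raise degrees by the same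
amounts. -/
lemma rees_mem_extDeg {φ : X →ₗ[R] R ⧸ Ideal.ofList rs} {i : ι} :
    P.rees hreg hrs hann hc φ ∈ P.extDeg c (i - w) ↔
      IsOfDegree (Y := GradedMod.quotRing _ hrs.isHomogIdeal) i φ := by
  constructor
  · rintro ⟨g, ⟨hgi, hg⟩, hgφ⟩
    have key : ∃ f ∈ dualDeg 𝒜 (P.gen 0) i, P.IsCocycleMod (Ideal.ofList rs) 0 f ∧
        P.IsRel 0 c rs f g := by
      have hg' : P.IsCocycleMod ⊥ c g := isCocycleMod_bot_iff.2 hg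
      obtain rfl : 0 + rs.length = c := by omega
      have := IsRel.exists_left_graded (n := 0) hrs hann hg' hgi
      rwa [sub_add_cancel] at this
    obtain ⟨f, hfi, hf, hfg⟩ := key
    obtain ⟨φ', hφ'⟩ := exists_of_isCocycleMod hf
    have : φ' = φ := (P.rees hreg hrs hann hc).injective <| Subtype.ext <|
      (P.rees_spec hreg hrs hann hc hφ' hfg).trans hgφ
    rw [← this]
    exact hφ'.isOfDegree _ hfi
  · intro hφ
    obtain ⟨f, hfi, hf⟩ := P.exists_represents_graded _ hφ
    obtain ⟨m, g, hgi, hg⟩ := IsRel.exists_right_graded hreg hrs hf.isCocycleMod hfi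
    have := hg.length_eq
    obtain rfl : m = c := by omega
    exact ⟨g, ⟨hgi, isCocycleMod_bot_iff.1 (hg.isCocycleMod hreg hf.isCocycleMod)⟩,
      (P.rees_spec hreg hrs hann hc hf hg).symm⟩

lemma extMap_rees {Q : FreeRes 𝒜 Y.deg} {u : Y →ₗ[R] X} (h : Lift Q P u)
    (hann' : ∀ x ∈ rs, ∀ y : Y, x • y = 0) (φ : X →ₗ[R] R ⧸ Ideal.ofList rs) :
    h.extMap c (P.rees hreg hrs hann hc φ) = Q.rees hreg hrs hann' hc (φ ∘ₗ u) := by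
  obtain ⟨f, hf⟩ := P.exists_represents φ
  obtain ⟨m, g, hg⟩ := IsRel.exists_right hreg hf.isCocycleMod
  have := hg.length_eq
  obtain rfl : m = c := by omega
  refine Subtype.ext ?_
  have h1 : Q.Represents (f ∘ₗ h.map 0) (φ ∘ₗ u) := fun y => by
    rw [LinearMap.comp_apply, hf]
    exact congrArg φ (LinearMap.congr_fun h.comm_ε y)
  rw [Q.rees_spec hreg hrs hann' hc h1 (hg.comp_lift h)]
  change Submodule.mapQ (P.coboundaries m) (Q.coboundaries m) (LinearMap.lcomp R R (h.map m))
    (h.map_coboundaries m) (P.rees hreg hrs hann hc φ : _ ⧸ P.coboundaries m) = _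
  rw [P.rees_spec hreg hrs hann hc hf hg]
  rfl

end

end FreeRes

end ReesIso

end ModuleLiaison

namespace ModuleLiaison

open CategoryTheory

/-! ### Perfect pairings and direct links -/

section Linking

variable {ι : Type} [AddCommGroup ι] [DecidableEq ι] {R : Type u} [CommRing R]
  {𝒜 : ι → AddSubgroup R} [GradedRing 𝒜]

lemma GradedMod.linearMap_ext {X : GradedMod 𝒜} {M : Type*} [AddCommGroup M] [Module R M]
    {f g : X →ₗ[R] M} (h : ∀ i, ∀ x ∈ X.deg i, f x = g x) : f = g :=
  LinearMap.ext fun x => X.induction (P := fun x => f x = g x) x (by rw [map_zero, map_zero]) h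
    fun x y hx hy => by rw [map_add, map_add, hx, hy]

/-- A perfect pairing of degree `e` with values in `R / J`. -/
structure PerfectPairing {J : Ideal R} (hJ : IsHomogIdeal 𝒜 J) (C : GradedMod 𝒜) (e : ι) where
  β : C ≃ₗ[R] (C →ₗ[R] R ⧸ J)
  deg : ∀ i x, x ∈ C.deg i ↔ IsOfDegree (Y := GradedMod.quotRing J hJ) (i + e) (β x)

namespace PerfectPairing

variable {J : Ideal R} {hJ : IsHomogIdeal 𝒜 J} {C D : GradedMod 𝒜} {e : ι}

/-- The values of the pairing are killed by J, and x is determined by its values. -/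
lemma smul_eq_zero (B : PerfectPairing hJ C e) {r : R} (hr : r ∈ J) (x : C) : r • x = 0 := by
  refine B.β.injective ?_
  rw [map_smul, map_zero]
  ext y
  obtain ⟨z, hz⟩ := Ideal.Quotient.mk_surjective (B.β x y)
  rw [LinearMap.smul_apply, ← hz, LinearMap.zero_apply]
  exact Ideal.Quotient.eq_zero_iff_mem.2 (Ideal.mul_mem_right _ _ hr)

/-- Against an element k of degree t, only the component of x of degree i contributes to degree t +
i + e. -/
lemma apply_comp (B : PerfectPairing hJ C e) {x k : C} {i t : ι} (hk : k ∈ C.deg t)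
    (h : B.β x k ∈ (GradedMod.quotRing J hJ).deg (t + (i + e))) :
    B.β x k = B.β (C.comp i x) k := by
  have h3 := GradedMod.comp_map_shift (X := C) (Y := GradedMod.quotRing J hJ) (t + e)
    (LinearMap.applyₗ k ∘ₗ B.β.toLinearMap) (fun j z hz => by
      have := (B.deg j z).1 hz t k hk
      rwa [show t + (j + e) = j + (t + e) by abel] at this) i x
  rw [show i + (t + e) = t + (i + e) by abel] at h3
  exact (GradedMod.comp_of_mem h).symm.trans h3

/-- The orthogonal sum of two perfect pairings. -/
noncomputable def directSum (B : PerfectPairing hJ C e) (B' : PerfectPairing hJ D e) :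
    PerfectPairing hJ (C.directSum D) e where
  β := (B.β.prodCongr B'.β).trans (LinearMap.coprodEquiv R)
  deg i x := by
    obtain ⟨x, y⟩ := x
    refine Iff.trans (and_congr (B.deg i x) (B'.deg i y)) ⟨fun h t z hz => ?_, fun h => ?_⟩
    · exact add_mem (h.1 t _ hz.1) (h.2 t _ hz.2)
    · refine ⟨fun t z hz => ?_, fun t z hz => ?_⟩
      · have := h t (z, 0) ⟨hz, zero_mem _⟩
        have h2 : ((B.β.prodCongr B'.β).trans (LinearMap.coprodEquiv R)) (x, y) (z, 0) =
          B.β x z := by simp [LinearMap.coprodEquiv]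
        rwa [← h2]
      · have := h t (0, z) ⟨zero_mem _, hz⟩
        have h2 : ((B.β.prodCongr B'.β).trans (LinearMap.coprodEquiv R)) (x, y) (0, z) =
          B'.β y z := by simp [LinearMap.coprodEquiv]
        rwa [← h2]

variable {rs : List R} {w : ι} (hreg : IsRegRev rs) (hrs : IsHomogSeq 𝒜 rs w)

/-- The self-duality given by a perfect pairing. -/
noncomputable def selfDuality (B : PerfectPairing hrs.isHomogIdeal C e)
    (hC : HasCodim C rs.length) (P : FreeRes 𝒜 C.deg) : SelfDuality C where
  c := rs.length
  codim := hC
  res := P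
  s := e - w
  α := B.β.trans (P.rees hreg hrs
    (fun _ hx => B.smul_eq_zero (Ideal.subset_span hx)) rfl)
  α_deg i x := by
    rw [LinearEquiv.trans_apply, ← add_sub_assoc, P.rees_mem_extDeg]
    exact B.deg i x

/-- The perfect pairing given by a self-duality. -/
noncomputable def ofSelfDuality (S : SelfDuality D) (hc : rs.length = S.c)
    (hann : ∀ x ∈ rs, ∀ y : D, x • y = 0) : PerfectPairing hrs.isHomogIdeal D (S.s + w) where
  β := S.α.trans (S.res.rees hreg hrs hann hc).symm
  deg i x := by
    rw [S.α_deg, ← S.res.rees_mem_extDeg hreg hrs hann hc, LinearEquiv.trans_apply,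
      LinearEquiv.apply_symm_apply, ← add_assoc, add_sub_cancel_right]

variable {M N : GradedMod 𝒜}

set_option maxHeartbeats 2000000 in
-- By naturality of Rees' isomorphism, L_C(φ)(x) corresponds to the restriction of β x to ker φ. Its
-- kernel is the orthogonal of ker φ, which is ker ψ by assumption, so N = C/ker ψ is isomorphic to
-- the image of L_C(φ).
lemma isoLinkingImage [IsNoetherianRing R] (B : PerfectPairing hrs.isHomogIdeal C e)
    (hC : HasCodim C rs.length) (P : FreeRes 𝒜 C.deg) (φ : EpiOnto C M) (ψ : EpiOnto C N)
    (h : ∀ x, ψ.φ x = 0 ↔ ∀ k, φ.φ k = 0 → B.β x k = 0) :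
    IsoLinkingImage (B.selfDuality hreg hrs hC P) φ N := by
  let K : Submodule R C := LinearMap.ker φ.φ
  let Y := C.sub K (GradedMod.isHomog_ker φ.φ_deg)
  obtain ⟨Q⟩ := exists_freeRes Y
  obtain ⟨l⟩ := Q.exists_lift P K.subtype (fun i x hx => hx)
  have hann : ∀ x ∈ rs, ∀ y : C, x • y = 0 := fun _ hx => B.smul_eq_zero (Ideal.subset_span hx)
  have hann' : ∀ x ∈ rs, ∀ y : Y, x • y = 0 := fun x hx y => Subtype.ext (hann x hx y)
  let L : C →ₗ[R] Q.Ext rs.length := linkingMap (B.selfDuality hreg hrs hC P) φ Q l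
  have hL : ∀ x, L x = Q.rees hreg hrs hann' rfl (B.β x ∘ₗ K.subtype) := fun x =>
    FreeRes.extMap_rees P hreg hrs hann rfl l hann' (B.β x)
  have hker : LinearMap.ker ψ.φ = LinearMap.ker L := by
    ext x
    rw [LinearMap.mem_ker, LinearMap.mem_ker, hL, LinearEquiv.map_eq_zero_iff, h]
    exact ⟨fun h => LinearMap.ext fun k => h k k.2, fun h k hk =>
      LinearMap.congr_fun h (⟨k, hk⟩ : K)⟩
  let E : N ≃ₗ[R] LinearMap.range L := (ψ.φ.quotKerEquivOfSurjective ψ.surjective).symm ≪≫ₗ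
    Submodule.quotEquivOfEq _ _ hker ≪≫ₗ L.quotKerEquivRange
  have hE : ∀ x, (E (ψ.φ x) : Q.Ext rs.length) = L x := fun x => by
    have : (ψ.φ.quotKerEquivOfSurjective ψ.surjective).symm (ψ.φ x) = (LinearMap.ker ψ.φ).mkQ x :=
      LinearEquiv.symm_apply_eq _ |>.2 rfl
    simp only [E, LinearEquiv.trans_apply]
    rw [this]
    rfl
  refine ⟨Q, l, E, fun i y => ?_⟩
  obtain ⟨x, rfl⟩ := ψ.surjective y
  change _ ↔ (E (ψ.φ x) : Q.Ext rs.length) ∈ Q.extDeg rs.length (i + (e - w))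
  have hcomp : ∀ x i, N.comp i (ψ.φ x) = ψ.φ (C.comp i x) := fun x i =>
    GradedMod.comp_map ψ.φ ψ.φ_deg i x
  rw [hE, hL, ← add_sub_assoc, Q.rees_mem_extDeg]
  constructor
  · intro hy
    have h1 : L x = L (C.comp i x) := by
      rw [← hE, ← hE, ← hcomp, GradedMod.comp_of_mem hy]
    rw [hL, hL] at h1
    rw [(Q.rees hreg hrs hann' rfl).injective h1]
    exact fun t k hk => (B.deg i _).1 (C.comp_mem i x) t k hk
  · intro hx
    -- If the restriction of β x to ker φ is homogeneous of degree i + e, then x may be replaced by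
    -- its component of degree i without changing that restriction, hence without changing ψ x.
    have h4 : (B.β x ∘ₗ K.subtype : Y →ₗ[R] R ⧸ Ideal.ofList rs) =
        B.β (C.comp i x) ∘ₗ K.subtype := by
      refine GradedMod.linearMap_ext fun t k hk => ?_
      exact B.apply_comp (k := (k : C)) hk (hx t k hk)
    have h1 : ψ.φ (x - C.comp i x) = 0 := by
      rw [h]
      intro k hk
      rw [map_sub, LinearMap.sub_apply, sub_eq_zero]
      exact LinearMap.congr_fun h4 ⟨k, hk⟩
    rw [map_sub, sub_eq_zero, ← hcomp] at h1
    rw [h1]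
    exact N.comp_mem i _

include hreg in
/-- Two quotients of `C` by mutually orthogonal submodules are directly linked. -/
theorem directlyLinked [IsNoetherianRing R] (B : PerfectPairing hrs.isHomogIdeal C e)
    (hC : HasCodim C rs.length) (hP : IsPerfect C) (φ : EpiOnto C M) (ψ : EpiOnto C N)
    (h : ∀ x, ψ.φ x = 0 ↔ ∀ k, φ.φ k = 0 → B.β x k = 0)
    (h' : ∀ x, φ.φ x = 0 ↔ ∀ k, ψ.φ k = 0 → B.β x k = 0) : DirectlyLinked M N := by
  obtain ⟨P⟩ := exists_freeRes C
  exact ⟨C, B.selfDuality hreg hrs hC P, φ, ψ, ⟨hP, ⟨B.selfDuality hreg hrs hC P⟩⟩,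
    B.isoLinkingImage hreg hrs hC P ψ φ h', B.isoLinkingImage hreg hrs hC P φ ψ h⟩

end PerfectPairing

end Linking

end ModuleLiaison

namespace ModuleLiaison

open CategoryTheory Abelian

/-! ### Ext with coefficients in quotients by regular sequences -/

section RegularExt

variable {R : Type u} [CommRing R]

/-- The sequence `R/J → R/J → R/(J + x)`, where `J` is generated by `rs`. -/
def consComplex (x : R) (rs : List R) : ShortComplex (ModuleCat.{u} R) :=
  ModuleCat.shortComplexOfCompEqZero (LinearMap.lsmul R (R ⧸ Ideal.ofList rs) x)
    (Submodule.factor (ofList_le_cons x rs)) (by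
      refine LinearMap.ext fun y => ?_
      obtain ⟨y, rfl⟩ := Ideal.Quotient.mk_surjective y
      exact Ideal.Quotient.eq_zero_iff_mem.2 (mem_ofList_cons.2 ⟨y, by simp⟩))

lemma consComplex_shortExact {x : R} {rs : List R}
    (h : ∀ y, x * y ∈ Ideal.ofList rs → y ∈ Ideal.ofList rs) : (consComplex x rs).ShortExact := by
  refine ModuleCat.shortComplex_shortExact _ ?_ ?_ ?_
  · intro y
    obtain ⟨y, rfl⟩ := Ideal.Quotient.mk_surjective y
    refine Iff.trans (Ideal.Quotient.eq_zero_iff_mem.trans mem_ofList_cons) ⟨?_, ?_⟩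
    · rintro ⟨a, ha⟩
      exact ⟨Ideal.Quotient.mk _ a, (Ideal.Quotient.eq.2 ha).symm⟩
    · rintro ⟨a, ha⟩
      obtain ⟨a, rfl⟩ := Ideal.Quotient.mk_surjective a
      exact ⟨a, Ideal.Quotient.eq.1 ha.symm⟩
  · refine (injective_iff_map_eq_zero (LinearMap.lsmul R (R ⧸ Ideal.ofList rs) x)).2 fun y hy => ?_
    obtain ⟨y, rfl⟩ := Ideal.Quotient.mk_surjective y
    exact Ideal.Quotient.eq_zero_iff_mem.2 (h _ (Ideal.Quotient.eq_zero_iff_mem.1 hy))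
  · exact Submodule.factor_surjective (ofList_le_cons x rs)

lemma smul_ext_eq_zero {X Y : ModuleCat.{u} R} {x : R} (hx : ∀ y : X, x • y = 0) {i : ℕ}
    (e : Ext X Y i) : x • e = 0 := by
  have h : x • 𝟙 X = 0 := by ext y; exact hx y
  have : x • e = (Ext.mk₀ (x • 𝟙 X)).comp e (zero_add i) := by simp [Ext.mk₀_smul]
  rw [this, h, Ext.mk₀_zero, Ext.zero_comp]

lemma comp_consComplex_f {X : ModuleCat.{u} R} {x : R} {rs : List R} (hx : ∀ y : X, x • y = 0)
    {i : ℕ} (e : Ext X (consComplex x rs).X₁ i) :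
    e.comp (Ext.mk₀ (consComplex x rs).f) (add_zero i) = 0 :=
  (Ext.smul_eq_comp_mk₀ e x).symm.trans (smul_ext_eq_zero hx e)

/-- Since x kills X, every class dies under multiplication by x on R/(rs). It therefore comes from
Ext in one degree less with coefficients in R/(x, rs), where induction applies; in degree 0
multiplication by x is also injective. -/
lemma subsingleton_ext_of_lt {l rs : List R} (hreg : IsRegRev (l ++ rs)) {X : ModuleCat.{u} R}
    (hX : ∀ x ∈ l, ∀ y : X, x • y = 0) {i : ℕ} (hi : i < l.length) :
    Subsingleton (Ext X (ModuleCat.of R (R ⧸ Ideal.ofList rs)) i) := by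
  induction l using List.reverseRecOn generalizing rs i with
  | nil => simp at hi
  | append_singleton l x ih =>
    rw [List.append_assoc, List.singleton_append] at hreg
    have hS := consComplex_shortExact (isRegRev_of_append l hreg).1
    have hx := hX x (by simp)
    refine subsingleton_of_forall_eq 0 fun e => ?_
    cases i with
    | zero =>
      have := hS.mono_f
      refine Ext.postcomp_mk₀_injective_of_mono X (consComplex x rs).f ?_
      exact (comp_consComplex_f hx e).trans (map_zero _).symm
    | succ i =>
      obtain ⟨e', he'⟩ := Ext.covariant_sequence_exact₁ X hS e (comp_consComplex_f hx e) rfl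
      have := ih hreg (fun y hy => hX y (by simp [hy])) (i := i) (by simpa using hi)
      have h0 : e' = 0 := Subsingleton.elim (h := this) _ _
      subst h0
      exact he'.symm.trans (Ext.zero_comp ..)

/-- Dimension shifting: the connecting map moves the extension problem from R/(x, rs) to R/(rs) in
one degree more. The solution there comes back because x kills S.X₂, and it restricts to e because
Ext(S.X₁, R/(rs)) vanishes in degree l.length. At the end of the shifting the only obstruction lies
in Ext(S.X₃, R), which is assumed to vanish. -/
lemma exists_ext_extension {l rs : List R} (hreg : IsRegRev (l ++ rs))
    {S : ShortComplex (ModuleCat.{u} R)} (hS : S.ShortExact)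
    (h₁ : ∀ x ∈ l ++ rs, ∀ y : S.X₁, x • y = 0) (h₂ : ∀ x ∈ l ++ rs, ∀ y : S.X₂, x • y = 0)
    (hT : Subsingleton (Ext S.X₃ (ModuleCat.of R (R ⧸ Ideal.ofList ([] : List R)))
      ((l ++ rs).length + 1)))
    (e : Ext S.X₁ (ModuleCat.of R (R ⧸ Ideal.ofList rs)) l.length) :
    ∃ e' : Ext S.X₂ (ModuleCat.of R (R ⧸ Ideal.ofList rs)) l.length,
      (Ext.mk₀ S.f).comp e' (zero_add _) = e := by
  induction rs generalizing l with
  | nil =>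
    rw [List.append_nil] at hT
    exact Ext.contravariant_sequence_exact₁ hS _ e (add_comm _ _) (Subsingleton.elim _ _)
  | cons x rs ih =>
    have hS' := consComplex_shortExact (isRegRev_of_append l hreg).1
    have e₁ : l ++ x :: rs = l ++ [x] ++ rs := by simp
    have hlen : l.length + 1 = (l ++ [x]).length := by simp
    rw [e₁] at h₁ h₂ hT hreg
    obtain ⟨z, hz⟩ := ih (l := l ++ [x]) hreg h₁ h₂ hT (e.comp hS'.extClass hlen)
    have hx : x ∈ l ++ [x] ++ rs := by simp
    obtain ⟨z', rfl⟩ := Ext.covariant_sequence_exact₁ S.X₂ hS' z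
      (comp_consComplex_f (h₂ x hx) z) hlen
    let w : Ext S.X₁ (consComplex x rs).X₃ l.length := (Ext.mk₀ S.f).comp z' (zero_add _)
    let e₀ : Ext S.X₁ (consComplex x rs).X₃ l.length := e
    have h4 : w.comp hS'.extClass hlen = e₀.comp hS'.extClass hlen := 
      (Ext.comp_assoc _ _ _ (zero_add _) hlen (by omega)).trans hz
    have h3 : (e₀ - w).comp hS'.extClass hlen = 0 := by
      rw [sub_eq_add_neg, Ext.add_comp, Ext.neg_comp, h4, add_neg_cancel]
    obtain ⟨v, hv⟩ := Ext.covariant_sequence_exact₃ S.X₁ hS' _ hlen h3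
    have hv0 : v = 0 := Subsingleton.elim (h := subsingleton_ext_of_lt hreg
      (fun y hy => h₁ y (List.mem_append_left _ hy)) (by simp)) _ _
    rw [hv0, Ext.zero_comp] at hv
    exact ⟨z', (sub_eq_zero.1 hv.symm).symm⟩

lemma hasProjectiveDimensionLE_quotient {rs : List R} (hreg : IsRegRev rs) :
    HasProjectiveDimensionLE (ModuleCat.of R (R ⧸ Ideal.ofList rs)) rs.length := by
  induction rs with
  | nil =>
    let e : R ≃ₗ[R] (R ⧸ Ideal.ofList ([] : List R)) :=
      (Submodule.quotEquivOfEqBot _ Ideal.ofList_nil).symm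
    have : Projective (ModuleCat.of R R) := ModuleCat.projective_of_free (Module.Basis.singleton Unit R)
    have : HasProjectiveDimensionLE (ModuleCat.of R R) 0 := inferInstance
    exact hasProjectiveDimensionLT_of_iso e.toModuleIso 1
  | cons x rs ih =>
    have hS := consComplex_shortExact hreg.1
    have h1 := ih hreg.2
    have h2 : HasProjectiveDimensionLT (ModuleCat.of R (R ⧸ Ideal.ofList rs)) (rs.length + 1 + 1) :=
      hasProjectiveDimensionLT_of_ge _ (rs.length + 1) _ (Nat.le_succ _)
    exact hS.hasProjectiveDimensionLT_X₃ (rs.length + 1) h1 h2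

end RegularExt

/-! ### Self-injectivity of B/I for a local ring of finite injective dimension -/

section LocalRing

variable {B : Type u} [CommRing B] [IsLocalRing B] [IsNoetherianRing B]

open IsLocalRing

omit [IsNoetherianRing B] in
lemma maximalIdeal_eq_ker {I : Ideal B} {s : B} (hs : s ∉ I) (hsm : ∀ x ∈ maximalIdeal B, x * s ∈ I) :
    maximalIdeal B = LinearMap.ker (LinearMap.toSpanSingleton B (B ⧸ I) (Ideal.Quotient.mk I s)) := by
  refine (maximalIdeal.isMaximal B).eq_of_le (fun h => hs ?_) fun x hx =>
    Ideal.Quotient.eq_zero_iff_mem.2 (hsm x hx)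
  have : (1 : B) ∈ LinearMap.ker (LinearMap.toSpanSingleton B (B ⧸ I) (Ideal.Quotient.mk I s)) := by
    rw [h]; trivial
  rw [LinearMap.mem_ker, LinearMap.toSpanSingleton_apply, one_smul] at this
  exact Ideal.Quotient.eq_zero_iff_mem.1 this

/-- Descending induction on i, starting above the injective dimension, combined with a prime
filtration of X. The residue field embeds into B/I through the socle element s, and B/I has
projective dimension at most rs.length < i, so vanishing in degree i + 1 for the cokernel gives it
in degree i for the residue field. For another prime p, an element y of the maximal ideal outside p
is regular on B/p, so Ext^i equals y Ext^i and Nakayama's lemma applies. -/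
lemma subsingleton_ext_of_socle {rs : List B} (hreg : IsRegRev rs) {s : B}
    (hs : s ∉ Ideal.ofList rs) (hsm : ∀ x ∈ maximalIdeal B, x * s ∈ Ideal.ofList rs)
    {T : ModuleCat.{u} B} [Module.Finite B T] {n : ℕ} (hT : HasInjectiveDimensionLE T n)
    {i : ℕ} (hi : rs.length < i) (X : ModuleCat.{u} B) [Module.Finite B X] :
    Subsingleton (Ext X T i) := by
  obtain hin | hin := le_or_gt (n + 1) i
  · exact hT.subsingleton T (n + 1) i hin X
  · generalize hk : n + 1 - i = k
    induction k generalizing i X with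
    | zero => omega
    | succ k ih =>
      have hnext : ∀ (Q : Type u) [AddCommGroup Q] [Module B Q] [Module.Finite B Q],
          Subsingleton (Ext (ModuleCat.of B Q) T (i + 1)) := fun Q _ _ _ => by
        obtain h | h := le_or_gt (n + 1) (i + 1)
        · exact hT.subsingleton T (n + 1) _ h _
        · exact ih (by omega) (ModuleCat.of B Q) h (by omega)
      have hpd := hasProjectiveDimensionLE_quotient hreg
      suffices ∀ (N : Type u) [AddCommGroup N] [Module B N], Module.Finite B N →
        Subsingleton (Ext (ModuleCat.of B N) T i) from this X inferInstance
      intro N _ _ hfin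
      induction hfin using IsNoetherianRing.induction_on_isQuotientEquivQuotientPrime B with
      | subsingleton N =>
        have hz : Limits.IsZero (ModuleCat.of B N) := ModuleCat.isZero_of_subsingleton _
        have : HasProjectiveDimensionLT (ModuleCat.of B N) 0 := hz.hasProjectiveDimensionLT_zero
        exact HasProjectiveDimensionLT.subsingleton _ 0 i (Nat.zero_le _) T
      | quotient N p f =>
        by_cases hp : p.1 = maximalIdeal B
        · have hker := hp.trans (maximalIdeal_eq_ker hs hsm)
          let v := Submodule.liftQ p.1 (LinearMap.toSpanSingleton B (B ⧸ Ideal.ofList rs)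
            (Ideal.Quotient.mk _ s)) hker.le
          have hv : Function.Injective v :=
            LinearMap.ker_eq_bot.1 (Submodule.ker_liftQ_eq_bot _ _ _ hker.ge)
          let u : N →ₗ[B] B ⧸ Ideal.ofList rs := v ∘ₗ f.toLinearMap
          have hu : Function.Injective u := hv.comp f.injective
          let S := ModuleCat.shortComplexOfCompEqZero u (LinearMap.range u).mkQ
            (by rw [LinearMap.range_mkQ_comp])
          have hS : S.ShortExact := ModuleCat.shortComplex_shortExact S
            (LinearMap.exact_map_mkQ_range u) hu (Submodule.mkQ_surjective _)
          refine subsingleton_of_forall_eq 0 fun e => ?_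
          obtain ⟨x, rfl⟩ := Ext.contravariant_sequence_exact₁ hS T e (add_comm 1 i)
            (Subsingleton.elim (h := hnext _) _ _)
          have : x = 0 := Subsingleton.elim (h := HasProjectiveDimensionLT.subsingleton
            (ModuleCat.of B (B ⧸ Ideal.ofList rs)) (rs.length + 1) i hi T) _ _
          rw [this, Ext.comp_zero]
        · obtain ⟨y, hy, hyp⟩ := SetLike.not_le_iff_exists.1 fun h =>
            hp ((le_maximalIdeal p.2.ne_top).antisymm h)
          have hreg : IsSMulRegular N y := by
            refine (f.isSMulRegular_congr y).2 ?_
            refine IsSMulRegular.of_right_eq_zero_of_smul fun z hz => ?_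
            obtain ⟨z, rfl⟩ := Ideal.Quotient.mk_surjective z
            rw [Ideal.Quotient.eq_zero_iff_mem]
            exact (p.2.mem_or_mem (Ideal.Quotient.eq_zero_iff_mem.1 hz)).resolve_left hyp
          have hS : (ModuleCat.smulShortComplex (ModuleCat.of B N) y).ShortExact :=
            IsSMulRegular.smulShortComplex_shortExact (M := ModuleCat.of B N) hreg
          have hle : (⊤ : Submodule B (Ext (ModuleCat.of B N) T i)) ≤ maximalIdeal B • ⊤ := by
            intro e _
            obtain ⟨x, rfl⟩ := Ext.contravariant_sequence_exact₁ hS T e (add_comm 1 i)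
              (Subsingleton.elim (h := hnext _) _ _)
            have : (Ext.mk₀ (ModuleCat.smulShortComplex (ModuleCat.of B N) y).f).comp x
              (zero_add i) = y • x := by
              rw [ModuleCat.smulShortComplex_f_eq_smul_id]
              refine (congrArg (Ext.comp · x (zero_add i)) (Ext.mk₀_smul y (𝟙 (ModuleCat.of B N)))).trans ?_
              refine (Ext.smul_comp ..).trans (congrArg (y • ·) (Ext.mk₀_id_comp x))
            rw [this]
            exact Submodule.smul_mem_smul hy trivial
          have := Submodule.eq_bot_of_le_smul_of_le_jacobson_bot (maximalIdeal B) _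
            Module.Finite.fg_top hle (maximalIdeal_le_jacobson _)
          exact (Submodule.subsingleton_iff B).1 (subsingleton_of_bot_eq_top this.symm)
      | exact N₁ N₂ N₃ f g hf hg hfg h₁ h₃ =>
        let S := ModuleCat.shortComplexOfCompEqZero f g hfg.linearMap_comp_eq_zero
        have hS : S.ShortExact := ModuleCat.shortComplex_shortExact S hfg hf hg
        refine subsingleton_of_forall_eq 0 fun e => ?_
        obtain ⟨x, rfl⟩ := Ext.contravariant_sequence_exact₂ hS T e
          (Subsingleton.elim (h := h₁) _ _)
        have : x = 0 := Subsingleton.elim (h := h₃) _ _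
        rw [this, Ext.comp_zero]

theorem exists_extension_of_socle {rs : List B} (hreg : IsRegRev rs) {s : B}
    (hs : s ∉ Ideal.ofList rs) (hsm : ∀ x ∈ maximalIdeal B, x * s ∈ Ideal.ofList rs)
    {n : ℕ} (hB : HasInjectiveDimensionLE (ModuleCat.of B B) n)
    {Y' Y : Type u} [AddCommGroup Y'] [Module B Y'] [AddCommGroup Y] [Module B Y]
    [Module.Finite B Y] {i : Y' →ₗ[B] Y} (hi : Function.Injective i)
    (hY : ∀ x ∈ rs, ∀ y : Y, x • y = 0) (g : Y' →ₗ[B] B ⧸ Ideal.ofList rs) :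
    ∃ G : Y →ₗ[B] B ⧸ Ideal.ofList rs, G ∘ₗ i = g := by
  let e : B ≃ₗ[B] (B ⧸ Ideal.ofList ([] : List B)) :=
    (Submodule.quotEquivOfEqBot _ Ideal.ofList_nil).symm
  have hT : HasInjectiveDimensionLE (ModuleCat.of B (B ⧸ Ideal.ofList ([] : List B))) n :=
    hasInjectiveDimensionLT_of_iso e.toModuleIso (n + 1)
  let S := ModuleCat.shortComplexOfCompEqZero i (LinearMap.range i).mkQ
    (by rw [LinearMap.range_mkQ_comp])
  have hS : S.ShortExact := ModuleCat.shortComplex_shortExact S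
    (LinearMap.exact_map_mkQ_range i) hi (Submodule.mkQ_surjective _)
  have hfin : Module.Finite B (ModuleCat.of B (B ⧸ Ideal.ofList ([] : List B))) :=
    inferInstanceAs (Module.Finite B (B ⧸ Ideal.ofList ([] : List B)))
  have hfin' : Module.Finite B S.X₃ := inferInstanceAs (Module.Finite B (Y ⧸ LinearMap.range i))
  obtain ⟨e', he'⟩ := exists_ext_extension (l := []) hreg hS
    (fun x hx y => hi ((map_smul i x y).trans ((hY x hx _).trans (map_zero i).symm)))
    -- With l empty the obstruction sits in degree rs.length + 1, just above the bound of
    -- `subsingleton_ext_of_socle`.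
    hY (subsingleton_ext_of_socle hreg hs hsm hT (Nat.lt_succ_self _) S.X₃)
    (Ext.mk₀ (ModuleCat.ofHom g))
  obtain ⟨G, rfl⟩ := (Ext.mk₀_bijective _ _).2 e'
  rw [Ext.mk₀_comp_mk₀] at he'
  have := (Ext.mk₀_bijective _ _).1 he'
  exact ⟨G.hom, congrArg ModuleCat.Hom.hom this⟩

/-- For x outside an ideal J of A = B/I, sending the class of x in A/J to s and extending to A/J → A
gives multiplication by an element that kills J but not x. So J ↦ Ann J strictly reverses
inclusions, and the ascending chain condition implies the descending one. -/
theorem isArtinianRing_of_socle {rs : List B} (hreg : IsRegRev rs) {s : B}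
    (hs : s ∉ Ideal.ofList rs) (hsm : ∀ x ∈ maximalIdeal B, x * s ∈ Ideal.ofList rs)
    {n : ℕ} (hB : HasInjectiveDimensionLE (ModuleCat.of B B) n) :
    IsArtinianRing (B ⧸ Ideal.ofList rs) := by
  set I := Ideal.ofList rs with hI
  have key : ∀ (J : Ideal (B ⧸ I)) (x : B ⧸ I), x ∉ J → ∃ y ∈ J.annihilator, y * x ≠ 0 := by
    intro J x hx
    let J' : Submodule B (B ⧸ I) := J.restrictScalars B
    let t := LinearMap.toSpanSingleton B ((B ⧸ I) ⧸ J') (J'.mkQ x)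
    have ht : LinearMap.ker t ≤ maximalIdeal B := le_maximalIdeal fun h => hx <| by
      have h1 : (1 : B) ∈ LinearMap.ker t := by rw [h]; trivial
      rw [LinearMap.mem_ker, LinearMap.toSpanSingleton_apply, one_smul] at h1
      exact (Submodule.Quotient.mk_eq_zero J').1 h1
    have hker := maximalIdeal_eq_ker hs hsm
    obtain ⟨G, hG⟩ := exists_extension_of_socle hreg hs hsm hB
      (i := (LinearMap.ker t).liftQ t le_rfl)
      (LinearMap.ker_eq_bot.1 (Submodule.ker_liftQ_eq_bot _ _ _ le_rfl))
      (fun r hr y => by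
        obtain ⟨y, rfl⟩ := Submodule.mkQ_surjective _ y
        obtain ⟨y, rfl⟩ := Ideal.Quotient.mk_surjective y
        rw [← map_smul]
        have : r • (Ideal.Quotient.mk I y) = 0 := Ideal.Quotient.eq_zero_iff_mem.2
          (Ideal.mul_mem_right _ _ (Ideal.subset_span hr))
        exact (congrArg _ this).trans (map_zero _))
      ((LinearMap.ker t).liftQ (LinearMap.toSpanSingleton B (B ⧸ I) (Ideal.Quotient.mk I s))
        (ht.trans hker.le))
    have hG' : ∀ z : B ⧸ I, G (J'.mkQ z) = G (J'.mkQ 1) * z := fun z => by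
      obtain ⟨z, rfl⟩ := Ideal.Quotient.mk_surjective z
      have h1 : Ideal.Quotient.mk I z = z • (1 : B ⧸ I) := by
        rw [Algebra.smul_def, mul_one]; rfl
      rw [h1, map_smul, map_smul, mul_smul_comm, mul_one]
    refine ⟨G (J'.mkQ 1), Submodule.mem_annihilator.2 fun j hj => ?_, ?_⟩
    · have h0 : J'.mkQ j = 0 := (Submodule.Quotient.mk_eq_zero J').2 hj
      rw [smul_eq_mul, ← hG', h0, map_zero]
    · rw [← hG']
      have := LinearMap.congr_fun hG (Submodule.Quotient.mk 1)
      simp only [LinearMap.comp_apply, Submodule.liftQ_apply, t, LinearMap.toSpanSingleton_apply,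
        one_smul] at this
      rw [this]
      exact fun h => hs (Ideal.Quotient.eq_zero_iff_mem.1 h)
  have hanti : StrictAnti fun J : Ideal (B ⧸ I) => J.annihilator := fun J₁ J₂ h => by
    refine lt_of_le_of_ne (Submodule.annihilator_mono h.le) fun (h' : J₂.annihilator = J₁.annihilator) => ?_
    obtain ⟨x, hx, hx'⟩ := SetLike.not_le_iff_exists.1 (not_le_of_gt h)
    obtain ⟨y, hy, hyx⟩ := key J₁ x hx'
    exact hyx (Submodule.mem_annihilator.1 (h' ▸ hy) x hx)
  exact hanti.wellFoundedLT

end LocalRing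

end ModuleLiaison

namespace ModuleLiaison

open CategoryTheory Abelian

/-! ### Finite injective dimension passes to all localizations -/

section GorensteinLocalization

variable {R : Type u} [CommRing R]

attribute [local instance] RingHomInvPair.of_ringEquiv in
lemma hasInjectiveDimensionLE_of_ringEquiv {A B : Type u} [CommRing A] [CommRing B] (e : A ≃+* B)
    {n : ℕ} (h : HasInjectiveDimensionLE (ModuleCat.of A A) n) :
    HasInjectiveDimensionLE (ModuleCat.of B B) n := by
  let f : ModuleCat.of A A ≃ₛₗ[RingHomClass.toRingHom e] ModuleCat.of B B :=
    { e with map_smul' := fun a x => map_mul e a x }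
  exact (ModuleCat.hasInjectiveDimensionLE_iff_of_semiLinearEquiv e f n).1 h

/-- Any localization of `X` is isomorphic to the chosen one. -/
noncomputable def localizedModuleEquiv {X : ModuleCat.{u} R} (S : Submonoid R) {N : Type u}
    [AddCommGroup N] [Module R N] (g : X →ₗ[R] N) [IsLocalizedModule S g] :
    X.localizedModule S ≃ₗ[R] N :=
  have := ModuleCat.localizedModule_isLocalizedModule X S
  IsLocalizedModule.linearEquiv S (X.localizedModuleMkLinearMap S) g

lemma hasInjectiveDimensionLE_localization [IsNoetherianRing R] (S : Submonoid R) {n : ℕ}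
    (h : HasInjectiveDimensionLE (ModuleCat.of R R) n) :
    HasInjectiveDimensionLE (ModuleCat.of (Localization S) (Localization S)) n := by
  have h1 := (ModuleCat.of R R).localizedModule_hasInjectiveDimensionLE n S
  let e := LinearEquiv.extendScalarsOfIsLocalization S (Localization S)
    (localizedModuleEquiv (X := ModuleCat.of R R) S (Algebra.linearMap R (Localization S)))
  exact hasInjectiveDimensionLT_of_iso (X' := ModuleCat.of (Localization S) (Localization S))
    e.toModuleIso (n + 1)

/-- The injective dimension is only controlled at maximal ideals, so R_p is obtained by localizing
R_q again, for a maximal ideal q containing p. -/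
theorem IsGorensteinRing.exists_hasInjectiveDimensionLE (hR : IsGorensteinRing R) (p : Ideal R)
    [p.IsPrime] : ∃ n : ℕ, HasInjectiveDimensionLE
      (ModuleCat.of (Localization.AtPrime p) (Localization.AtPrime p)) n := by
  have := hR.noetherian
  obtain ⟨q, hq, hpq⟩ := Ideal.exists_le_maximal p (Ideal.IsPrime.ne_top ‹_›)
  obtain ⟨n, hn⟩ := hR.injDim q
  let P := p.map (algebraMap R (Localization.AtPrime q))
  have hd : Disjoint (q.primeCompl : Set R) (p : Set R) :=
    Set.disjoint_left.2 fun x hx hxp => hx (hpq hxp)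
  have hP : P.IsPrime := IsLocalization.isPrime_of_isPrime_disjoint q.primeCompl _ p ‹_› hd
  have hc : P.comap (algebraMap R (Localization.AtPrime q)) = p :=
    IsLocalization.under_map_of_isPrime_disjoint q.primeCompl _ ‹_› hd
  have hn' := hasInjectiveDimensionLE_localization P.primeCompl hn
  let e := IsLocalization.localizationLocalizationAtPrimeIsoLocalization q.primeCompl P
  refine ⟨n, hasInjectiveDimensionLE_of_ringEquiv ?_ hn'⟩
  have h := Localization.isLocalization
    (M := (P.comap (algebraMap R (Localization.AtPrime q))).primeCompl)
  simp only [hc] at h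
  exact e.symm.toRingEquiv.trans (@IsLocalization.algEquiv _ _ p.primeCompl _ _ _ h _ _ _ _).toRingEquiv

end GorensteinLocalization

/-! ### Associated primes of R/(rs), and homomorphisms that separate elements -/

section AssociatedPrimes

variable {R : Type u} [CommRing R] [IsNoetherianRing R]

lemma mem_associatedPrimes_iff {M : Type*} [AddCommGroup M] [Module R M] {p : Ideal R} :
    p ∈ associatedPrimes R M ↔ p.IsPrime ∧ ∃ x : M, ∀ a, a ∈ p ↔ a • x = 0 := by
  rw [AssociatedPrimes.mem_iff, isAssociatedPrime_iff]
  refine and_congr_right fun _ => exists_congr fun x => ?_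
  rw [Ideal.ext_iff]
  simp [Submodule.mem_colon_singleton]

lemma exists_mem_associatedPrimes_smul {M : Type*} [AddCommGroup M] [Module R M] {x : M}
    (hx : x ≠ 0) : ∃ p ∈ associatedPrimes R M, ∃ b : R, ∀ a, a ∈ p ↔ a • b • x = 0 := by
  have : Nontrivial (Submodule.span R {x}) :=
    ⟨⟨x, Submodule.mem_span_singleton_self x⟩, 0, fun h => hx (congrArg Subtype.val h)⟩
  obtain ⟨p, hp⟩ := associatedPrimes.nonempty R (Submodule.span R {x})
  obtain ⟨hp', ⟨y, hy⟩, h⟩ := mem_associatedPrimes_iff.1 hp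
  obtain ⟨b, rfl⟩ := Submodule.mem_span_singleton.1 hy
  refine ⟨p, mem_associatedPrimes_iff.2 ⟨hp', b • x, ?_⟩, b, ?_⟩ <;>
  · intro a
    rw [h, Subtype.ext_iff]
    rfl

omit [IsNoetherianRing R] in
lemma IsRegRev.map_localization {S : Submonoid R} {B : Type*} [CommRing B] [Algebra R B]
    [IsLocalization S B] {rs : List R} (h : IsRegRev rs) :
    IsRegRev (rs.map (algebraMap R B)) := by
  induction rs with
  | nil => trivial
  | cons x rs ih =>
    refine ⟨fun y hy => ?_, ih h.2⟩
    rw [← Ideal.map_ofList] at hy ⊢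
    obtain ⟨⟨a, s⟩, ha⟩ := IsLocalization.surj S y
    simp only at ha
    rw [← Ideal.unit_mul_mem_iff_mem _ (IsLocalization.map_units B s), mul_comm, ha]
    have h1 : algebraMap R B (x * a) ∈ (Ideal.ofList rs).map (algebraMap R B) := by
      rw [map_mul, ← ha, ← mul_assoc]
      exact Ideal.mul_mem_right _ _ hy
    obtain ⟨m, hm, hma⟩ := (IsLocalization.algebraMap_mem_map_algebraMap_iff S B _ _).1 h1
    refine (IsLocalization.algebraMap_mem_map_algebraMap_iff S B _ _).2 ⟨m, hm, h.1 _ ?_⟩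
    rwa [mul_left_comm]

section Socle

variable {rs : List R} {p : Ideal R} [p.IsPrime] {s : R}

lemma socle_localization (hs : ∀ a, a ∈ p ↔ a * s ∈ Ideal.ofList rs) :
    algebraMap R (Localization.AtPrime p) s ∉ Ideal.ofList (rs.map (algebraMap R (Localization.AtPrime p))) ∧
    ∀ x ∈ IsLocalRing.maximalIdeal (Localization.AtPrime p),
      x * algebraMap R (Localization.AtPrime p) s ∈
        Ideal.ofList (rs.map (algebraMap R (Localization.AtPrime p))) := by
  rw [← Ideal.map_ofList]
  constructor
  · intro h
    obtain ⟨m, hm, hma⟩ := (IsLocalization.algebraMap_mem_map_algebraMap_iff p.primeCompl _ _ _).1 h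
    exact hm ((hs m).2 hma)
  · intro x hx
    rw [← Localization.AtPrime.map_eq_maximalIdeal] at hx
    have := Ideal.mul_mem_mul hx (Ideal.mem_map_of_mem (algebraMap R (Localization.AtPrime p))
      (Ideal.mem_span_singleton_self s))
    rw [← Ideal.map_mul] at this
    refine Ideal.map_mono ?_ this
    rw [Ideal.mul_le]
    intro a ha b hb
    obtain ⟨c, rfl⟩ := Ideal.mem_span_singleton'.1 hb
    rw [mul_left_comm]
    exact Ideal.mul_mem_left _ _ ((hs a).1 ha)

/-- The localization of R/(rs) at p is Artinian and local, so the image of a is nilpotent there; the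
element u clears the denominator. This is minimality of p over (rs) in terms of elements. -/
lemma exists_mul_pow_mem (hR : IsGorensteinRing R) (hreg : IsRegRev rs)
    (hs : ∀ a, a ∈ p ↔ a * s ∈ Ideal.ofList rs) {a : R} (ha : a ∈ p) :
    ∃ u ∉ p, ∃ k, u * a ^ k ∈ Ideal.ofList rs := by
  let B := Localization.AtPrime p
  obtain ⟨n, hn⟩ := hR.exists_hasInjectiveDimensionLE p
  obtain ⟨h1, h2⟩ := socle_localization hs
  have hart := isArtinianRing_of_socle (hreg.map_localization (S := p.primeCompl)) h1 h2 hn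
  set J := Ideal.ofList (rs.map (algebraMap R B)) with hJ
  have : Nontrivial (B ⧸ J) := Ideal.Quotient.nontrivial_iff.2 fun h => h1 (h ▸ trivial)
  have : IsLocalRing (B ⧸ J) := IsLocalRing.of_surjective' _ Ideal.Quotient.mk_surjective
  have hm : Ideal.Quotient.mk J (algebraMap R B a) ∈ IsLocalRing.maximalIdeal (B ⧸ J) := by
    rw [IsLocalRing.mem_maximalIdeal]
    intro hu
    have : IsUnit (algebraMap R B a) := by
      have : IsLocalHom (Ideal.Quotient.mk J) :=
        IsLocalHom.of_surjective _ Ideal.Quotient.mk_surjective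
      exact isUnit_of_map_unit _ _ hu
    exact (IsLocalization.AtPrime.isUnit_to_map_iff B p a).1 this ha
  obtain ⟨k, hk⟩ := Ring.KrullDimLE.isNilpotent_iff_mem_maximalIdeal.2 hm
  rw [← map_pow, ← map_pow, Ideal.Quotient.eq_zero_iff_mem, hJ, ← Ideal.map_ofList] at hk
  obtain ⟨m, hm, hma⟩ := (IsLocalization.algebraMap_mem_map_algebraMap_iff p.primeCompl _ _ _).1 hk
  exact ⟨m, hm, k, hma⟩

/-- After localizing at p, the annihilator of y is contained in the maximal ideal, which is the
annihilator of s; so y ↦ s is well defined on the submodule generated by y. Self-injectivity extends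
it to M_p, and clearing denominators (M is finitely presented) gives a map defined over R. -/
lemma exists_map_ne_zero_of_socle (hR : IsGorensteinRing R) (hreg : IsRegRev rs)
    (hs : ∀ a, a ∈ p ↔ a * s ∈ Ideal.ofList rs)
    {M : Type u} [AddCommGroup M] [Module R M] [Module.Finite R M]
    (hM : ∀ x ∈ rs, ∀ y : M, x • y = 0) {y : M} (hy : ∀ a, a ∈ p ↔ a • y = 0) :
    ∃ f : M →ₗ[R] R ⧸ Ideal.ofList rs, f y ≠ 0 := by
  let B := Localization.AtPrime p
  obtain ⟨n, hn⟩ := hR.exists_hasInjectiveDimensionLE p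
  obtain ⟨h1, h2⟩ := socle_localization hs
  have hreg' := hreg.map_localization (S := p.primeCompl) (B := B)
  set J := Ideal.ofList (rs.map (algebraMap R B)) with hJ
  let N := LocalizedModule p.primeCompl M
  let ν : M →ₗ[R] N := LocalizedModule.mkLinearMap p.primeCompl M
  let t : B →ₗ[B] N := LinearMap.toSpanSingleton B N (ν y)
  have ht : LinearMap.ker t ≤ IsLocalRing.maximalIdeal B := IsLocalRing.le_maximalIdeal fun h => by
    have h1 : (1 : B) ∈ LinearMap.ker t := by rw [h]; trivial
    rw [LinearMap.mem_ker, LinearMap.toSpanSingleton_apply, one_smul] at h1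
    obtain ⟨c, hc⟩ := (IsLocalizedModule.eq_zero_iff p.primeCompl ν).1 h1
    exact c.2 ((hy c).2 hc)
  have hker := maximalIdeal_eq_ker h1 h2
  obtain ⟨G, hG⟩ := exists_extension_of_socle hreg' h1 h2 hn
    (i := (LinearMap.ker t).liftQ t le_rfl)
    (LinearMap.ker_eq_bot.1 (Submodule.ker_liftQ_eq_bot _ _ _ le_rfl))
    (fun r hr z => by
      obtain ⟨r, hr', rfl⟩ := List.mem_map.1 hr
      rw [algebraMap_smul]
      obtain ⟨⟨z, c⟩, rfl⟩ := IsLocalizedModule.mk'_surjective p.primeCompl ν z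
      rw [Function.uncurry_apply_pair, ← IsLocalizedModule.mk'_smul, hM r hr', IsLocalizedModule.mk'_zero])
    ((LinearMap.ker t).liftQ (LinearMap.toSpanSingleton B (B ⧸ J) (Ideal.Quotient.mk J _))
      (ht.trans hker.le))
  have hGy : G (ν y) = Ideal.Quotient.mk J (algebraMap R B s) := by
    have := LinearMap.congr_fun hG (Submodule.Quotient.mk 1)
    simpa only [LinearMap.comp_apply, Submodule.liftQ_apply, t, LinearMap.toSpanSingleton_apply,
      one_smul] using this
  let J' := Submodule.localized' B p.primeCompl (Algebra.linearMap R B) (Ideal.ofList rs)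
  have hJ' : J = J' := by rw [hJ, ← Ideal.map_ofList]; exact (Ideal.localized'_eq_map _ _ _).symm
  let G' : M →ₗ[R] B ⧸ J' :=
    ((Submodule.quotEquivOfEq J J' hJ').toLinearMap ∘ₗ G).restrictScalars R ∘ₗ ν
  have := Module.finitePresentation_of_finite R M
  obtain ⟨h, c, hh⟩ := Module.FinitePresentation.exists_lift_of_isLocalizedModule p.primeCompl
    (Submodule.toLocalizedQuotient' B p.primeCompl (Algebra.linearMap R B) (Ideal.ofList rs)) G'
  refine ⟨h, fun h0 => h1 ?_⟩
  have h3 := LinearMap.congr_fun hh y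
  have h4 : G' y = Submodule.Quotient.mk (algebraMap R B s) := by
    change Submodule.quotEquivOfEq J J' hJ' (G (ν y)) = _
    rw [hGy]
    rfl
  rw [LinearMap.comp_apply, h0, map_zero, LinearMap.smul_apply, h4] at h3
  have h5 : algebraMap R B c * algebraMap R B s ∈ J := by
    rw [hJ', ← Submodule.Quotient.mk_eq_zero, ← smul_eq_mul, algebraMap_smul]
    exact h3.symm
  exact (Ideal.unit_mul_mem_iff_mem _ (IsLocalization.map_units B c)).1 h5

end Socle

variable {rs : List R}

lemma exists_socle_of_mem_associatedPrimes {J p : Ideal R} (hp : p ∈ associatedPrimes R (R ⧸ J)) :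
    ∃ s : R, ∀ a, a ∈ p ↔ a * s ∈ J := by
  obtain ⟨_, x, hx⟩ := mem_associatedPrimes_iff.1 hp
  obtain ⟨s, rfl⟩ := Ideal.Quotient.mk_surjective x
  exact ⟨s, fun a => (hx a).trans Ideal.Quotient.eq_zero_iff_mem⟩

/-- Some multiple b x has an associated prime of M as its annihilator, and it suffices not to kill b
x. -/
theorem exists_map_ne_zero (hR : IsGorensteinRing R) (hreg : IsRegRev rs)
    {M : Type u} [AddCommGroup M] [Module R M] [Module.Finite R M]
    (hM : ∀ x ∈ rs, ∀ y : M, x • y = 0)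
    (hass : associatedPrimes R M ⊆ associatedPrimes R (R ⧸ Ideal.ofList rs)) {x : M} (hx : x ≠ 0) :
    ∃ f : M →ₗ[R] R ⧸ Ideal.ofList rs, f x ≠ 0 := by
  obtain ⟨p, hp, b, hb⟩ := exists_mem_associatedPrimes_smul (R := R) hx
  have := hp.1
  obtain ⟨s, hs⟩ := exists_socle_of_mem_associatedPrimes (hass hp)
  obtain ⟨f, hf⟩ := exists_map_ne_zero_of_socle hR hreg hs hM hb
  exact ⟨f, fun h => hf (by rw [map_smul, h, smul_zero])⟩

/-- A prime q minimal over the shorter sequence is associated to its quotient, so it does not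
contain the next regular element. Hence q is strictly below p. -/
lemma length_le_height (hreg : IsRegRev rs) {p : Ideal R} [hp : p.IsPrime]
    (h : Ideal.ofList rs ≤ p) : (rs.length : ℕ∞) ≤ p.height := by
  induction rs generalizing p with
  | nil => simp
  | cons x rs ih =>
    obtain ⟨q, hq, hqp⟩ := Ideal.exists_minimalPrimes_le ((ofList_le_cons x rs).trans h)
    have := hq.1.1
    have hass : q ∈ associatedPrimes R (R ⧸ Ideal.ofList rs) := by
      refine Module.associatedPrimes.minimalPrimes_annihilator_subset_associatedPrimes R
        (R ⧸ Ideal.ofList rs) ?_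
      rwa [Ideal.annihilator_quotient]
    obtain ⟨s, hs⟩ := exists_socle_of_mem_associatedPrimes hass
    have hxq : x ∉ q := fun hx => this.one_notMem ((hs 1).2 (by
      rw [one_mul]; exact hreg.1 s ((hs x).1 hx)))
    have hlt : q < p := lt_of_le_of_ne hqp fun e =>
      hxq (e ▸ h (Ideal.subset_span (List.mem_cons_self)))
    have h1 := Ideal.height_add_one_le_of_lt_of_isPrime hlt
    rw [List.length_cons, Nat.cast_add, Nat.cast_one]
    exact (add_le_add_left (ih hreg.2 hq.1.2) 1).trans h1

theorem mem_minimalPrimes_of_mem_associatedPrimes (hR : IsGorensteinRing R) (hreg : IsRegRev rs)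
    {p : Ideal R} (hp : p ∈ associatedPrimes R (R ⧸ Ideal.ofList rs)) :
    p ∈ (Ideal.ofList rs).minimalPrimes := by
  have hp' := hp.1
  obtain ⟨s, hs⟩ := exists_socle_of_mem_associatedPrimes hp
  refine ⟨⟨hp', fun a ha => (hs a).2 (Ideal.mul_mem_right _ _ ha)⟩, fun q hq hqp a ha => ?_⟩
  obtain ⟨u, hu, k, hk⟩ := exists_mul_pow_mem hR hreg hs ha
  exact hq.1.mem_of_pow_mem _ ((hq.1.mem_or_mem (hq.2 hk)).resolve_left fun h => hu (hqp h))

theorem height_eq_length (hR : IsGorensteinRing R) (hreg : IsRegRev rs)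
    {p : Ideal R} (hp : p ∈ associatedPrimes R (R ⧸ Ideal.ofList rs)) :
    p.height = rs.length := by
  classical
  have hp' := hp.1
  have hmin := mem_minimalPrimes_of_mem_associatedPrimes hR hreg hp
  refine le_antisymm ?_ (length_le_height hreg hmin.1.2)
  have h1 : Ideal.ofList rs = Ideal.span (rs.toFinset : Set R) := by
    simp [Ideal.ofList]
  rw [h1] at hmin
  exact (Ideal.height_le_card_of_mem_minimalPrimes_span_finset hmin).trans
    (Nat.cast_le.2 (List.toFinset_card_le rs))

end AssociatedPrimes

end ModuleLiaison

namespace ModuleLiaison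

/-! ### Krull dimension along regular sequences -/

section Dimension

variable {R : Type u} [CommRing R]

lemma ringKrullDim_quotient_succ_le {J J' : Ideal R} {x : R} (hx : ∀ y, x * y ∈ J → y ∈ J)
    (hJ : J ≤ J') (hx' : x ∈ J') : ringKrullDim (R ⧸ J') + 1 ≤ ringKrullDim (R ⧸ J) := by
  refine ringKrullDim_succ_le_of_surjective (Ideal.Quotient.factor hJ)
    (Ideal.Quotient.factor_surjective hJ) (r := Ideal.Quotient.mk J x) ?_
    (Ideal.Quotient.eq_zero_iff_mem.2 hx')
  refine mem_nonZeroDivisors_iff_right.2 fun y hy => ?_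
  obtain ⟨y, rfl⟩ := Ideal.Quotient.mk_surjective y
  rw [← map_mul, Ideal.Quotient.eq_zero_iff_mem, mul_comm] at hy
  exact Ideal.Quotient.eq_zero_iff_mem.2 (hx y hy)

lemma ringKrullDim_quotient_anti {J J' : Ideal R} (hJ : J ≤ J') :
    ringKrullDim (R ⧸ J') ≤ ringKrullDim (R ⧸ J) :=
  ringKrullDim_le_of_surjective (Ideal.Quotient.factor hJ) (Ideal.Quotient.factor_surjective hJ)

lemma ringKrullDim_quotient_add_length_le {l rs : List R} (h : IsRegRev (l ++ rs)) :
    ringKrullDim (R ⧸ Ideal.ofList (l ++ rs)) + l.length ≤ ringKrullDim (R ⧸ Ideal.ofList rs) := by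
  induction l with
  | nil => simp
  | cons x l ih =>
    have h1 := ringKrullDim_quotient_succ_le (J' := Ideal.ofList (x :: (l ++ rs))) h.1
      (ofList_le_cons _ _) (Ideal.subset_span List.mem_cons_self)
    rw [List.length_cons, Nat.cast_add, Nat.cast_one, add_comm (l.length : WithBot ℕ∞), ← add_assoc]
    exact (add_le_add_left h1 _).trans (ih h.2)

/-- A chain of d + 1 primes containing J can be measured from a minimal prime q of J below its first
member, so q has coheight at least d. -/
lemma height_add_le_ringKrullDim {J : Ideal R} {d : ℕ} (hd : (d : WithBot ℕ∞) ≤ ringKrullDim (R ⧸ J)) :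
    ∃ q ∈ J.minimalPrimes, (q.height : WithBot ℕ∞) + d ≤ ringKrullDim R := by
  rw [ringKrullDim_quotient, Order.le_krullDim_iff] at hd
  obtain ⟨s, rfl⟩ := hd
  obtain ⟨q, hq, hqs⟩ := Ideal.exists_minimalPrimes_le (J := s.head.1.asIdeal) s.head.2
  let q' : PrimeSpectrum R := ⟨q, hq.1.1⟩
  let s' : LTSeries (PrimeSpectrum R) := s.map Subtype.val fun _ _ h => h
  have h1 : (s.length : ℕ∞) ≤ Order.coheight q' :=
    Order.length_le_coheight (p := s') hqs
  refine ⟨q, hq, ?_⟩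
  have : Nonempty (PrimeSpectrum R) := ⟨q'⟩
  rw [ringKrullDim, Order.krullDim_eq_iSup_height_add_coheight_of_nonempty]
  refine le_trans ?_ (WithBot.coe_le_coe.2 (le_iSup _ q'))
  rw [← PrimeSpectrum.height_eq_orderHeight, WithBot.coe_add]
  exact add_le_add_right (WithBot.coe_le_coe.2 h1) _

end Dimension

/-! ### Homogeneous regular sequences in annihilators -/

section GoodGrading

variable {ι : Type} [AddCommGroup ι] [DecidableEq ι] {R : Type u} [CommRing R]

/-- The properties of a Gorenstein graded ring with a unique maximal graded ideal that are shared
by local rings and standard graded algebras: homogeneous prime avoidance and the bound of the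
dimension by the number of elements of a homogeneous system of parameters. -/
structure GoodGrading (𝒜 : ι → AddSubgroup R) [GradedRing 𝒜] : Prop where
  gorenstein : IsGorensteinRing R
  isMaximal : (homogMaxIdeal 𝒜).IsMaximal
  avoid : ∀ J : Ideal R, IsHomogIdeal 𝒜 J → J ≤ homogMaxIdeal 𝒜 → ∀ s : Set (Ideal R), s.Finite →
    (∀ p ∈ s, p.IsPrime) → (∀ i, ∀ a ∈ 𝒜 i, a ∈ J → ∃ p ∈ s, a ∈ p) → ∃ p ∈ s, J ≤ p
  dim_le : ∀ J : Ideal R, IsHomogIdeal 𝒜 J → ∀ ys : List R, (∀ y ∈ ys, y ∈ homogMaxIdeal 𝒜) →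
    (∀ y ∈ ys, ∃ b, y ∈ 𝒜 b) → ∀ k, homogMaxIdeal 𝒜 ^ k ≤ J ⊔ Ideal.ofList ys →
    ringKrullDim (R ⧸ J) ≤ ys.length

/-- A homogeneous regular sequence in the maximal graded ideal. -/
structure IsRegSeq (𝒜 : ι → AddSubgroup R) (rs : List R) : Prop where
  reg : IsRegRev rs
  mem : ∀ x ∈ rs, x ∈ homogMaxIdeal 𝒜
  homog : ∀ x ∈ rs, ∃ b, x ∈ 𝒜 b

variable {𝒜 : ι → AddSubgroup R}

lemma exists_isHomogSeq {rs : List R} (h : ∀ x ∈ rs, ∃ b, x ∈ 𝒜 b) : ∃ w, IsHomogSeq 𝒜 rs w := by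
  induction rs with
  | nil => exact ⟨0, .nil⟩
  | cons x rs ih =>
    obtain ⟨b, hb⟩ := h x List.mem_cons_self
    obtain ⟨w, hw⟩ := ih fun y hy => h y (List.mem_cons_of_mem _ hy)
    exact ⟨b + w, .cons hb hw⟩

lemma IsRegSeq.of_append {l rs : List R} (h : IsRegSeq 𝒜 (l ++ rs)) : IsRegSeq 𝒜 rs :=
  ⟨isRegRev_of_append l h.reg, fun x hx => h.mem x (List.mem_append_right _ hx),
    fun x hx => h.homog x (List.mem_append_right _ hx)⟩

lemma IsRegSeq.cons {x : R} {rs : List R} (h : IsRegSeq 𝒜 rs)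
    (hx : ∀ y, x * y ∈ Ideal.ofList rs → y ∈ Ideal.ofList rs) (hm : x ∈ homogMaxIdeal 𝒜)
    (hh : ∃ b, x ∈ 𝒜 b) : IsRegSeq 𝒜 (x :: rs) :=
  ⟨⟨hx, h.reg⟩, by simpa using ⟨hm, h.mem⟩, by simpa using ⟨hh, h.homog⟩⟩

lemma IsRegSeq.nil : IsRegSeq 𝒜 ([] : List R) := ⟨trivial, by simp, by simp⟩

lemma IsRegSeq.le {rs : List R} (h : IsRegSeq 𝒜 rs) : Ideal.ofList rs ≤ homogMaxIdeal 𝒜 :=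
  Ideal.span_le.2 h.mem

variable [GradedRing 𝒜]

lemma IsRegSeq.isHomogIdeal {rs : List R} (h : IsRegSeq 𝒜 rs) :
    IsHomogIdeal 𝒜 (Ideal.ofList rs) :=
  (exists_isHomogSeq h.homog).elim fun _ hw => hw.isHomogIdeal

lemma IsHomogIdeal.exists_rcomp_notMem {J : Ideal R} {x : R} (hx : x ∉ J) :
    ∃ i, rcomp 𝒜 i x ∉ J := by
  by_contra! h
  obtain ⟨t, ht⟩ := exists_sum_rcomp 𝒜 x
  exact hx (by rw [ht]; exact sum_mem fun i _ => h i)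

lemma IsHomogIdeal.le_homogMaxIdeal {J : Ideal R} (hJ : IsHomogIdeal 𝒜 J) (h : J ≠ ⊤) :
    J ≤ homogMaxIdeal 𝒜 := by
  intro x hx
  obtain ⟨t, ht⟩ := exists_sum_rcomp 𝒜 x
  rw [ht]
  exact sum_mem fun i _ => Ideal.subset_span ⟨⟨i, rcomp_mem i x⟩, fun hu =>
    h (Ideal.eq_top_of_isUnit_mem _ (hJ i x hx) hu)⟩

lemma isHomogIdeal_span {S : Set R} (hS : ∀ x ∈ S, ∃ b, x ∈ 𝒜 b) :
    IsHomogIdeal 𝒜 (Ideal.span S) := by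
  intro i x hx
  induction hx using Submodule.span_induction generalizing i with
  | mem x hx =>
    obtain ⟨b, hb⟩ := hS x hx
    by_cases h : i = b
    · rw [h, rcomp_of_mem hb]
      exact Ideal.subset_span hx
    · rw [rcomp_of_mem_ne hb (Ne.symm h)]
      exact zero_mem _
  | zero => rw [map_zero]; exact zero_mem _
  | add x y _ _ hx hy => rw [map_add]; exact add_mem (hx i) (hy i)
  | smul r x _ hx =>
    obtain ⟨t, ht⟩ := exists_sum_rcomp 𝒜 r
    rw [ht, Finset.sum_smul, map_sum]
    refine sum_mem fun j _ => ?_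
    have := rcomp_mul (i - j) x (rcomp_mem (𝒜 := 𝒜) j r)
    rw [sub_add_cancel, mul_comm] at this
    rw [smul_eq_mul, this]
    exact Ideal.mul_mem_right _ _ (hx _)

lemma isHomogIdeal_homogMaxIdeal : IsHomogIdeal 𝒜 (homogMaxIdeal 𝒜) :=
  isHomogIdeal_span fun _ hx => hx.1

lemma isHomogIdeal_annihilator (X : GradedMod 𝒜) :
    IsHomogIdeal 𝒜 (Module.annihilator R X) := by
  intro i a ha
  rw [Module.mem_annihilator] at ha ⊢
  intro x
  induction x using X.induction with
  | zero => exact smul_zero _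
  | add x y hx hy => rw [smul_add, hx, hy, add_zero]
  | hom j x hx => rw [← GradedMod.comp_smul_of_mem i a hx, ha, map_zero]

namespace GoodGrading

variable [IsNoetherianRing R] (G : GoodGrading 𝒜)

include G

lemma nontrivial : Nontrivial R := by
  by_contra h
  rw [not_nontrivial_iff_subsingleton] at h
  exact G.isMaximal.ne_top (Subsingleton.elim _ _)

lemma quotient_nontrivial {rs : List R} (h : IsRegSeq 𝒜 rs) : Nontrivial (R ⧸ Ideal.ofList rs) :=
  Ideal.Quotient.nontrivial_iff.2 fun e => G.isMaximal.ne_top (top_le_iff.1 (e ▸ h.le))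

lemma exists_ringKrullDim_eq : ∃ n : ℕ, ringKrullDim R = n := by
  have := G.nontrivial
  obtain ⟨s, hs, hs'⟩ := (Submodule.fg_span_iff_fg_span_finset_subset _).1
    (IsNoetherian.noetherian (homogMaxIdeal 𝒜))
  have h := G.dim_le ⊥ (fun i x hx => by rw [Ideal.mem_bot] at hx ⊢; rw [hx, map_zero]) s.toList
    (fun y hy => Ideal.subset_span (hs (by simpa using hy)))
    (fun y hy => (hs (by simpa using hy : y ∈ (s : Set R))).1) 1 (by
      rw [pow_one, bot_sup_eq]
      refine hs'.le.trans (Ideal.span_mono fun y hy => ?_)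
      simpa using hy)
  rw [ringKrullDim_eq_of_ringEquiv (RingEquiv.quotientBot R)] at h
  have h0 := ringKrullDim_nonneg_of_nontrivial (R := R)
  generalize ringKrullDim R = d at h h0 ⊢
  match d with
  | ⊥ => simp at h0
  | (⊤ : ℕ∞) => exact absurd (WithBot.coe_le_coe.1 h) (by simp)
  | ((n : ℕ) : ℕ∞) => exact ⟨n, rfl⟩

lemma length_le {rs : List R} (h : IsRegSeq 𝒜 rs) : (rs.length : WithBot ℕ∞) ≤ ringKrullDim R := by
  have := G.quotient_nontrivial h
  have h1 := ringKrullDim_quotient_add_length_le (l := rs) (rs := []) (by simpa using h.reg)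
  have h0 := ringKrullDim_nonneg_of_nontrivial (R := R ⧸ Ideal.ofList rs)
  rw [List.append_nil] at h1
  calc (rs.length : WithBot ℕ∞) = 0 + rs.length := (zero_add _).symm
    _ ≤ _ := add_le_add_left h0 _
    _ ≤ _ := h1
    _ ≤ _ := ringKrullDim_quotient_le _

/-- Homogeneous regular elements of J are added as long as possible; the length is bounded by dim R.
When none is left, all homogeneous elements of J lie in the finitely many associated primes, and
homogeneous prime avoidance applies. -/
lemma exists_maximal_extension {J : Ideal R} (hJ : IsHomogIdeal 𝒜 J) (hJm : J ≤ homogMaxIdeal 𝒜)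
    {rs : List R} (hrs : IsRegSeq 𝒜 rs) : ∃ l : List R, (∀ x ∈ l, x ∈ J) ∧ IsRegSeq 𝒜 (l ++ rs) ∧
      ∃ p ∈ associatedPrimes R (R ⧸ Ideal.ofList (l ++ rs)), J ≤ p := by
  obtain ⟨n, hn⟩ := G.exists_ringKrullDim_eq
  have hlen : ∀ {rs : List R}, IsRegSeq 𝒜 rs → rs.length ≤ n := fun h => by
    exact_mod_cast hn ▸ G.length_le h
  generalize hk : n - rs.length = k
  induction k using Nat.strong_induction_on generalizing rs with
  | _ k ih =>
    by_cases h : ∃ i, ∃ a ∈ 𝒜 i, a ∈ J ∧ ∀ y, a * y ∈ Ideal.ofList rs → y ∈ Ideal.ofList rs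
    · obtain ⟨i, a, hai, haJ, ha⟩ := h
      have h1 := hrs.cons ha (hJm haJ) ⟨i, hai⟩
      have h2 := hlen h1
      rw [List.length_cons] at h2
      obtain ⟨l, hl, hl', hp⟩ := ih _ (by rw [List.length_cons]; omega) h1 rfl
      have e : l ++ a :: rs = l ++ [a] ++ rs := by simp
      rw [e] at hl' hp
      exact ⟨l ++ [a], by simpa [or_imp, forall_and] using ⟨hl, haJ⟩, hl', hp⟩
    · push Not at h
      refine ⟨[], by simp, hrs, G.avoid J hJ hJm _ (associatedPrimes.finite R _)
        (fun p hp => hp.1) fun i a hai haJ => ?_⟩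
      obtain ⟨y, hy, hy'⟩ := h i a hai haJ
      obtain ⟨p, hp, b, hb⟩ := exists_mem_associatedPrimes_smul (R := R)
        (x := Ideal.Quotient.mk (Ideal.ofList rs) y)
        (fun h => hy' (Ideal.Quotient.eq_zero_iff_mem.1 h))
      refine ⟨p, hp, (hb a).2 ?_⟩
      rw [smul_comm]
      have : a • Ideal.Quotient.mk (Ideal.ofList rs) y = 0 := Ideal.Quotient.eq_zero_iff_mem.2 hy
      rw [this, smul_zero]

lemma exists_pow_le {rs : List R} (hrs : IsRegSeq 𝒜 rs) {p : Ideal R}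
    (hp : p ∈ associatedPrimes R (R ⧸ Ideal.ofList rs)) (hm : homogMaxIdeal 𝒜 ≤ p) :
    ∃ k, homogMaxIdeal 𝒜 ^ k ≤ Ideal.ofList rs := by
  have hp' := hp.1
  have hmp := G.isMaximal.eq_of_le hp'.ne_top hm
  obtain ⟨s, hs⟩ := exists_socle_of_mem_associatedPrimes hp
  refine Ideal.exists_pow_le_of_le_radical_of_fg ?_ (IsNoetherian.noetherian _)
  refine Ideal.span_le.2 ?_
  rintro a ⟨⟨i, hai⟩, ha⟩
  have ha' : a ∈ homogMaxIdeal 𝒜 := Ideal.subset_span ⟨⟨i, hai⟩, ha⟩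
  obtain ⟨u, hu, k, hk⟩ := exists_mul_pow_mem G.gorenstein hrs.reg hs (hm ha')
  exact ⟨k, GradedMod.mem_of_mul_mem hrs.isHomogIdeal (SetLike.pow_mem_graded k hai)
    (hmp ▸ hu) hk⟩

/-- This is the Cohen-Macaulay property of R. A regular sequence that is maximal in the graded
maximal ideal generates an ideal containing a power of that ideal, so its length is at least dim R.
As each regular element lowers the dimension, all inequalities are equalities. -/
lemma exists_complementary {rs : List R} (hrs : IsRegSeq 𝒜 rs) : ∃ l : List R,
    IsRegSeq 𝒜 (l ++ rs) ∧ ringKrullDim R = (l.length + rs.length : ℕ) ∧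
    ringKrullDim (R ⧸ Ideal.ofList rs) = l.length := by
  obtain ⟨l, -, hl, p, hp, hmp⟩ := G.exists_maximal_extension isHomogIdeal_homogMaxIdeal le_rfl hrs
  obtain ⟨k, hk⟩ := G.exists_pow_le hl hp hmp
  have := G.quotient_nontrivial hl
  have h1 := G.dim_le ⊥ (fun i x hx => by rw [Ideal.mem_bot] at hx ⊢; rw [hx, map_zero]) _
    hl.mem hl.homog k (by rwa [bot_sup_eq])
  rw [ringKrullDim_eq_of_ringEquiv (RingEquiv.quotientBot R), List.length_append] at h1
  have h2 := ringKrullDim_quotient_add_length_le hl.reg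
  have h3 := ringKrullDim_quotient_add_length_le (l := rs) (rs := []) (by simpa using hrs.reg)
  rw [List.append_nil] at h3
  replace h3 := h3.trans (ringKrullDim_quotient_le _)
  have h0 := ringKrullDim_nonneg_of_nontrivial (R := R ⧸ Ideal.ofList (l ++ rs))
  obtain ⟨n, hn⟩ := G.exists_ringKrullDim_eq
  have h4 : (l.length : WithBot ℕ∞) ≤ ringKrullDim (R ⧸ Ideal.ofList rs) :=
    (le_add_of_nonneg_left h0).trans h2
  rw [hn] at h1 h3 ⊢
  have h5 := h3.trans h1
  generalize ringKrullDim (R ⧸ Ideal.ofList rs) = d at h3 h4 h5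
  match d with
  | ⊥ => simp at h4
  | (⊤ : ℕ∞) => exact absurd (WithBot.coe_le_coe.1 h3) (by simp)
  | ((d : ℕ) : ℕ∞) =>
    refine ⟨l, hl, ?_, ?_⟩
    all_goals
      norm_cast at h1 h3 h4 h5 ⊢
      have h1' : n ≤ l.length + rs.length := by exact_mod_cast h1
      have h3' : d + rs.length ≤ n := by exact_mod_cast h3
      have h4' : l.length ≤ d := by exact_mod_cast h4
      omega

omit G in
lemma exists_divide_homogeneous {x : R} {rs : List R} (hx : IsRegSeq 𝒜 (x :: rs)) {z : R} {i : ι}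
    (hz : z ∈ 𝒜 i) (h : z ∈ Ideal.ofList (x :: rs)) :
    ∃ j, ∃ c ∈ 𝒜 j, z - x * c ∈ Ideal.ofList rs := by
  obtain ⟨a, ha⟩ := mem_ofList_cons.1 h
  obtain ⟨b, hb⟩ := hx.homog x List.mem_cons_self
  refine ⟨i - b, rcomp 𝒜 (i - b) a, rcomp_mem _ _, ?_⟩
  have h1 := (hx.of_append (l := [x])).isHomogIdeal i _ ha
  have h2 := rcomp_mul (i - b) a hb
  rw [sub_add_cancel] at h2
  rwa [map_sub, rcomp_of_mem hz, mul_comm x a, h2, mul_comm] at h1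

/-- As long as z lies in (x, rs), it is divided by x modulo (rs). Since x is regular, no
annihilating elements are lost, and the ideal (rs, z) grows strictly by the graded Nakayama
argument. The ascending chain condition stops the process. -/
lemma exists_notMem_cons {x : R} {rs : List R} (hx : IsRegSeq 𝒜 (x :: rs)) {z : R} {i : ι}
    (hz : z ∈ 𝒜 i) (h : z ∉ Ideal.ofList rs) : ∃ j, ∃ z' ∈ 𝒜 j, z' ∉ Ideal.ofList (x :: rs) ∧
      ∀ a, a * z ∈ Ideal.ofList rs → a * z' ∈ Ideal.ofList rs := by
  generalize hI : Ideal.ofList rs ⊔ Ideal.span {z} = I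
  induction I using WellFoundedGT.induction generalizing z i with
  | _ I ih =>
    by_cases hzx : z ∈ Ideal.ofList (x :: rs)
    · obtain ⟨j, c, hc, hzc⟩ := exists_divide_homogeneous hx hz hzx
      have hle : I ≤ Ideal.ofList rs ⊔ Ideal.span {c} := by
        rw [← hI, sup_le_iff, Ideal.span_singleton_le_iff_mem]
        refine ⟨le_sup_left, ?_⟩
        have := Submodule.add_mem_sup hzc (Ideal.mul_mem_left (Ideal.span {c}) x
          (Ideal.mem_span_singleton_self c))
        rwa [sub_add_cancel] at this
      have hcr : c ∉ Ideal.ofList rs := fun hc' => h <| by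
        simpa using add_mem hzc (Ideal.mul_mem_left _ x hc')
      have hac : ∀ a, a * z ∈ Ideal.ofList rs → a * c ∈ Ideal.ofList rs := fun a ha => by
        refine hx.reg.1 _ ?_
        have := sub_mem ha (Ideal.mul_mem_left _ a hzc)
        rw [← mul_sub, sub_sub_cancel] at this
        rwa [mul_left_comm]
      obtain ⟨j', z', hz', h1, h2⟩ := ih _ (lt_of_le_of_ne hle fun e => hcr <| by
        have hcI : c ∈ Ideal.ofList rs ⊔ Ideal.span {z} := by
          rw [hI, e]
          exact Ideal.mem_sup_right (Ideal.mem_span_singleton_self c)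
        obtain ⟨u, hu, v, hv, huv⟩ := Submodule.mem_sup.1 hcI
        obtain ⟨t, rfl⟩ := Ideal.mem_span_singleton'.1 hv
        refine GradedMod.mem_of_mul_mem (hx.of_append (l := [x])).isHomogIdeal hc
          (s := 1 - t * x) (fun hm => G.isMaximal.ne_top ((Ideal.eq_top_iff_one _).2 ?_)) ?_
        · simpa using add_mem hm (Ideal.mul_mem_left _ t (hx.mem x List.mem_cons_self))
        · have : (1 - t * x) * c = u + t * (z - x * c) := by linear_combination -huv
          rw [this]
          exact add_mem hu (Ideal.mul_mem_left _ t hzc)) hc hcr rfl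
      exact ⟨j', z', hz', h1, fun a ha => h2 a (hac a ha)⟩
    · exact ⟨i, z, hz, hzx, fun _ => id⟩

/-- The depth is at most the dimension of any cyclic submodule generated by a nonzero homogeneous z.
Passing from z to the z' of `exists_notMem_cons`, the element x is regular modulo the annihilator of
z and lies in that of z' modulo x, so each step costs one dimension. -/
lemma length_le_ringKrullDim {l rs : List R} (h : IsRegSeq 𝒜 (l ++ rs)) {z : R} {i : ι}
    (hz : z ∈ 𝒜 i) (hzr : z ∉ Ideal.ofList rs) {J : Ideal R} (hJ : ∀ a ∈ J, a * z ∈ Ideal.ofList rs) :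
    (l.length : WithBot ℕ∞) ≤ ringKrullDim (R ⧸ J) := by
  induction l using List.reverseRecOn generalizing rs z i J with
  | nil =>
    have : Nontrivial (R ⧸ J) := Ideal.Quotient.nontrivial_iff.2 fun e =>
      hzr (by simpa using hJ 1 (e ▸ trivial))
    simpa using ringKrullDim_nonneg_of_nontrivial
  | append_singleton l x ih =>
    rw [List.append_assoc, List.singleton_append] at h
    have hx := h.of_append
    obtain ⟨j, z', hz', h1, h2⟩ := G.exists_notMem_cons hx hz hzr
    let J₀ : Ideal R := (Ideal.ofList rs).colon {z}
    let J₁ : Ideal R := (Ideal.ofList (x :: rs)).colon {z'}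
    have hJ₀ : ∀ a, a ∈ J₀ ↔ a * z ∈ Ideal.ofList rs := fun a => Submodule.mem_colon_singleton
    have hJ₁ : ∀ a, a ∈ J₁ ↔ a * z' ∈ Ideal.ofList (x :: rs) := fun a =>
      Submodule.mem_colon_singleton
    have h3 := ih h hz' h1 fun a => (hJ₁ a).1
    have h4 : ringKrullDim (R ⧸ J₁) + 1 ≤ ringKrullDim (R ⧸ J₀) := by
      refine ringKrullDim_quotient_succ_le (x := x) (fun y hy => ?_) (fun a ha => ?_) ?_
      · rw [hJ₀, mul_assoc] at hy
        exact (hJ₀ y).2 (hx.reg.1 _ hy)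
      · exact (hJ₁ a).2 (ofList_le_cons _ _ (h2 a ((hJ₀ a).1 ha)))
      · exact (hJ₁ x).2 (Ideal.mul_mem_right _ _ (Ideal.subset_span List.mem_cons_self))
    rw [List.length_append, List.length_singleton, Nat.cast_add, Nat.cast_one]
    exact ((add_le_add_left h3 1).trans h4).trans
      (ringKrullDim_quotient_anti fun a ha => (hJ₀ a).2 (hJ a ha))

/-- A maximal regular sequence l in I ∩ J leaves a homogeneous z outside (l) with (I ∩ J) z in (l).
Either J kills z modulo (l), or some multiple b z with b in J is nonzero and killed by I. In both
cases `length_le_ringKrullDim` shows that l has at least c elements; the last c of them, which come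
first in the sequence, are kept. -/
lemma exists_isRegSeq {I J : Ideal R} (hI : IsHomogIdeal 𝒜 I) (hJ : IsHomogIdeal 𝒜 J)
    (hIm : I ≤ homogMaxIdeal 𝒜) {c : ℕ}
    (hIc : ringKrullDim (R ⧸ I) + c = ringKrullDim R)
    (hJc : ringKrullDim (R ⧸ J) + c = ringKrullDim R) :
    ∃ rs : List R, IsRegSeq 𝒜 rs ∧ (∀ x ∈ rs, x ∈ I ∧ x ∈ J) ∧ rs.length = c := by
  obtain ⟨l, hlIJ, hl, p, hp, hIJ⟩ := G.exists_maximal_extension (J := I ⊓ J)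
    (fun i x hx => ⟨hI i x hx.1, hJ i x hx.2⟩) (inf_le_left.trans hIm) IsRegSeq.nil
  rw [List.append_nil] at hl hp
  have hc : c ≤ l.length := by
    obtain ⟨s, hs⟩ := exists_socle_of_mem_associatedPrimes hp
    have hp' := hp.1
    have hsl : s ∉ Ideal.ofList l := fun h => hp'.one_notMem ((hs 1).2 (by rwa [one_mul]))
    obtain ⟨i, hi⟩ := IsHomogIdeal.exists_rcomp_notMem (𝒜 := 𝒜) hsl
    have hz : ∀ j, ∀ a ∈ 𝒜 j, a ∈ I → a ∈ J → a * rcomp 𝒜 i s ∈ Ideal.ofList l := by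
      intro j a haj haI haJ
      have h1 := hl.isHomogIdeal (i + j) _ ((hs a).1 (hIJ ⟨haI, haJ⟩))
      rwa [mul_comm, rcomp_mul i s haj, mul_comm] at h1
    obtain ⟨l', hl', hdim, -⟩ := G.exists_complementary hl
    have key : ∀ J' : Ideal R, ringKrullDim (R ⧸ J') + c = ringKrullDim R → ∀ t, ∀ z ∈ 𝒜 t,
        z ∉ Ideal.ofList l → (∀ a ∈ J', a * z ∈ Ideal.ofList l) → c ≤ l.length := by
      intro J' hJ' t z hz hzl hJz
      have h1 := G.length_le_ringKrullDim hl' hz hzl hJz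
      have h2 := hJ'.symm ▸ add_le_add_left h1 (c : WithBot ℕ∞)
      rw [hdim] at h2
      have h3 : l'.length + c ≤ l'.length + l.length := by exact_mod_cast h2
      omega
    have hsum : ∀ {J' : Ideal R}, IsHomogIdeal 𝒜 J' → ∀ {z}, (∀ j, ∀ a ∈ 𝒜 j, a ∈ J' →
        a * z ∈ Ideal.ofList l) → ∀ a ∈ J', a * z ∈ Ideal.ofList l := by
      intro J' hJ' z h a ha
      obtain ⟨t, ht⟩ := exists_sum_rcomp 𝒜 a
      rw [ht, Finset.sum_mul]
      exact sum_mem fun j _ => h j _ (rcomp_mem j a) (hJ' j a ha)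
    by_cases hb : ∀ j, ∀ b ∈ 𝒜 j, b ∈ J → b * rcomp 𝒜 i s ∈ Ideal.ofList l
    · exact key J hJc i _ (rcomp_mem i s) hi (hsum hJ hb)
    · push Not at hb
      obtain ⟨j, b, hbj, hbJ, hb⟩ := hb
      refine key I hIc (j + i) _ (SetLike.mul_mem_graded hbj (rcomp_mem i s)) hb
        (hsum hI fun k a hak haI => ?_)
      rw [← mul_assoc]
      exact hz (k + j) _ (SetLike.mul_mem_graded hak hbj) (Ideal.mul_mem_right _ _ haI)
        (Ideal.mul_mem_left _ _ hbJ)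
  refine ⟨l.drop (l.length - c), ?_, fun x hx => ?_, ?_⟩
  · exact IsRegSeq.of_append (l := l.take (l.length - c)) (by rwa [List.take_append_drop])
  · exact hlIJ x (List.mem_of_mem_drop hx)
  · rw [List.length_drop]; omega

/-- A longest chain of primes over Ann M starts above a minimal prime q of Ann M with height at most
c = rs.length, and q is associated to M. By unmixedness all associated primes of M have height at
most c. As they contain a regular sequence of length c, they are minimal over it, hence associated
to R/(rs). -/
theorem associatedPrimes_subset {M : GradedMod 𝒜} (hM : IsUnmixed M) {rs : List R}
    (hrs : IsRegSeq 𝒜 rs) (hc : HasCodim M rs.length) (hann : ∀ x ∈ rs, ∀ y : M, x • y = 0)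
    [Nontrivial M] :
    associatedPrimes R M ⊆ associatedPrimes R (R ⧸ Ideal.ofList rs) := by
  obtain ⟨n, hn⟩ := G.exists_ringKrullDim_eq
  have hle : Ideal.ofList rs ≤ Module.annihilator R M :=
    Ideal.span_le.2 fun x hx => Module.mem_annihilator.2 (hann x hx)
  rw [HasCodim, Module.supportDim_eq_ringKrullDim_quotient_annihilator] at hc
  have h0 : ∃ d : ℕ, ringKrullDim (R ⧸ Module.annihilator R M) = d := by
    rw [hn] at hc
    generalize ringKrullDim (R ⧸ Module.annihilator R M) = d at hc
    match d with
    | ⊥ => simp at hc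
    | (⊤ : ℕ∞) => exact absurd (WithBot.coe_injective hc) (by simp)
    | ((d : ℕ) : ℕ∞) => exact ⟨d, rfl⟩
  obtain ⟨d, hd⟩ := h0
  obtain ⟨q, hq, hqd⟩ := height_add_le_ringKrullDim hd.ge
  rw [← hc, hd] at hqd
  have hqh : q.height ≤ rs.length := by
    generalize q.height = h at hqd
    match h with
    | ⊤ => exact absurd (WithBot.coe_le_coe.1 hqd) (by simp)
    | (h : ℕ) =>
      have : h + d ≤ d + rs.length := by exact_mod_cast hqd
      exact_mod_cast (by omega : h ≤ rs.length)
  have hqM : q ∈ associatedPrimes R M :=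
    Module.associatedPrimes.minimalPrimes_annihilator_subset_associatedPrimes R M hq
  intro p hp
  have hp' := hp.1
  have hpI : Ideal.ofList rs ≤ p := hle.trans (Submodule.annihilator_top (R := R) (M := M) ▸ hp.annihilator_le)
  refine Module.associatedPrimes.minimalPrimes_annihilator_subset_associatedPrimes R
    (R ⧸ Ideal.ofList rs) ?_
  rw [Ideal.annihilator_quotient]
  refine ⟨⟨hp', hpI⟩, fun p' hp'' hle' => ?_⟩
  have := hp''.1
  have h1 := length_le_height hrs.reg hp''.2
  by_contra hne
  have h2 := Ideal.height_add_one_le_of_lt_of_isPrime (lt_of_le_not_ge hle' hne)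
  have h3 := (add_le_add_left h1 1).trans (h2.trans ((hM p hp q hqM).le.trans hqh))
  have : rs.length + 1 ≤ rs.length := by exact_mod_cast h3
  omega

end GoodGrading

end GoodGrading

end ModuleLiaison

namespace ModuleLiaison

open CategoryTheory Abelian

/-! ### Perfect modules through vanishing of Ext -/

section Perfect

variable {ι : Type} [AddCommGroup ι] [DecidableEq ι] {R : Type u} [CommRing R]

/-- A module of finite projective dimension whose depth, measured by the vanishing of `Ext`, is at
least `d`. -/
structure HasPerfectDepth (𝒜 : ι → AddSubgroup R) (d : ℕ) (X : Type u) [AddCommGroup X]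
    [Module R X] : Prop where
  subsingleton_ext : ∀ i < d,
    Subsingleton (Ext (ModuleCat.of R (R ⧸ homogMaxIdeal 𝒜)) (ModuleCat.of R X) i)
  projDim : ∃ n : ℕ, HasProjectiveDimensionLE (ModuleCat.of R X) n

namespace HasPerfectDepth

variable {𝒜 : ι → AddSubgroup R} {d : ℕ} {X Y : Type u} [AddCommGroup X] [Module R X]
  [AddCommGroup Y] [Module R Y]

lemma of_equiv (h : HasPerfectDepth 𝒜 d X) (e : X ≃ₗ[R] Y) : HasPerfectDepth 𝒜 d Y := by
  refine ⟨fun i hi => ?_, h.projDim.imp fun n (hn : HasProjectiveDimensionLT _ (n + 1)) =>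
    hasProjectiveDimensionLT_of_iso e.toModuleIso (n + 1)⟩
  refine subsingleton_of_forall_eq 0 fun y => ?_
  have h1 : y.comp (Ext.mk₀ e.toModuleIso.inv) (add_zero i) = 0 :=
    Subsingleton.elim (h := h.subsingleton_ext i hi) _ _
  have h2 : (y.comp (Ext.mk₀ e.toModuleIso.inv) (add_zero i)).comp
      (Ext.mk₀ e.toModuleIso.hom) (add_zero i) = y := by
    rw [Ext.comp_assoc_of_second_deg_zero, Ext.mk₀_comp_mk₀, Iso.inv_hom_id, Ext.comp_mk₀_id]
  rw [← h2, h1, Ext.zero_comp]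

lemma prod (hX : HasPerfectDepth 𝒜 d X) (hY : HasPerfectDepth 𝒜 d Y) :
    HasPerfectDepth 𝒜 d (X × Y) := by
  let S := ModuleCat.shortComplexOfCompEqZero (LinearMap.inl R X Y) (LinearMap.snd R X Y)
    (by ext; simp)
  have hS : S.ShortExact := ModuleCat.shortComplex_shortExact S
    (fun y => ⟨fun h => ⟨y.1, Prod.ext rfl (Eq.symm h)⟩, by rintro ⟨x, rfl⟩; rfl⟩)
    LinearMap.inl_injective LinearMap.snd_surjective
  refine ⟨fun i hi => subsingleton_of_forall_eq 0 fun y => ?_, ?_⟩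
  · obtain ⟨x, rfl⟩ := Ext.covariant_sequence_exact₂ _ hS y
      (Subsingleton.elim (h := hY.subsingleton_ext i hi) _ _)
    have h0 : x = 0 := Subsingleton.elim (h := hX.subsingleton_ext i hi) _ _
    rw [h0, Ext.zero_comp]
  · obtain ⟨a, ha⟩ := hX.projDim
    obtain ⟨b, hb⟩ := hY.projDim
    have h1 : HasProjectiveDimensionLT (ModuleCat.of R X) (max a b + 1) :=
      hasProjectiveDimensionLT_of_ge _ (a + 1) _ (by omega)
    have h2 : HasProjectiveDimensionLT (ModuleCat.of R Y) (max a b + 1) :=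
      hasProjectiveDimensionLT_of_ge _ (b + 1) _ (by omega)
    exact ⟨max a b, hS.hasProjectiveDimensionLT_X₂ _ h1 h2⟩

lemma of_subsingleton [Subsingleton X] : HasPerfectDepth 𝒜 d X := by
  have hz : Limits.IsZero (ModuleCat.of R X) := ModuleCat.isZero_of_subsingleton _
  have := hz.hasProjectiveDimensionLT_zero
  refine ⟨fun i _ => subsingleton_of_forall_eq 0 fun y => ?_, 0,
    hasProjectiveDimensionLT_of_ge _ 0 _ (by omega)⟩
  rw [← Ext.comp_mk₀_id y, hz.eq_of_src (𝟙 _) 0, Ext.mk₀_zero, Ext.comp_zero]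

lemma pi (h : HasPerfectDepth 𝒜 d X) (κ : Type) [Finite κ] : HasPerfectDepth 𝒜 d (κ → X) := by
  induction κ using Finite.induction_empty_option with
  | of_equiv e ih => exact ih.of_equiv (LinearEquiv.funCongrLeft R X e.symm)
  | h_empty => exact of_subsingleton
  | h_option ih => exact (h.prod ih).of_equiv (LinearEquiv.piOptionEquivProd (M := fun _ => X) R).symm

lemma quotient {l rs : List R} (h : IsRegSeq 𝒜 (l ++ rs)) :
    HasPerfectDepth 𝒜 l.length (R ⧸ Ideal.ofList rs) := by
  refine ⟨fun i hi => subsingleton_ext_of_lt h.reg (fun x hx y => ?_) hi,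
    rs.length, hasProjectiveDimensionLE_quotient h.of_append.reg⟩
  obtain ⟨y, rfl⟩ := Ideal.Quotient.mk_surjective y
  exact Ideal.Quotient.eq_zero_iff_mem.2
    (Ideal.mul_mem_right _ _ (h.mem x (List.mem_append_left _ hx)))

variable [GradedRing 𝒜] [IsNoetherianRing R]

/-- Depth as vanishing of Ext behaves well under direct sums; a regular sequence of length d is
extracted from it only here, using the graded Nakayama lemma. -/
lemma isPerfect {M : GradedMod 𝒜} [Nontrivial M] (hm : (homogMaxIdeal 𝒜).IsMaximal)
    (h : HasPerfectDepth 𝒜 d M) (hd : Module.supportDim R M = d) : IsPerfect M := by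
  refine ⟨?_, h.projDim⟩
  have : Module.Finite R (ModuleCat.of R M) := M.finite
  have : Module.Finite R (ModuleCat.of R (R ⧸ homogMaxIdeal 𝒜)) :=
    inferInstanceAs (Module.Finite R (R ⧸ homogMaxIdeal 𝒜))
  obtain ⟨rs, hlen, hmem, hreg⟩ := ModuleCat.exists_isRegular_of_exists_subsingleton_ext
    (homogMaxIdeal 𝒜) d (ModuleCat.of R M) (M.smul_top_ne_top hm.ne_top).lt_top
    (ModuleCat.of R (R ⧸ homogMaxIdeal 𝒜)) (by
      change Module.support R (R ⧸ homogMaxIdeal 𝒜) = _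
      rw [Module.support_eq_zeroLocus, Ideal.annihilator_quotient]) h.subsingleton_ext
  exact ⟨rs, hmem, hreg, by rw [hlen, hd]⟩

lemma of_isPerfect {M : GradedMod 𝒜} (hm : (homogMaxIdeal 𝒜).IsMaximal)
    (h : IsPerfect M) (hd : Module.supportDim R M = d) : HasPerfectDepth 𝒜 d M := by
  refine ⟨?_, h.2⟩
  obtain ⟨rs, hmem, hreg, hlen⟩ := h.1
  have := hreg.nontrivial
  have : Module.Finite R (ModuleCat.of R M) := M.finite
  have : Module.Finite R (ModuleCat.of R (R ⧸ homogMaxIdeal 𝒜)) :=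
    inferInstanceAs (Module.Finite R (R ⧸ homogMaxIdeal 𝒜))
  have hd' : rs.length = d := by exact_mod_cast hlen.trans hd
  rw [← hd']
  refine ModuleCat.subsingleton_ext_of_exists_isRegular (homogMaxIdeal 𝒜) _ ?_
    (ModuleCat.of R M) (M.smul_top_ne_top hm.ne_top).lt_top rs hmem hreg
  change Module.support R (R ⧸ homogMaxIdeal 𝒜) ⊆ _
  rw [Module.support_eq_zeroLocus, Ideal.annihilator_quotient]

end HasPerfectDepth

lemma supportDim_le_of_annihilated {X : Type*} [AddCommGroup X] [Module R X] [Module.Finite R X]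
    {I : Ideal R} (hX : ∀ r ∈ I, ∀ x : X, r • x = 0) :
    Module.supportDim R X ≤ ringKrullDim (R ⧸ I) := by
  rw [Module.supportDim_eq_ringKrullDim_quotient_annihilator]
  exact ringKrullDim_quotient_anti fun r hr => Module.mem_annihilator.2 (hX r hr)

lemma supportDim_eq_of_surjective {X Y : Type*} [AddCommGroup X] [Module R X] [Module.Finite R X]
    [AddCommGroup Y] [Module R Y] {I : Ideal R} (hX : ∀ r ∈ I, ∀ x : X, r • x = 0)
    {f : X →ₗ[R] Y} (hf : Function.Surjective f)
    (hY : Module.supportDim R Y = ringKrullDim (R ⧸ I)) :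
    Module.supportDim R X = ringKrullDim (R ⧸ I) :=
  (supportDim_le_of_annihilated hX).antisymm (hY ▸ Module.supportDim_le_of_surjective f hf)

end Perfect

end ModuleLiaison

namespace ModuleLiaison

open CategoryTheory

/-! ### Dual pairs and hyperbolic pairings -/

section DualPairing

variable {ι : Type} [AddCommGroup ι] [DecidableEq ι] {R : Type u} [CommRing R]
  {𝒜 : ι → AddSubgroup R} [GradedRing 𝒜]

/-- A perfect pairing of degree `e` between `X` and `Y` with values in `R / J`. -/
structure DualPairing {J : Ideal R} (hJ : IsHomogIdeal 𝒜 J) (X Y : GradedMod 𝒜) (e : ι) where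
  γ : X ≃ₗ[R] (Y →ₗ[R] R ⧸ J)
  γ' : Y ≃ₗ[R] (X →ₗ[R] R ⧸ J)
  flip : ∀ x y, γ' y x = γ x y
  deg : ∀ i x, x ∈ X.deg i ↔ IsOfDegree (Y := GradedMod.quotRing J hJ) (i + e) (γ x)
  deg' : ∀ i y, y ∈ Y.deg i ↔ IsOfDegree (Y := GradedMod.quotRing J hJ) (i + e) (γ' y)

variable {J : Ideal R} {hJ : IsHomogIdeal 𝒜 J} {X Y : GradedMod 𝒜} {e : ι}

/-- The perfect pairing on `X ⊕ Y` given by a pairing between `X` and `Y`. -/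
noncomputable def DualPairing.hyperbolic (P : DualPairing hJ X Y e) :
    PerfectPairing hJ (X.directSum Y) e where
  β := (LinearEquiv.prodComm R X Y).trans ((P.γ'.prodCongr P.γ).trans (LinearMap.coprodEquiv R))
  deg i x := by
    obtain ⟨x, y⟩ := x
    refine Iff.trans (and_congr (P.deg i x) (P.deg' i y)) ⟨fun h t z hz => ?_, fun h => ?_⟩
    · exact add_mem (h.2 t _ hz.1) (h.1 t _ hz.2)
    · refine ⟨fun t z hz => ?_, fun t z hz => ?_⟩
      · have h1 : P.γ' y 0 + P.γ x z ∈ _ := h t (0, z) ⟨zero_mem _, hz⟩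
        rwa [map_zero, zero_add] at h1
      · have h1 : P.γ' y z + P.γ x 0 ∈ _ := h t (z, 0) ⟨hz, zero_mem _⟩
        rwa [map_zero, add_zero] at h1

lemma DualPairing.hyperbolic_apply (P : DualPairing hJ X Y e) (x y : X × Y) :
    P.hyperbolic.β x y = P.γ' x.2 y.1 + P.γ x.1 y.2 := rfl

lemma DualPairing.hyperbolic_symm (P : DualPairing hJ X Y e) (x y : X × Y) :
    P.hyperbolic.β x y = P.hyperbolic.β y x := by
  rw [P.hyperbolic_apply, P.hyperbolic_apply, P.flip, P.flip, add_comm]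

/-- Shifting the first argument of a pairing. -/
noncomputable def DualPairing.shift (P : DualPairing hJ X Y e) (j : ι) :
    DualPairing hJ (X.shift j) Y (e + j) where
  γ := P.γ
  γ' := P.γ'
  flip := P.flip
  deg i x := by
    have := P.deg (i + j) x
    rwa [show i + j + e = i + (e + j) by abel] at this
  deg' i y := by
    refine (P.deg' i y).trans ⟨fun h t x hx => ?_, fun h t x hx => ?_⟩
    · have := h (t + j) x hx
      rwa [show t + j + (i + e) = t + (i + (e + j)) by abel] at this
    · have := h (t - j) x (show x ∈ X.deg (t - j + j) by rwa [sub_add_cancel])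
      rwa [show t - j + (i + (e + j)) = t + (i + e) by abel] at this

/-- A symmetric pairing on `X` as a pairing between `X` and itself. -/
noncomputable def PerfectPairing.dualPairing (B : PerfectPairing hJ X e)
    (hB : ∀ x y, B.β x y = B.β y x) : DualPairing hJ X X e where
  γ := B.β
  γ' := B.β
  flip x y := hB y x
  deg := B.deg
  deg' := B.deg

/-- Shifting a perfect pairing. -/
noncomputable def PerfectPairing.shift (B : PerfectPairing hJ X e) (j : ι) :
    PerfectPairing hJ (X.shift j) (e + j + j) where
  β := B.β
  deg i x := by
    refine (B.deg (i + j) x).trans ⟨fun h t y hy => ?_, fun h t y hy => ?_⟩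
    · have := h (t + j) y hy
      rwa [show t + j + (i + j + e) = t + (i + (e + j + j)) by abel] at this
    · have := h (t - j) y (show y ∈ X.deg (t - j + j) by rwa [sub_add_cancel])
      rwa [show t - j + (i + (e + j + j)) = t + (i + j + e) by abel] at this

lemma quotRing_mul_mem {i j : ι} {x y : R ⧸ J} (hx : x ∈ (GradedMod.quotRing J hJ).deg i)
    (hy : y ∈ (GradedMod.quotRing J hJ).deg j) : x * y ∈ (GradedMod.quotRing J hJ).deg (i + j) := by
  obtain ⟨x, hx', rfl⟩ := GradedMod.mem_quotRing_deg.1 hx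
  obtain ⟨y, hy', rfl⟩ := GradedMod.mem_quotRing_deg.1 hy
  rw [← map_mul]
  exact GradedMod.mk_mem_quotRing_deg (SetLike.mul_mem_graded hx' hy')

variable (J) in
/-- The pairing of `(R / J)^κ` with itself. -/
noncomputable def dotEquiv (κ : Type) [Fintype κ] [DecidableEq κ] :
    (κ → R ⧸ J) ≃ₗ[R] ((κ → R ⧸ J) →ₗ[R] R ⧸ J) :=
  ((dotProductEquiv (R ⧸ J) κ).restrictScalars R).trans
    ((LinearMap.extendScalarsOfSurjectiveEquiv (S := R ⧸ J) Ideal.Quotient.mk_surjective).symm.restrictScalars R)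

lemma dotEquiv_apply {κ : Type} [Fintype κ] [DecidableEq κ] (x y : κ → R ⧸ J) :
    dotEquiv J κ x y = ∑ k, x k * y k := rfl

lemma mem_pi_deg_iff {κ : Type} [Fintype κ] [DecidableEq κ] {a b : κ → ι}
    (h : ∀ k, a k + b k + e = 0) (i : ι) (x : κ → R ⧸ J) :
    x ∈ ((GradedMod.quotRing J hJ).pi a).deg i ↔
      IsOfDegree (X := (GradedMod.quotRing J hJ).pi b) (Y := GradedMod.quotRing J hJ) (i + e)
        (dotEquiv J κ x) := by
  have hk : ∀ k, e = - a k - b k := fun k => by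
    rw [← sub_eq_zero, ← h k]; abel
  constructor
  · intro hx t y hy
    rw [dotEquiv_apply]
    refine sum_mem fun k _ => ?_
    have := quotRing_mul_mem (hx k trivial) (hy k trivial)
    rwa [show i - a k + (t - b k) = t + (i + e) by rw [hk k]; abel] at this
  · intro hx k _
    have := hx (b k) (Pi.single k 1) fun l _ => by
      change (Pi.single k 1 : κ → R ⧸ J) l ∈ (GradedMod.quotRing J hJ).deg (b k - b l)
      by_cases hl : l = k
      · subst hl
        rw [Pi.single_eq_same, sub_self]
        exact GradedMod.mk_mem_quotRing_deg SetLike.GradedOne.one_mem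
      · rw [Pi.single_eq_of_ne hl]
        exact zero_mem _
    rw [dotEquiv_apply] at this
    simp only [Pi.single_apply, mul_ite, mul_one, mul_zero, Finset.sum_ite_eq', Finset.mem_univ,
      if_true] at this
    rwa [show b k + (i + e) = i - a k by rw [hk k]; abel] at this

variable (hJ) in
/-- The pairing between `⊕ₖ (R / J)(-aₖ)` and `⊕ₖ (R / J)(-bₖ)`. -/
noncomputable def DualPairing.free {κ : Type} [Fintype κ] [DecidableEq κ] {a b : κ → ι}
    (h : ∀ k, a k + b k + e = 0) :
    DualPairing hJ ((GradedMod.quotRing J hJ).pi a) ((GradedMod.quotRing J hJ).pi b) e where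
  γ := dotEquiv J κ
  γ' := dotEquiv J κ
  flip x y := by
    simp_rw [dotEquiv_apply, mul_comm]
  deg := mem_pi_deg_iff h
  deg' := mem_pi_deg_iff fun k => by rw [add_comm (b k), h k]

lemma DualPairing.smul_eq_zero (P : DualPairing hJ X Y e) {r : R} (hr : r ∈ J) (x : X) (y : Y) :
    r • x = 0 ∧ r • y = 0 :=
  Prod.mk_eq_zero.1 (P.hyperbolic.smul_eq_zero hr (x, y))

/-- The orthogonal of ker φ is graded because ker φ is, so that orthogonality may be tested on
homogeneous elements of ker φ. -/
lemma DualPairing.exists_orthogonal (P : DualPairing hJ X Y e) {M : GradedMod 𝒜} {φ : X →ₗ[R] M}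
    (hφ : ∀ i, ∀ x ∈ X.deg i, φ x ∈ M.deg i) :
    ∃ L : Submodule R Y, Y.IsHomog L ∧ ∀ y, y ∈ L ↔ ∀ k, φ k = 0 → P.γ' y k = 0 := by
  let L : Submodule R Y :=
    { carrier := {y | ∀ k, φ k = 0 → P.γ' y k = 0}
      zero_mem' := fun k _ => by rw [map_zero, LinearMap.zero_apply]
      add_mem' := fun hx hy k hk => by rw [map_add, LinearMap.add_apply, hx k hk, hy k hk, add_zero]
      smul_mem' := fun r x hx k hk => by rw [map_smul, LinearMap.smul_apply, hx k hk, smul_zero] }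
  refine ⟨L, fun i y hy k hk => ?_, fun y => Iff.rfl⟩
  have key : ∀ t, ∀ x ∈ X.deg t, φ x = 0 → P.γ' (Y.comp i y) x = 0 := by
    intro t x hx hφx
    have h3 := GradedMod.comp_map_shift (X := Y) (Y := GradedMod.quotRing J hJ) (t + e)
      (LinearMap.applyₗ x ∘ₗ P.γ'.toLinearMap) (fun j z hz => by
        have := (P.deg' j z).1 hz t x hx
        rwa [show t + (j + e) = j + (t + e) by abel] at this) i y
    refine h3.symm.trans ?_
    have : P.γ' y x = 0 := hy x hφx
    exact (congrArg _ this).trans (map_zero _)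
  obtain ⟨s, hs⟩ := X.exists_sum_comp k
  rw [hs, map_sum]
  refine Finset.sum_eq_zero fun t _ => key t _ (X.comp_mem t k) ?_
  rw [← GradedMod.comp_map φ hφ, hk, map_zero]

end DualPairing

/-! ### Links obtained from hyperbolic pairings -/

section Links

variable {ι : Type} [AddCommGroup ι] [DecidableEq ι] {R : Type u} [CommRing R]
  {𝒜 : ι → AddSubgroup R} [GradedRing 𝒜]

lemma DirectlyLinked.symm {M N : GradedMod 𝒜} (h : DirectlyLinked M N) : DirectlyLinked N M := by
  obtain ⟨C, S, φ, ψ, hC, h1, h2⟩ := h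
  exact ⟨C, S, ψ, φ, hC, h2, h1⟩

lemma GradedMod.Iso.refl (M : GradedMod 𝒜) : M.Iso M := ⟨LinearEquiv.refl R M, fun _ _ => Iff.rfl⟩

variable [IsNoetherianRing R]

lemma nontrivial_of_supportDim_eq {M : GradedMod 𝒜} {d : ℕ} (h : Module.supportDim R M = d) :
    Nontrivial M := by
  rw [← Module.supportDim_ne_bot_iff_nontrivial R, h]
  exact WithBot.coe_ne_bot

variable (G : GoodGrading 𝒜) {rs : List R} {w : ι} {d : ℕ}
  (hrs : IsRegSeq 𝒜 rs) (hw : IsHomogSeq 𝒜 rs w) (hI : ringKrullDim (R ⧸ Ideal.ofList rs) = d)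
  (hd : (d : WithBot ℕ∞) + rs.length = ringKrullDim R) {e : ι}

include G hrs hI hd

lemma PerfectPairing.isQuasiGorenstein {C : GradedMod 𝒜}
    (B : PerfectPairing hw.isHomogIdeal C e) (hC : HasPerfectDepth 𝒜 d C)
    (hCd : Module.supportDim R C = d) : IsQuasiGorenstein C := by
  have := nontrivial_of_supportDim_eq hCd
  obtain ⟨P⟩ := exists_freeRes C
  exact ⟨hC.isPerfect G.isMaximal hCd, ⟨B.selfDuality hrs.reg hw (by rw [HasCodim, hCd, hd]) P⟩⟩

lemma PerfectPairing.directlyLinked_of_surjective {C M N : GradedMod 𝒜}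
    (B : PerfectPairing hw.isHomogIdeal C e) (hC : HasPerfectDepth 𝒜 d C)
    {φ : C →ₗ[R] M} (hφ : ∀ i, ∀ x ∈ C.deg i, φ x ∈ M.deg i) (hφs : Function.Surjective φ)
    {ψ : C →ₗ[R] N} (hψ : ∀ i, ∀ x ∈ C.deg i, ψ x ∈ N.deg i) (hψs : Function.Surjective ψ)
    (hM : Module.supportDim R M = d) (hN : Module.supportDim R N = d)
    (h : ∀ x, ψ x = 0 ↔ ∀ k, φ k = 0 → B.β x k = 0)
    (h' : ∀ x, φ x = 0 ↔ ∀ k, ψ k = 0 → B.β x k = 0) : DirectlyLinked M N := by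
  have hCd : Module.supportDim R C = d := by
    rw [← hI] at hM ⊢
    exact supportDim_eq_of_surjective (fun r hr => B.smul_eq_zero hr) hφs hM
  have := nontrivial_of_supportDim_eq hCd
  exact B.directlyLinked hrs.reg hw (by rw [HasCodim, hCd, hd])
    (hC.isPerfect G.isMaximal hCd) ⟨φ, hφ, hφs, hM.trans hCd.symm⟩ ⟨ψ, hψ, hψs, hN.trans hCd.symm⟩ h h'

variable {X Y M : GradedMod 𝒜} (P : DualPairing hw.isHomogIdeal X Y e)
  (hX : HasPerfectDepth 𝒜 d X) (hY : HasPerfectDepth 𝒜 d Y)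
  (hM : Module.supportDim R M = d)
  (hMt : ∀ x : M, x ≠ 0 → ∃ f : M →ₗ[R] R ⧸ Ideal.ofList rs, f x ≠ 0)
  {φ : X →ₗ[R] M} (hφ : ∀ i, ∀ x ∈ X.deg i, φ x ∈ M.deg i) (hφs : Function.Surjective φ)
  {L : Submodule R Y} (hL : Y.IsHomog L) (hLφ : ∀ y, y ∈ L ↔ ∀ k, φ k = 0 → P.γ' y k = 0)

include P hM hφs in
lemma DualPairing.supportDim_directSum :
    Module.supportDim R ((Y.quot L hL).directSum X) = d := by
  rw [← hI] at hM ⊢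
  have h1 : Module.supportDim R X = _ :=
    supportDim_eq_of_surjective (fun r hr x => (P.smul_eq_zero hr x 0).1) hφs hM
  change Module.supportDim R ((Y ⧸ L) × X) = _
  refine supportDim_eq_of_surjective (X := (Y ⧸ L) × X) (fun r hr x => ?_)
    (LinearMap.snd_surjective (R := R) (M := Y ⧸ L) (M₂ := X)) h1
  obtain ⟨x, y⟩ := x
  obtain ⟨x, rfl⟩ := L.mkQ_surjective x
  refine Prod.ext ?_ (P.smul_eq_zero hr y 0).1
  change r • L.mkQ x = 0
  rw [← map_smul, (P.smul_eq_zero hr 0 x).2, map_zero]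

omit [IsNoetherianRing R] G hrs hI hd in
include P hMt hLφ in
-- If φ x ≠ 0, choose f on M with f (φ x) ≠ 0. By perfectness f ∘ φ is the pairing with some y; this
-- y lies in L and is not orthogonal to x.
lemma DualPairing.orthogonal_orthogonal (x : X) : φ x = 0 ↔ ∀ l ∈ L, P.γ x l = 0 := by
  refine ⟨fun hx l hl => ?_, fun h => ?_⟩
  · rw [← P.flip]
    exact (hLφ l).1 hl x hx
  · by_contra hx
    obtain ⟨f, hf⟩ := hMt _ hx
    have h1 : P.γ' (P.γ'.symm (f ∘ₗ φ)) = f ∘ₗ φ := P.γ'.apply_symm_apply _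
    refine hf ?_
    have h2 := h (P.γ'.symm (f ∘ₗ φ)) ((hLφ _).2 fun k hk => by
      rw [h1, LinearMap.comp_apply, hk, map_zero])
    rwa [← P.flip, h1] at h2

include hX hY hM hMt hφ hφs hLφ in
-- In the hyperbolic module X ⊕ Y, the submodules ker φ ⊕ Y and 0 ⊕ L are mutually orthogonal; their
-- quotients are M and Y/L ⊕ X.
lemma DualPairing.directlyLinked : DirectlyLinked M ((Y.quot L hL).directSum X) := by
  let ψ : X × Y →ₗ[R] (Y ⧸ L) × X :=
    (L.mkQ ∘ₗ LinearMap.snd R X Y).prod (LinearMap.fst R X Y)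
  have hψ : ∀ x y, ψ (x, y) = 0 ↔ y ∈ L ∧ x = 0 := fun x y => by
    rw [← Submodule.Quotient.mk_eq_zero L]
    exact Prod.mk_eq_zero
  refine P.hyperbolic.directlyLinked_of_surjective G hrs hw hI hd (hX.prod hY)
    (φ := φ ∘ₗ LinearMap.fst R X Y) (fun i x hx => hφ i _ hx.1)
    (hφs.comp LinearMap.fst_surjective) (ψ := ψ)
    (fun i x hx => ⟨GradedMod.mkQ_mem_quot_deg hx.2, hx.1⟩) ?_ hM
    (P.supportDim_directSum G hrs hw hI hd hM hφs hL) ?_ ?_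
  · rintro ⟨y, x⟩
    obtain ⟨y, rfl⟩ := L.mkQ_surjective y
    exact ⟨(x, y), rfl⟩
  · rintro ⟨x, y⟩
    refine (hψ x y).trans ⟨?_, fun h => ⟨(hLφ y).2 fun k hk => ?_, ?_⟩⟩
    · rintro ⟨hy, rfl⟩ ⟨k, l⟩ hk
      rw [P.hyperbolic_apply, map_zero, LinearMap.zero_apply, add_zero]
      exact (hLφ y).1 hy k hk
    · have : P.γ' y k + P.γ x 0 = 0 := h (k, 0) hk
      rwa [map_zero, add_zero] at this
    · refine P.γ.injective ?_
      rw [map_zero]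
      ext l
      have : P.γ' y 0 + P.γ x l = 0 := h (0, l) (map_zero φ)
      rwa [map_zero, zero_add] at this
  · rintro ⟨x, y⟩
    refine (P.orthogonal_orthogonal hw hMt hLφ x).trans ⟨?_, fun h l hl => ?_⟩
    · rintro h ⟨k, l⟩ hkl
      obtain ⟨hl, rfl⟩ := (hψ k l).1 hkl
      rw [P.hyperbolic_apply, map_zero, zero_add]
      exact h l hl
    · have : P.γ' y 0 + P.γ x l = 0 := h (0, l) ((hψ 0 l).2 ⟨hl, rfl⟩)
      rwa [map_zero, zero_add] at this

include hX hY hM hMt hφ hφs hLφ in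
-- With D added orthogonally, ker φ ⊕ Y ⊕ 0 and 0 ⊕ L ⊕ D are mutually orthogonal. The factor D
-- survives in the first quotient and is killed in the second, so the link is the same as for M
-- alone.
lemma DualPairing.directlyLinked_directSum {D : GradedMod 𝒜}
    (B : PerfectPairing hw.isHomogIdeal D e) (hD : HasPerfectDepth 𝒜 d D) :
    DirectlyLinked (M.directSum D) ((Y.quot L hL).directSum X) := by
  let ψ : (X × Y) × D →ₗ[R] (Y ⧸ L) × X :=
    (L.mkQ ∘ₗ LinearMap.snd R X Y ∘ₗ LinearMap.fst R (X × Y) D).prod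
      (LinearMap.fst R X Y ∘ₗ LinearMap.fst R (X × Y) D)
  have hψ : ∀ x y z, ψ ((x, y), z) = 0 ↔ y ∈ L ∧ x = 0 := fun x y z => by
    rw [← Submodule.Quotient.mk_eq_zero L]
    exact Prod.mk_eq_zero
  have hap : ∀ x y z k l m, (P.hyperbolic.directSum B).β ((x, y), z) ((k, l), m) =
      P.γ' y k + P.γ x l + B.β z m := fun _ _ _ _ _ _ => rfl
  have hMD : Module.supportDim R (M.directSum D) = d := by
    rw [← hI] at hM ⊢
    change Module.supportDim R (M × D) = _
    refine supportDim_eq_of_surjective (X := M × D) (fun r hr z => ?_)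
      (LinearMap.fst_surjective (R := R) (M := M) (M₂ := D)) hM
    obtain ⟨x, hx⟩ := hφs z.1
    refine Prod.ext ?_ (B.smul_eq_zero hr z.2)
    change r • z.1 = 0
    rw [← hx, ← map_smul, (P.smul_eq_zero hr x 0).1, map_zero]
  refine (P.hyperbolic.directSum B).directlyLinked_of_surjective G hrs hw hI hd ((hX.prod hY).prod hD)
    (φ := (φ ∘ₗ LinearMap.fst R X Y).prodMap LinearMap.id)
    (fun i x hx => ⟨hφ i _ hx.1.1, hx.2⟩)
    ((hφs.comp LinearMap.fst_surjective).prodMap Function.surjective_id) (ψ := ψ)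
    (fun i x hx => ⟨GradedMod.mkQ_mem_quot_deg hx.1.2, hx.1.1⟩) ?_ hMD
    (P.supportDim_directSum G hrs hw hI hd hM hφs hL) ?_ ?_
  · rintro ⟨y, x⟩
    obtain ⟨y, rfl⟩ := L.mkQ_surjective y
    exact ⟨((x, y), 0), rfl⟩
  · rintro ⟨⟨x, y⟩, z⟩
    refine (hψ x y z).trans ⟨?_, fun h => ⟨(hLφ y).2 fun k hk => ?_, ?_⟩⟩
    · rintro ⟨hy, rfl⟩ ⟨⟨k, l⟩, m⟩ hkm
      obtain ⟨hk, hm⟩ := Prod.mk_eq_zero.1 hkm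
      have hm' : m = 0 := hm
      rw [hap, hm', map_zero, map_zero, LinearMap.zero_apply, add_zero, add_zero]
      exact (hLφ y).1 hy k hk
    · have := h ((k, 0), 0) (Prod.mk_eq_zero.2 ⟨hk, rfl⟩)
      rwa [hap, map_zero, map_zero, add_zero, add_zero] at this
    · refine P.γ.injective ?_
      rw [map_zero]
      ext l
      have := h ((0, l), 0) (Prod.mk_eq_zero.2 ⟨map_zero φ, rfl⟩)
      rwa [hap, map_zero, map_zero, zero_add, add_zero] at this
  · rintro ⟨⟨x, y⟩, z⟩
    refine (Prod.mk_eq_zero (x := φ x) (y := z)).trans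
      ((and_congr_left' (P.orthogonal_orthogonal hw hMt hLφ x)).trans ⟨?_, fun h => ⟨fun l hl => ?_, ?_⟩⟩)
    · rintro ⟨h, rfl⟩ ⟨⟨k, l⟩, m⟩ hkl
      obtain ⟨hl, rfl⟩ := (hψ k l m).1 hkl
      rw [hap, map_zero, map_zero, zero_add, LinearMap.zero_apply, add_zero]
      exact h l hl
    · have := h ((0, l), 0) ((hψ 0 l 0).2 ⟨hl, rfl⟩)
      rwa [hap, map_zero, map_zero, zero_add, add_zero] at this
    · refine B.β.injective ?_
      rw [map_zero]
      ext m
      have := h ((0, 0), m) ((hψ 0 0 m).2 ⟨zero_mem _, rfl⟩)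
      rwa [hap, map_zero, map_zero, zero_add, zero_add] at this

end Links

end ModuleLiaison

namespace ModuleLiaison

open CategoryTheory

/-! ### The links of the theorem under a good grading -/

section Main

variable {ι : Type} [AddCommGroup ι] [DecidableEq ι] {R : Type u} [CommRing R]
  {𝒜 : ι → AddSubgroup R} [GradedRing 𝒜]

lemma exists_free_surjection {J : Ideal R} (hJ : IsHomogIdeal 𝒜 J) (M : GradedMod 𝒜)
    (hM : ∀ r ∈ J, ∀ x : M, r • x = 0) : ∃ (r : ℕ) (a : Fin r → ι)
      (φ : (Fin r → R ⧸ J) →ₗ[R] M),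
      (∀ i, ∀ x ∈ ((GradedMod.quotRing J hJ).pi a).deg i, φ x ∈ M.deg i) ∧
      Function.Surjective φ := by
  obtain ⟨r, a, x, hxa, hx⟩ := M.exists_homogeneous_generators
  have hle : ∀ k, J ≤ LinearMap.ker (LinearMap.toSpanSingleton R M (x k)) := fun k s hs =>
    hM s hs (x k)
  let l : Fin r → (R ⧸ J) →ₗ[R] M := fun k => J.liftQ (LinearMap.toSpanSingleton R M (x k)) (hle k)
  have hl : ∀ k s, l k (Ideal.Quotient.mk J s) = s • x k := fun k s => rfl
  let φ : (Fin r → R ⧸ J) →ₗ[R] M := ∑ k, l k ∘ₗ LinearMap.proj k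
  have hφ : ∀ y, φ y = ∑ k, l k (y k) := fun y => by simp [φ]
  refine ⟨r, a, φ, fun i y hy => ?_, ?_⟩
  · rw [hφ]
    refine sum_mem fun k _ => ?_
    obtain ⟨s, hs, hsy⟩ := GradedMod.mem_quotRing_deg.1 (hy k trivial)
    rw [← hsy, hl]
    have := M.smul_mem hs (hxa k)
    rwa [sub_add_cancel] at this
  · rw [← LinearMap.range_eq_top, ← top_le_iff, ← hx, Submodule.span_le]
    rintro _ ⟨k, rfl⟩
    refine ⟨Pi.single k 1, ?_⟩
    rw [hφ, Finset.sum_eq_single k, Pi.single_eq_same]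
    · exact (hl k 1).trans (one_smul _ _)
    · intro j _ hj
      rw [Pi.single_eq_of_ne hj, map_zero]
    · simp

variable [IsNoetherianRing R] (G : GoodGrading 𝒜)

include G

lemma GoodGrading.supportDim_add_eq {c d : ℕ} {X : GradedMod 𝒜} (hX : HasCodim X c)
    (hd : Module.supportDim R X = d) : (d : WithBot ℕ∞) + c = ringKrullDim R := hd ▸ hX

lemma GoodGrading.exists_supportDim_eq (M : GradedMod 𝒜) [Nontrivial M] :
    ∃ d c : ℕ, Module.supportDim R M = d ∧ HasCodim M c := by
  obtain ⟨n, hn⟩ := G.exists_ringKrullDim_eq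
  have h1 := Module.supportDim_le_ringKrullDim R M
  have h2 := Module.supportDim_ne_bot_of_nontrivial R M
  rw [hn] at h1
  simp only [HasCodim, hn]
  generalize Module.supportDim R M = d at h1 h2 ⊢
  match d with
  | ⊥ => exact absurd rfl h2
  | (⊤ : ℕ∞) => exact absurd (WithBot.coe_le_coe.1 h1) (by simp)
  | ((d : ℕ) : ℕ∞) =>
    have h3 : d ≤ n := by exact_mod_cast h1
    refine ⟨d, n - d, rfl, ?_⟩
    have h4 := congrArg (Nat.cast : ℕ → WithBot ℕ∞) (Nat.add_sub_of_le h3)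
    rwa [Nat.cast_add] at h4

/-- A homogeneous regular sequence that annihilates two modules of the same dimension and has the
length of their codimension. -/
lemma GoodGrading.exists_isRegSeq_annihilator {M D : GradedMod 𝒜} [Nontrivial M] {c d : ℕ}
    (hM : Module.supportDim R M = d) (hD : Module.supportDim R D = d) (hc : HasCodim M c) :
    ∃ rs : List R, IsRegSeq 𝒜 rs ∧ rs.length = c ∧ (∀ x ∈ rs, ∀ y : M, x • y = 0) ∧
      (∀ x ∈ rs, ∀ y : D, x • y = 0) ∧ ringKrullDim (R ⧸ Ideal.ofList rs) = d ∧
      HasPerfectDepth 𝒜 d (R ⧸ Ideal.ofList rs) := by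
  have hc' : HasCodim D c := by rwa [HasCodim, hD, ← hM]
  have hMd := hM
  unfold HasCodim at hc hc'
  rw [Module.supportDim_eq_ringKrullDim_quotient_annihilator] at hc hc'
  obtain ⟨rs, hrs, hann, hlen⟩ := G.exists_isRegSeq (isHomogIdeal_annihilator M)
    (isHomogIdeal_annihilator D) ((isHomogIdeal_annihilator M).le_homogMaxIdeal fun h =>
      not_subsingleton M (Module.annihilator_eq_top_iff.1 h)) hc hc'
  obtain ⟨l, hl, h1, h2⟩ := G.exists_complementary hrs
  have h3 : l.length = d := by
    rw [← Module.supportDim_eq_ringKrullDim_quotient_annihilator, hMd, h1] at hc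
    have : d + c = l.length + rs.length := by exact_mod_cast hc
    omega
  rw [← h3]
  exact ⟨rs, hrs, hlen, fun x hx => Module.mem_annihilator.1 (hann x hx).1,
    fun x hx => Module.mem_annihilator.1 (hann x hx).2, h2, HasPerfectDepth.quotient hl⟩

theorem GoodGrading.exists_link_directSum {D M : GradedMod 𝒜} (hD : IsQuasiGorenstein D)
    (hM : IsUnmixed M) (hdim : Module.supportDim R M = Module.supportDim R D) :
    ∃ N, DirectlyLinked (M.directSum D) N ∧ DirectlyLinked N M := by
  obtain ⟨hDP, ⟨S⟩⟩ := hD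
  have hDn : Nontrivial D := by
    obtain ⟨⟨_, -, h, -⟩, -⟩ := hDP
    exact h.nontrivial
  obtain ⟨d, -, hDd, -⟩ := G.exists_supportDim_eq D
  have hMd := hdim.trans hDd
  have hMn := nontrivial_of_supportDim_eq hMd
  have hMc : HasCodim M S.c := by
    have := S.codim
    rwa [HasCodim, ← hdim] at this
  obtain ⟨rs, hrs, hlen, hannM, hannD, hI, hA⟩ := G.exists_isRegSeq_annihilator hMd hDd hMc
  obtain ⟨w, hw⟩ := exists_isHomogSeq hrs.homog
  have hd := G.supportDim_add_eq hMc hMd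
  rw [← hlen] at hd hMc
  let B := PerfectPairing.ofSelfDuality hrs.reg hw S hlen hannD
  have hIM : ∀ r ∈ Ideal.ofList rs, ∀ x : M, r • x = 0 := fun r hr =>
    Module.mem_annihilator.1 ((Ideal.span_le (I := Module.annihilator R M)).2
      (fun x hx => Module.mem_annihilator.2 (hannM x hx)) hr)
  obtain ⟨r, a, φ, hφ, hφs⟩ := exists_free_surjection hw.isHomogIdeal M hIM
  -- The degrees b of the dual basis are chosen so that this pairing has the degree of the pairing
  -- on D; otherwise their orthogonal sum would not be homogeneous.
  let P := DualPairing.free hw.isHomogIdeal (e := S.s + w) (a := a)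
    (b := fun k => - (S.s + w) - a k) (fun k => by abel)
  obtain ⟨L, hL, hLφ⟩ := P.exists_orthogonal hφ
  have hMt : ∀ x : M, x ≠ 0 → ∃ f : M →ₗ[R] R ⧸ Ideal.ofList rs, f x ≠ 0 := fun x hx =>
    exists_map_ne_zero G.gorenstein hrs.reg hannM
      (G.associatedPrimes_subset hM hrs hMc hannM) hx
  exact ⟨_, P.directlyLinked_directSum G hrs hw hI hd (hA.pi _) (hA.pi _) hMd hMt hφ hφs hL hLφ B
      (HasPerfectDepth.of_isPerfect G.isMaximal hDP hDd),
    (P.directlyLinked G hrs hw hI hd (hA.pi _) (hA.pi _) hMd hMt hφ hφs hL hLφ).symm⟩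

theorem GoodGrading.linkedInSteps_two {D M : GradedMod 𝒜} (hD : IsQuasiGorenstein D)
    (hM : IsUnmixed M) (hdim : Module.supportDim R M = Module.supportDim R D) :
    LinkedInSteps 2 (M.directSum D) M := by
  obtain ⟨N, h1, h2⟩ := G.exists_link_directSum hD hM hdim
  exact ⟨N, h1, M, h2, GradedMod.Iso.refl M⟩

omit [DecidableEq ι] [GradedRing 𝒜] G in
-- If Hom(N, R/(rs)) separates elements, an associated prime of N lies in one of R/(rs), whose
-- height is rs.length. It also contains the regular sequence rs, which gives the opposite bound.
lemma height_eq_of_mem_associatedPrimes_quotient (hR : IsGorensteinRing R) {rs : List R}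
    (hreg : IsRegRev rs) {N : Type*} [AddCommGroup N] [Module R N]
    (hann : ∀ x ∈ rs, ∀ y : N, x • y = 0)
    (hN : ∀ x : N, x ≠ 0 → ∃ f : N →ₗ[R] R ⧸ Ideal.ofList rs, f x ≠ 0) {p : Ideal R}
    (hp : p ∈ associatedPrimes R N) : p.height = rs.length := by
  obtain ⟨hp', x, hx⟩ := mem_associatedPrimes_iff.1 hp
  have hx0 : x ≠ 0 := fun h => hp'.ne_top ((Ideal.eq_top_iff_one _).2 ((hx 1).2 (by rw [h, smul_zero])))
  obtain ⟨f, hf⟩ := hN x hx0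
  obtain ⟨q, hq, b, hb⟩ := exists_mem_associatedPrimes_smul (R := R) hf
  have hpq : p ≤ q := fun a ha => (hb a).2 (by
    rw [smul_comm, ← map_smul f a, (hx a).1 ha, map_zero, smul_zero])
  have h1 := length_le_height hreg (p := p) (Ideal.span_le.2 fun r hr => (hx r).2 (hann r hr x))
  exact ((Ideal.height_mono hpq).trans (height_eq_length hR hreg hq).le).antisymm h1

/-- The self-dual module F serves as both arguments of the pairing. When only the first argument is
shifted, the orthogonal L in the second one is unchanged, so M and M(j) are linked to N ⊕ F and N ⊕
F(j) with the same N = F/L. -/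
theorem GoodGrading.evenlyLinked_shift {M : GradedMod 𝒜} [Nontrivial M] (hM : IsUnmixed M) (j : ι) :
    EvenlyLinked M (M.shift j) := by
  obtain ⟨d, c, hMd, hMc⟩ := G.exists_supportDim_eq M
  obtain ⟨rs, hrs, hlen, hannM, -, hI, hA⟩ := G.exists_isRegSeq_annihilator hMd hMd hMc
  obtain ⟨w, hw⟩ := exists_isHomogSeq hrs.homog
  have hd := G.supportDim_add_eq hMc hMd
  rw [← hlen] at hd hMc
  have hIM : ∀ r ∈ Ideal.ofList rs, ∀ x : M, r • x = 0 := fun r hr =>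
    Module.mem_annihilator.1 ((Ideal.span_le (I := Module.annihilator R M)).2
      (fun x hx => Module.mem_annihilator.2 (hannM x hx)) hr)
  obtain ⟨r, a, φ₀, hφ₀, hφ₀s⟩ := exists_free_surjection hw.isHomogIdeal M hIM
  have hMt : ∀ x : M, x ≠ 0 → ∃ f : M →ₗ[R] R ⧸ Ideal.ofList rs, f x ≠ 0 := fun x hx =>
    exists_map_ne_zero G.gorenstein hrs.reg hannM
      (G.associatedPrimes_subset hM hrs hMc hannM) hx
  let P₀ := DualPairing.free hw.isHomogIdeal (e := 0) (a := a) (b := fun k => - a k)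
    (fun k => by abel)
  let F₀ := (GradedMod.quotRing (Ideal.ofList rs) hw.isHomogIdeal).pi a
  let F₁ := (GradedMod.quotRing (Ideal.ofList rs) hw.isHomogIdeal).pi fun k => - a k
  let F := F₀.directSum F₁
  let B := P₀.hyperbolic
  let P := B.dualPairing P₀.hyperbolic_symm
  have hF : HasPerfectDepth 𝒜 d F := (hA.pi _).prod (hA.pi _)
  let φ : F →ₗ[R] M := φ₀ ∘ₗ LinearMap.fst R F₀ F₁
  have hφ : ∀ i, ∀ x ∈ F.deg i, φ x ∈ M.deg i := fun i x hx => hφ₀ i _ hx.1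
  have hφs : Function.Surjective φ := hφ₀s.comp LinearMap.fst_surjective
  obtain ⟨L, hL, hLφ⟩ := P.exists_orthogonal hφ
  let N := F.quot L hL
  have hFd : Module.supportDim R F = d := by
    rw [← hI] at hMd ⊢
    exact supportDim_eq_of_surjective (fun r hr x => (P.smul_eq_zero hr x x).1) hφs hMd
  have hNd : Module.supportDim R N = d := by
    -- The kernel of φ contains F₁, so elements of its orthogonal L have first component 0. Thus N
    -- maps onto F₀ and has full dimension.
    have hL0 : L ≤ LinearMap.ker (LinearMap.fst R F₀ F₁) := fun y hy => by
      refine P₀.γ.injective (LinearMap.ext fun l => ?_)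
      have h1 : P₀.γ' y.2 0 + P₀.γ y.1 l = 0 := (hLφ y).1 hy (0, l) (map_zero φ₀)
      rw [map_zero, zero_add] at h1
      exact h1.trans (by rw [map_zero]; rfl)
    have h0 : Module.supportDim R F₀ = d := by
      rw [← hI] at hMd ⊢
      exact supportDim_eq_of_surjective (fun r hr x => (P₀.smul_eq_zero hr x 0).1) hφ₀s hMd
    rw [← hI] at h0 ⊢
    refine supportDim_eq_of_surjective (fun r hr x => ?_) (f := L.liftQ (LinearMap.fst R F₀ F₁) hL0)
      (fun y => ⟨L.mkQ (y, 0), rfl⟩) h0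
    obtain ⟨x, rfl⟩ := L.mkQ_surjective x
    rw [← map_smul, (P.smul_eq_zero hr x x).1, map_zero]
  -- N = F/L embeds into Hom(ker φ, A), so evaluations at elements of ker φ separate its elements;
  -- hence N is unmixed and part (b) applies to it.
  have hNt : ∀ x : N, x ≠ 0 → ∃ f : N →ₗ[R] R ⧸ Ideal.ofList rs, f x ≠ 0 := by
    intro x hx
    obtain ⟨y, rfl⟩ := L.mkQ_surjective x
    have hy : y ∉ L := fun h => hx ((Submodule.Quotient.mk_eq_zero L).2 h)
    rw [hLφ] at hy
    push Not at hy
    obtain ⟨k, hk, hyk⟩ := hy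
    exact ⟨L.liftQ (LinearMap.applyₗ k ∘ₗ P.γ'.toLinearMap) (fun z hz => (hLφ z).1 hz k hk), hyk⟩
  have hN : IsUnmixed N := by
    have hannN : ∀ x ∈ rs, ∀ y : N, x • y = 0 := fun x hx y => by
      obtain ⟨y, rfl⟩ := L.mkQ_surjective y
      rw [← map_smul, (P.smul_eq_zero (Ideal.subset_span hx) y y).1, map_zero]
    intro p hp q hq
    rw [height_eq_of_mem_associatedPrimes_quotient G.gorenstein hrs.reg hannN hNt hp,
      height_eq_of_mem_associatedPrimes_quotient G.gorenstein hrs.reg hannN hNt hq]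
  have hF' : HasPerfectDepth 𝒜 d (F.shift j) := hF
  have hFd' : Module.supportDim R (F.shift j) = d := hFd
  obtain ⟨Y₀, h1, h2⟩ := G.exists_link_directSum
    (B.isQuasiGorenstein G hrs hw hI hd hF hFd) hN (hNd.trans hFd.symm)
  obtain ⟨Y₁, h3, h4⟩ := G.exists_link_directSum
    ((B.shift j).isQuasiGorenstein G hrs hw hI hd hF' hFd') hN (hNd.trans hFd'.symm)
  have h5 : DirectlyLinked M (N.directSum F) :=
    P.directlyLinked G hrs hw hI hd hF hF hMd hMt hφ hφs hL hLφ
  have h6 : DirectlyLinked (M.shift j) (N.directSum (F.shift j)) :=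
    (P.shift j).directlyLinked (M := M.shift j) G hrs hw hI hd hF' hF hMd hMt (φ := φ)
      (fun i => hφ (i + j)) hφs hL hLφ
  -- The chain is M, N ⊕ F, Y₀, N, Y₁, N ⊕ F(j), M(j).
  exact ⟨6, by decide, _, h5, _, h1, _, h2, _, h4.symm, _, h3.symm, _, h6.symm, GradedMod.Iso.refl _⟩

theorem GoodGrading.sameEvenLiaisonClass_shift {M : GradedMod 𝒜} (hM : IsUnmixed M) (j : ι) :
    SameEvenLiaisonClass M (M.shift j) := by
  refine .rel _ _ ?_
  obtain h | h := subsingleton_or_nontrivial M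
  -- The zero module equals its shift, so a chain of zero links suffices.
  · exact ⟨0, by decide, LinearEquiv.refl R M, fun i x => by
      rw [Subsingleton.elim x 0]
      exact iff_of_true (zero_mem _) (zero_mem _)⟩
  · exact G.evenlyLinked_shift hM j

end Main

end ModuleLiaison

namespace ModuleLiaison

/-! ### The local case -/

section Local

variable {R : Type u} [CommRing R]

/-- The maximal ideal of R/J is minimal over the images of ys, so its height is bounded by Krull's
height theorem. -/
lemma ringKrullDim_quotient_le_length [IsLocalRing R] [IsNoetherianRing R] (J : Ideal R)
    {ys : List R} (hys : ∀ y ∈ ys, y ∈ IsLocalRing.maximalIdeal R) {k : ℕ}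
    (hk : IsLocalRing.maximalIdeal R ^ k ≤ J ⊔ Ideal.ofList ys) :
    ringKrullDim (R ⧸ J) ≤ ys.length := by
  classical
  by_cases hJ : J = ⊤
  · have : Subsingleton (R ⧸ J) := Ideal.Quotient.subsingleton_iff.2 hJ
    rw [ringKrullDim_eq_bot_of_subsingleton]
    exact bot_le
  have : Nontrivial (R ⧸ J) := Ideal.Quotient.nontrivial_iff.2 hJ
  have hloc : IsLocalRing (R ⧸ J) :=
    IsLocalRing.of_surjective' (Ideal.Quotient.mk J) Ideal.Quotient.mk_surjective
  have hmk : ∀ x ∈ IsLocalRing.maximalIdeal R,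
      Ideal.Quotient.mk J x ∈ IsLocalRing.maximalIdeal (R ⧸ J) := by
    have h := IsLocalRing.eq_maximalIdeal (Ideal.comap_isMaximal_of_surjective (Ideal.Quotient.mk J)
      Ideal.Quotient.mk_surjective (K := IsLocalRing.maximalIdeal (R ⧸ J)))
    exact fun x hx => Ideal.mem_comap.1 (h ▸ hx)
  have hmin : IsLocalRing.maximalIdeal (R ⧸ J) ∈
      (Ideal.span ((ys.map (Ideal.Quotient.mk J)).toFinset : Set (R ⧸ J))).minimalPrimes := by
    refine ⟨⟨inferInstance, Ideal.span_le.2 ?_⟩, fun q hq _ => ?_⟩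
    · intro y hy
      simp only [List.coe_toFinset, List.mem_map, Set.mem_ofPred_eq] at hy
      obtain ⟨z, hz, rfl⟩ := hy
      exact hmk z (hys z hz)
    · have hqp := hq.1
      have h1 : J ⊔ Ideal.ofList ys ≤ q.comap (Ideal.Quotient.mk J) := by
        refine sup_le (fun x hx => ?_) (Ideal.span_le.2 fun y hy => hq.2 (Ideal.subset_span ?_))
        · rw [Ideal.mem_comap, Ideal.Quotient.eq_zero_iff_mem.2 hx]
          exact zero_mem _
        · simp only [List.coe_toFinset, List.mem_map, Set.mem_ofPred_eq]
          exact ⟨y, hy, rfl⟩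
      have h2 := Ideal.IsPrime.le_of_pow_le (hk.trans h1)
      intro x hx
      obtain ⟨x, rfl⟩ := Ideal.Quotient.mk_surjective x
      refine h2 ((IsLocalRing.mem_maximalIdeal x).2 fun hu => ?_)
      exact (IsLocalRing.mem_maximalIdeal _).1 hx (hu.map _)
  have h1 := Ideal.height_le_card_of_mem_minimalPrimes_span_finset hmin
  rw [← IsLocalRing.maximalIdeal_height_eq_ringKrullDim]
  refine (WithBot.coe_le_coe.2 (h1.trans (Nat.cast_le.2
    ((List.toFinset_card_le _).trans (List.length_map _).le)))).trans ?_
  exact le_rfl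

lemma mem_of_unit (𝒜 : Unit → AddSubgroup R) [GradedRing 𝒜] (x : R) :
    x ∈ 𝒜 () := by
  obtain ⟨s, hs⟩ := exists_sum_rcomp 𝒜 x
  rw [hs]
  exact sum_mem fun i _ => rcomp_mem i x

theorem GoodGrading.of_isLocalRing [IsLocalRing R] (𝒜 : Unit → AddSubgroup R) [GradedRing 𝒜]
    (hR : IsGorensteinRing R) : GoodGrading 𝒜 := by
  have := hR.noetherian
  have hm : homogMaxIdeal 𝒜 = IsLocalRing.maximalIdeal R := by
    refine le_antisymm (Ideal.span_le.2 fun x hx => hx.2) fun x hx => Ideal.subset_span ?_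
    exact ⟨⟨(), mem_of_unit 𝒜 x⟩, hx⟩
  refine ⟨hR, hm ▸ inferInstance, ?_, ?_⟩
  · intro J _ _ s hs hp h
    have h1 := (Ideal.subset_union_prime (s := hs.toFinset) (f := id) ⊥ ⊥
      (fun p hps _ _ => hp p (hs.mem_toFinset.1 hps)) (I := J)).1 fun x hx => by
        obtain ⟨p, hps, hxp⟩ := h () x (mem_of_unit 𝒜 x) hx
        exact Set.mem_biUnion (hs.mem_toFinset.2 hps) hxp
    obtain ⟨p, hps, hJ⟩ := h1
    exact ⟨p, hs.mem_toFinset.1 hps, hJ⟩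
  · intro J _ ys hys _ k hk
    rw [hm] at hk hys
    exact ringKrullDim_quotient_le_length J hys hk

end Local

/-! ### The standard graded case: prime avoidance and the irrelevant ideal -/

section Graded

variable {R : Type u} [CommRing R] {𝒜 : ℤ → AddSubgroup R} [GradedRing 𝒜]

lemma rcomp_mem_of_mem_span {N : AddSubgroup R} {S : Set R} {i : ℤ}
    (h : ∀ x ∈ S, ∀ r, rcomp 𝒜 i (r * x) ∈ N) {z : R} (hz : z ∈ Ideal.span S) :
    rcomp 𝒜 i z ∈ N := by
  suffices H : ∀ r, rcomp 𝒜 i (r * z) ∈ N by simpa using H 1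
  induction hz using Submodule.span_induction with
  | mem x hx => exact h x hx
  | zero => simp
  | add x y _ _ hx hy => exact fun r => by rw [mul_add, map_add]; exact add_mem (hx r) (hy r)
  | smul s x _ hx => exact fun r => by rw [smul_eq_mul, ← mul_assoc]; exact hx _

lemma rcomp_mul_eq {x : R} {j : ℤ} (i : ℤ) (r : R) (hx : x ∈ 𝒜 j) :
    rcomp 𝒜 i (r * x) = rcomp 𝒜 (i - j) r * x := by
  rw [← rcomp_mul _ r hx, sub_add_cancel]

lemma not_isUnit_of_mem (hneg : ∀ i < 0, 𝒜 i = ⊥) [Nontrivial R] {i : ℤ} (hi : 0 < i) {x : R}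
    (hx : x ∈ 𝒜 i) : ¬ IsUnit x := by
  rintro ⟨u, rfl⟩
  have h1 := rcomp_mul_eq 0 (↑u⁻¹ : R) hx
  have h2 : rcomp 𝒜 (0 - i) (↑u⁻¹ : R) = 0 := by
    have := rcomp_mem (𝒜 := 𝒜) (0 - i) (↑u⁻¹ : R)
    rw [hneg _ (by omega)] at this
    exact this
  rw [Units.inv_mul, h2, zero_mul, rcomp_of_mem (SetLike.GradedOne.one_mem)] at h1
  exact one_ne_zero h1

/-- Homogeneous prime avoidance. -/
lemma exists_homogeneous_notMem {J : Ideal R} (hJ : ∀ p : Ideal R, ¬ J ≤ p → p.IsPrime →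
      ∃ i : ℕ, 0 < i ∧ ∃ a ∈ 𝒜 i, a ∈ J ∧ a ∉ p)
    (hneg : ∀ i < 0, 𝒜 i = ⊥) (s : Finset (Ideal R)) (hs : ∀ p ∈ s, p.IsPrime ∧ ¬ J ≤ p) :
    ∃ i : ℕ, 0 < i ∧ ∃ a ∈ 𝒜 i, a ∈ J ∧ ∀ p ∈ s, a ∉ p := by
  classical
  induction h : s.card generalizing s with
  | zero =>
    rw [Finset.card_eq_zero] at h
    subst h
    exact ⟨1, one_pos, 0, zero_mem _, zero_mem _, by simp⟩
  | succ n ih =>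
    obtain ⟨p, hp⟩ : s.Nonempty := Finset.card_pos.1 (by omega)
    -- If all homogeneous elements of q lie in p, a homogeneous element avoiding p avoids q as well,
    -- and q can be dropped.
    by_cases hc : ∃ q ∈ s, q ≠ p ∧ ∀ i : ℤ, ∀ a ∈ 𝒜 i, a ∈ q → a ∈ p
    · obtain ⟨q, hq, hqp, hqa⟩ := hc
      obtain ⟨i, hi, a, ha, haJ, has⟩ := ih (s.erase q)
        (fun p hp => hs p (Finset.mem_of_mem_erase hp)) (by rw [Finset.card_erase_of_mem hq, h]; rfl)
      refine ⟨i, hi, a, ha, haJ, fun p' hp' hap => ?_⟩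
      by_cases hpq : p' = q
      · exact has p (Finset.mem_erase.2 ⟨hqp.symm, hp⟩) (hqa i a ha (hpq ▸ hap))
      · exact has p' (Finset.mem_erase.2 ⟨hpq, hp'⟩) hap
    push Not at hc
    obtain ⟨i, hi, a, ha, haJ, has⟩ := ih (s.erase p)
      (fun p hp => hs p (Finset.mem_of_mem_erase hp)) (by rw [Finset.card_erase_of_mem hp, h]; rfl)
    by_cases hap : a ∉ p
    · refine ⟨i, hi, a, ha, haJ, fun q hq => ?_⟩
      by_cases hqp : q = p
      · exact hqp ▸ hap
      · exact has q (Finset.mem_erase.2 ⟨hqp, hq⟩)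
    rw [not_not] at hap
    have hpp := (hs p hp).1
    -- An element of J outside p is multiplied by homogeneous elements of the other primes outside
    -- p. The product lies in J and in all other primes, but not in p.
    have hprod : ∀ t ⊆ s.erase p, ∃ j : ℕ, 0 < j ∧ ∃ b ∈ 𝒜 j, b ∈ J ∧ b ∉ p ∧ ∀ q ∈ t, b ∈ q := by
      intro t ht
      induction t using Finset.induction_on with
      | empty =>
        obtain ⟨j, hj, b, hb, hbJ, hbp⟩ := hJ p (hs p hp).2 hpp
        exact ⟨j, hj, b, hb, hbJ, hbp, by simp⟩
      | insert q t _ iht =>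
        obtain ⟨j, hj, b, hb, hbJ, hbp, hbt⟩ := iht ((Finset.subset_insert _ _).trans ht)
        obtain ⟨hqp, hqs⟩ := Finset.mem_erase.1 (ht (Finset.mem_insert_self _ _))
        obtain ⟨l, c, hc, hcq, hcp⟩ := hc q hqs hqp
        have hl : 0 ≤ l := by
          by_contra! hl
          rw [hneg l hl, AddSubgroup.mem_bot] at hc
          exact hcp (hc ▸ zero_mem p)
        lift l to ℕ using hl
        refine ⟨l + j, by omega, c * b, ?_, J.mul_mem_left c hbJ, fun h =>
          (hpp.mem_or_mem h).elim hcp hbp, ?_⟩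
        · rw [Nat.cast_add]
          exact SetLike.GradedMul.mul_mem hc hb
        · intro q' hq'
          obtain rfl | hq' := Finset.mem_insert.1 hq'
          · exact q'.mul_mem_right b hcq
          · exact q'.mul_mem_left c (hbt q' hq')
    obtain ⟨j, hj, b, hb, hbJ, hbp, hbs⟩ := hprod _ subset_rfl
    have hpow : ∀ (c : R) (i j : ℕ), c ∈ 𝒜 i → c ^ j ∈ 𝒜 ((i * j : ℕ) : ℤ) := by
      intro c i j hc
      have := SetLike.pow_mem_graded j hc
      rwa [nsmul_eq_mul, mul_comm, ← Nat.cast_mul] at this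
    -- The powers equalize the degrees of a and b. Each prime of s contains exactly one of a and b,
    -- so none contains the sum of the powers.
    refine ⟨i * j, Nat.mul_pos hi hj, a ^ j + b ^ i, add_mem (hpow a i j ha) ?_,
      add_mem (J.pow_mem_of_mem haJ j hj) (J.pow_mem_of_mem hbJ i hi), fun q hq hab => ?_⟩
    · rw [mul_comm]
      exact hpow b j i hb
    · have hqp := (hs q hq).1
      by_cases h : q = p
      · subst h
        exact hbp (hqp.mem_of_pow_mem i ((Ideal.add_mem_iff_right q (q.pow_mem_of_mem hap j hj)).1 hab))
      · have hq' := Finset.mem_erase.2 ⟨h, hq⟩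
        exact has q hq' (hqp.mem_of_pow_mem j
          ((Ideal.add_mem_iff_left q (q.pow_mem_of_mem (hbs q hq') i hi)).1 hab))

variable {K : Type v} [Field K] [Algebra K R]

namespace IsStandardGraded

variable (h : IsStandardGraded K 𝒜)

include h

lemma algebraMap_mem (c : K) : algebraMap K R c ∈ 𝒜 0 := by
  rw [h.zero]
  exact ⟨c, rfl⟩

lemma exists_sub_mem (x : R) : ∃ c : K, x - algebraMap K R c ∈ Ideal.span (𝒜 1 : Set R) := by
  have hx : x ∈ Algebra.adjoin K (𝒜 1 : Set R) := h.adjoin ▸ Algebra.mem_top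
  induction hx using Algebra.adjoin_induction with
  | mem x hx => exact ⟨0, by simpa using Ideal.subset_span hx⟩
  | algebraMap c => exact ⟨c, by simp⟩
  | add x y _ _ hx hy =>
    obtain ⟨c, hc⟩ := hx
    obtain ⟨d, hd⟩ := hy
    refine ⟨c + d, ?_⟩
    rw [map_add, add_sub_add_comm]
    exact add_mem hc hd
  | mul x y _ _ hx hy =>
    obtain ⟨c, hc⟩ := hx
    obtain ⟨d, hd⟩ := hy
    refine ⟨c * d, ?_⟩
    have : x * y - algebraMap K R (c * d) =
        y * (x - algebraMap K R c) + algebraMap K R c * (y - algebraMap K R d) := by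
      rw [map_mul]
      ring
    rw [this]
    exact add_mem (Ideal.mul_mem_left _ _ hc) (Ideal.mul_mem_left _ _ hd)

lemma eq_zero_of_neg {i : ℤ} (hi : i < 0) {x : R} (hx : x ∈ 𝒜 i) : x = 0 := by
  rwa [h.neg i hi] at hx

lemma mem_span_of_mem {i : ℤ} (hi : 0 < i) {x : R} (hx : x ∈ 𝒜 i) :
    x ∈ Ideal.span (𝒜 1 : Set R) := by
  obtain ⟨c, hc⟩ := h.exists_sub_mem x
  have h1 := isHomogIdeal_span (𝒜 := 𝒜) (S := (𝒜 1 : Set R)) (fun x hx => ⟨1, hx⟩) i _ hc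
  rwa [map_sub, rcomp_of_mem hx, rcomp_of_mem_ne (h.algebraMap_mem c) hi.ne, sub_zero] at h1

lemma isUnit_of_mem_zero {x : R} (hx : x ∈ 𝒜 0) (hx0 : x ≠ 0) : IsUnit x := by
  rw [h.zero] at hx
  obtain ⟨c, rfl⟩ := hx
  refine (IsUnit.mk0 c ?_).map (algebraMap K R)
  rintro rfl
  exact hx0 (map_zero (algebraMap K R))

lemma homogMaxIdeal_eq : homogMaxIdeal 𝒜 = Ideal.span (𝒜 1 : Set R) := by
  have := h.nontrivial
  refine le_antisymm (Ideal.span_le.2 ?_) (Ideal.span_mono fun x hx =>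
    ⟨⟨1, hx⟩, not_isUnit_of_mem h.neg one_pos hx⟩)
  rintro x ⟨⟨i, hx⟩, hu⟩
  obtain hi | rfl | hi := lt_trichotomy i 0
  · rw [h.eq_zero_of_neg hi hx]
    exact zero_mem _
  · rw [not_imp_comm.1 (h.isUnit_of_mem_zero hx) hu]
    exact zero_mem _
  · exact h.mem_span_of_mem hi hx

lemma rcomp_zero_eq_zero {x : R} (hx : x ∈ homogMaxIdeal 𝒜) : rcomp 𝒜 0 x = 0 := by
  rw [h.homogMaxIdeal_eq] at hx
  refine (AddSubgroup.mem_bot).1 (rcomp_mem_of_mem_span (𝒜 := 𝒜) (fun y hy r => ?_) hx)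
  rw [rcomp_mul_eq _ _ hy, h.eq_zero_of_neg (by omega) (rcomp_mem _ _), zero_mul]
  exact zero_mem _

lemma isMaximal : (homogMaxIdeal 𝒜).IsMaximal := by
  have := h.nontrivial
  refine Ideal.isMaximal_iff.2 ⟨fun h1 => ?_, fun J x hJ hx hxJ => ?_⟩
  · have := h.rcomp_zero_eq_zero h1
    rw [rcomp_of_mem SetLike.GradedOne.one_mem] at this
    exact one_ne_zero this
  · obtain ⟨c, hc⟩ := h.exists_sub_mem x
    rw [← h.homogMaxIdeal_eq] at hc
    have hc0 : c ≠ 0 := by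
      rintro rfl
      rw [map_zero, sub_zero] at hc
      exact hx hc
    have h1 : algebraMap K R c ∈ J := by
      have := J.sub_mem hxJ (hJ hc)
      rwa [sub_sub_cancel] at this
    have h2 := J.mul_mem_left (algebraMap K R c⁻¹) h1
    rwa [← map_mul, inv_mul_cancel₀ hc0, map_one] at h2

lemma exists_le_of_forall_mem {J : Ideal R} (hJ : IsHomogIdeal 𝒜 J) (hJm : J ≤ homogMaxIdeal 𝒜)
    {s : Set (Ideal R)} (hs : s.Finite) (hp : ∀ p ∈ s, p.IsPrime)
    (ha : ∀ i, ∀ a ∈ 𝒜 i, a ∈ J → ∃ p ∈ s, a ∈ p) : ∃ p ∈ s, J ≤ p := by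
  by_contra! H
  obtain ⟨i, -, a, hai, haJ, has⟩ := exists_homogeneous_notMem (𝒜 := 𝒜) (J := J) (fun p hp _ => by
    obtain ⟨x, hxJ, hxp⟩ := SetLike.not_le_iff_exists.1 hp
    obtain ⟨i, hi⟩ := IsHomogIdeal.exists_rcomp_notMem (𝒜 := 𝒜) hxp
    obtain hi0 | rfl | hi0 := lt_trichotomy i 0
    · rw [h.eq_zero_of_neg hi0 (rcomp_mem _ _)] at hi
      exact absurd (zero_mem _) hi
    · rw [h.rcomp_zero_eq_zero (hJm hxJ)] at hi
      exact absurd (zero_mem _) hi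
    · lift i to ℕ using hi0.le
      exact ⟨i, by exact_mod_cast hi0, _, rcomp_mem _ _, hJ _ _ hxJ, hi⟩) h.neg hs.toFinset
    fun p hps => ⟨hp p (hs.mem_toFinset.1 hps), H p (hs.mem_toFinset.1 hps)⟩
  obtain ⟨p, hps, hap⟩ := ha i a hai haJ
  exact has p (hs.mem_toFinset.2 hps) hap

/-- Products of a spanning set in degree n with finitely many ideal generators of degree one span
degree n + 1, because coefficients may be replaced by their components of degree n. -/
lemma exists_finite_span [IsNoetherianRing R] (n : ℕ) :
    ∃ t : Set R, t.Finite ∧ ∀ x ∈ 𝒜 n, x ∈ Submodule.span K t := by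
  obtain ⟨X, hX, hXspan⟩ := (Submodule.fg_span_iff_fg_span_finset_subset (𝒜 1 : Set R)).1
    (IsNoetherian.noetherian (Ideal.span (𝒜 1 : Set R)))
  induction n with
  | zero =>
    refine ⟨{1}, Set.finite_singleton 1, fun x hx => ?_⟩
    rw [Nat.cast_zero, h.zero] at hx
    obtain ⟨c, rfl⟩ := hx
    exact Submodule.mem_span_singleton.2 ⟨c, (Algebra.algebraMap_eq_smul_one c).symm⟩
  | succ n ih =>
    obtain ⟨t, ht, htn⟩ := ih
    refine ⟨Set.image2 (· * ·) t X, ht.image2 _ X.finite_toSet, fun x hx => ?_⟩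
    have hx1 : x ∈ Ideal.span (X : Set R) := hXspan.le (h.mem_span_of_mem (by omega) hx)
    rw [← rcomp_of_mem hx]
    refine rcomp_mem_of_mem_span (𝒜 := 𝒜) (N := (Submodule.span K _).toAddSubgroup) (fun y hy r => ?_) hx1
    rw [rcomp_mul_eq _ _ (hX hy)]
    have h1 := htn (rcomp 𝒜 (((n + 1 : ℕ) : ℤ) - 1) r)
      (by simpa using rcomp_mem (𝒜 := 𝒜) (((n + 1 : ℕ) : ℤ) - 1) r)
    generalize rcomp 𝒜 (((n + 1 : ℕ) : ℤ) - 1) r = z at h1 ⊢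
    change _ ∈ Submodule.span K _
    induction h1 using Submodule.span_induction with
    | mem z hz => exact Submodule.subset_span ⟨z, hz, y, hy, rfl⟩
    | zero => rw [zero_mul]; exact zero_mem _
    | add z w _ _ hz hw => rw [add_mul]; exact add_mem hz hw
    | smul c z _ hz => rw [smul_mul_assoc]; exact Submodule.smul_mem _ c hz

lemma mem_pow_of_mem (n : ℕ) {x : R} (hx : x ∈ 𝒜 n) : x ∈ homogMaxIdeal 𝒜 ^ n := by
  induction n generalizing x with
  | zero => simp
  | succ n ih =>
    rw [← rcomp_of_mem hx]
    refine rcomp_mem_of_mem_span (𝒜 := 𝒜) (N := (homogMaxIdeal 𝒜 ^ (n + 1)).toAddSubgroup)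
      (fun y hy r => ?_) (h.mem_span_of_mem (by omega) hx)
    rw [rcomp_mul_eq _ _ hy, pow_succ]
    refine Ideal.mul_mem_mul (ih ?_) (h.homogMaxIdeal_eq ▸ Ideal.subset_span hy)
    simpa using rcomp_mem (𝒜 := 𝒜) (((n + 1 : ℕ) : ℤ) - 1) r

end IsStandardGraded

end Graded

end ModuleLiaison

/-! ### The standard graded case: dimension and systems of parameters -/

namespace ModuleLiaison

lemma ringKrullDim_le_of_isIntegral {A B : Type*} [CommRing A] [CommRing B] [Algebra A B]
    [Algebra.IsIntegral A B] : ringKrullDim B ≤ ringKrullDim A :=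
  Order.krullDim_le_of_strictMono (PrimeSpectrum.comap (algebraMap A B)) fun p q hpq =>
    Ideal.IsIntegral.comap_lt_comap (I := p.asIdeal) (J := q.asIdeal) hpq

namespace IsStandardGraded

variable {R : Type u} [CommRing R] {𝒜 : ℤ → AddSubgroup R} [GradedRing 𝒜]
  {K : Type v} [Field K] [Algebra K R] (h : IsStandardGraded K 𝒜)

include h

/-- The quotient is finite over the polynomial ring in the elements of a system of parameters, by
the graded Nakayama lemma. -/
lemma ringKrullDim_quotient_le [IsNoetherianRing R] {J : Ideal R} (hJ : IsHomogIdeal 𝒜 J)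
    {ys : List R} (hys : ∀ y ∈ ys, y ∈ homogMaxIdeal 𝒜) (hyh : ∀ y ∈ ys, ∃ b, y ∈ 𝒜 b) {k : ℕ}
    (hk : homogMaxIdeal 𝒜 ^ k ≤ J ⊔ Ideal.ofList ys) : ringKrullDim (R ⧸ J) ≤ ys.length := by
  let f : MvPolynomial (Fin ys.length) K →ₐ[K] R := MvPolynomial.aeval ys.get
  let _ : Algebra (MvPolynomial (Fin ys.length) K) (R ⧸ J) :=
    ((Ideal.Quotient.mk J).comp f.toRingHom).toAlgebra
  have hsmul : ∀ (a : MvPolynomial (Fin ys.length) K) (x : R),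
      a • Ideal.Quotient.mk J x = Ideal.Quotient.mk J (f a * x) := fun a x => by
    rw [Algebra.smul_def, map_mul]
    rfl
  choose t ht htn using h.exists_finite_span
  let T : Set R := ⋃ n ∈ Finset.range k, t n
  have hT : T.Finite := (Finset.range k).finite_toSet.biUnion fun n _ => ht n
  let N : Submodule (MvPolynomial (Fin ys.length) K) (R ⧸ J) :=
    Submodule.span _ (Ideal.Quotient.mk J '' T)
  have hlow : ∀ n < k, ∀ x ∈ 𝒜 n, Ideal.Quotient.mk J x ∈ N := by
    intro n hn x hx
    have h1 := htn n x hx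
    clear hx
    induction h1 using Submodule.span_induction with
    | mem x hx =>
      exact Submodule.subset_span ⟨x, Set.mem_biUnion (Finset.mem_range.2 hn) hx, rfl⟩
    | zero => rw [map_zero]; exact zero_mem _
    | add x y _ _ hx hy => rw [map_add]; exact add_mem hx hy
    | smul c x _ hx =>
      have h2 := N.smul_mem (MvPolynomial.C c) hx
      rwa [hsmul, MvPolynomial.algHom_C, ← Algebra.smul_def] at h2
  -- In degrees at least k an element is, modulo J, a combination of the ys whose coefficients have
  -- smaller degree; degrees below k are covered by T.
  have hhom : ∀ n : ℕ, ∀ x ∈ 𝒜 n, Ideal.Quotient.mk J x ∈ N := by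
    intro n
    induction n using Nat.strong_induction_on with
    | _ n ih =>
      intro x hx
      by_cases hn : n < k
      · exact hlow n hn x hx
      obtain ⟨j, hj, z, hz, rfl⟩ := Submodule.mem_sup.1
        (hk (Ideal.pow_le_pow_right (not_lt.1 hn) (h.mem_pow_of_mem n hx)))
      rw [← rcomp_of_mem hx, map_add, map_add, Ideal.Quotient.eq_zero_iff_mem.2 (hJ _ _ hj),
        zero_add]
      refine rcomp_mem_of_mem_span
        (N := N.toAddSubgroup.comap (Ideal.Quotient.mk J).toAddMonoidHom) (fun y hy r => ?_) hz
      change Ideal.Quotient.mk J _ ∈ N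
      obtain ⟨b, hb⟩ := hyh y hy
      rw [rcomp_mul_eq _ _ hb]
      obtain ⟨l, rfl⟩ := List.mem_iff_get.1 hy
      have hfl : f (MvPolynomial.X l) = ys.get l := MvPolynomial.aeval_X _ _
      rw [mul_comm, ← hfl, ← hsmul]
      -- A homogeneous element of the irrelevant ideal of degree at most 0 vanishes. So only ys of
      -- positive degree matter, and the induction descends.
      by_cases hb0 : b ≤ 0
      · have h0 : ys.get l = 0 := by
          obtain hb0 | rfl := hb0.lt_or_eq
          · exact h.eq_zero_of_neg hb0 hb
          · rw [← rcomp_of_mem hb, h.rcomp_zero_eq_zero (hys _ hy)]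
        rw [hsmul, hfl, h0, zero_mul, map_zero]
        exact zero_mem _
      · refine N.smul_mem _ ?_
        have hr := rcomp_mem (𝒜 := 𝒜) ((n : ℤ) - b) r
        by_cases hnb : (n : ℤ) - b < 0
        · rw [h.eq_zero_of_neg hnb hr, map_zero]
          exact zero_mem _
        · generalize rcomp 𝒜 ((n : ℤ) - b) r = z at hr ⊢
          generalize hm : (n : ℤ) - b = m at hr hnb
          lift m to ℕ using not_lt.1 hnb
          exact ih m (by omega) z hr
  have hN : N = ⊤ := by
    refine Submodule.eq_top_iff'.2 fun x => ?_
    obtain ⟨x, rfl⟩ := Ideal.Quotient.mk_surjective x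
    obtain ⟨s, hs⟩ := exists_sum_rcomp 𝒜 x
    rw [hs, map_sum]
    refine sum_mem fun i _ => ?_
    have hr := rcomp_mem (𝒜 := 𝒜) i x
    by_cases hi : i < 0
    · rw [h.eq_zero_of_neg hi hr, map_zero]
      exact zero_mem _
    · lift i to ℕ using not_lt.1 hi
      exact hhom i _ hr
  have hfin : Module.Finite (MvPolynomial (Fin ys.length) K) (R ⧸ J) :=
    ⟨hN ▸ Submodule.fg_span (hT.image _)⟩
  refine (ringKrullDim_le_of_isIntegral (A := MvPolynomial (Fin ys.length) K)).trans ?_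
  rw [MvPolynomial.ringKrullDim_of_isNoetherianRing, ringKrullDim_eq_zero_of_field, zero_add,
    Nat.card_fin]

theorem goodGrading (hR : IsGorensteinRing R) : GoodGrading 𝒜 := by
  have := hR.noetherian
  exact ⟨hR, h.isMaximal, fun _ hJ hJm _ hs hp ha => h.exists_le_of_forall_mem hJ hJm hs hp ha,
    fun _ hJ _ hys hyh _ hk => h.ringKrullDim_quotient_le hJ hys hyh hk⟩

end IsStandardGraded

end ModuleLiaison
open ModuleLiaison in
theorem mainTheorem11 :
    -- the graded case
    (∀ (K : Type v) (R : Type u) [Field K] [CommRing R] [Algebra K R]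
      (𝒜 : ℤ → AddSubgroup R) [GradedRing 𝒜],
      IsStandardGraded K 𝒜 → IsGorensteinRing R →
        (∀ (M : GradedMod 𝒜) (j : ℤ), IsUnmixed M → SameEvenLiaisonClass M (M.shift j)) ∧
        (∀ D M : GradedMod 𝒜, IsQuasiGorenstein D → IsUnmixed M →
          Module.supportDim R M = Module.supportDim R D →
          LinkedInSteps 2 (M.directSum D) M)) ∧
    -- the local case: a ring graded by the one-element group is concentrated in degree zero
    (∀ (R : Type u) [CommRing R] [IsLocalRing R] (𝒜 : Unit → AddSubgroup R) [GradedRing 𝒜],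
      IsGorensteinRing R →
        ∀ D M : GradedMod 𝒜, IsQuasiGorenstein D → IsUnmixed M →
          Module.supportDim R M = Module.supportDim R D →
          LinkedInSteps 2 (M.directSum D) M) := by
  refine ⟨fun K R _ _ _ 𝒜 _ h hR => ?_, fun R _ _ 𝒜 _ hR D M hD hM hdim => ?_⟩
  · have := hR.noetherian
    exact ⟨fun M j hM => (h.goodGrading hR).sameEvenLiaisonClass_shift hM j,
      fun D M hD hM hdim => (h.goodGrading hR).linkedInSteps_two hD hM hdim⟩
  · have := hR.noetherian
    exact (GoodGrading.of_isLocalRing 𝒜 hR).linkedInSteps_two hD hM hdim
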